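/- Let $N\ge 3$ and $s\ge 0$. For $r\ge 0$ let $H^r=H^r(\mathbb R^N)$ be the Sobolev space with norm $\|f\|_{H^r}=\|(1-\Delta)^{r/2}f\|_{L^2(\mathbb R^N)}$, and for $T\in(0,\infty]$ let $X^r_T=L^\infty((0,T);H^r)\cap L^2((0,T);H^{r+1})$, with $\|w\|_{X^r_T}=\|w\|_{L^\infty((0,T);H^r)}+\|w\|_{L^2((0,T);H^{r+1})}$; write $X^r=X^r_\infty$. For a matrix field $F$ with values in $\mathbb R^{N^2}$ put $({\rm Div}F)_i=\sum_{j=1}^N\partial_jF_{ij}$. Consider the linear Stokes/heat system $$\begin{cases}\partial_tu-\Delta u+\nabla p={\rm Div}F,\quad {\rm div}\,u=0 & \text{in }(0,T)\times\mathbb R^N,\\ \partial_td-\Delta d=g & \text{in }(0,T)\times\mathbb R^N,\\ u(0)=u_0,\quad d(0)=d_0 & \text{in }\mathbb R^N,\end{cases}\qquad(\ast)$$ for $u,d$ with values in $\mathbb R^N$ and $p$ with values in $\mathbb R$, understood in the weak sense (tested against functions in $C_c^\infty([0,T)\times\mathbb R^N)$, so that the initial conditions are included). (1) Let $0<T<\infty$.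 There is a constant $C=C(N,s,T)$ such that for all $u_0\in H^s(\mathbb R^N;\mathbb R^N)$ with ${\rm div}\,u_0=0$, $d_0\in H^{s+1}(\mathbb R^N;\mathbb R^N)$, $F\in L^2((0,T);H^s(\mathbb R^N;\mathbb R^{N^2}))$ and $g\in L^2((0,T);H^s(\mathbb R^N;\mathbb R^N))$, the system $(\ast)$ has a solution $$(u,p,d)\in X^s_T\times L^2((0,T);L^2_{\rm loc}(\mathbb R^N))\times X^{s+1}_T,$$ which is unique in this class up to adding to $p$ a function $\rho(t)$ of time only, with $\rho\in L^2(0,T)$, and $$\|u\|_{X^s_T}+\|d\|_{X^{s+1}_T}\le C\left[\|u_0\|_{H^s}+\|d_0\|_{H^{s+1}}+\|F\|_{L^2((0,T);H^s)}+\|g\|_{L^2((0,T);H^s)}\right].$$ (2) Let $T=\infty$. There is a constant $C=C(N,s)$ such that, for all data as in (1) with $T=\infty$ which satisfy in addition $u_0,d_0\in L^1(\mathbb R^N;\mathbb R^N)$ and ${\rm Div}F,\,g\in L^1((0,\infty);L^1(\mathbb R^N;\mathbb R^N))$, the same existence and uniqueness statement holds on $(0,\infty)$, with $$\|u\|_{X^s}+\|d\|_{X^{s+1}}\le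 C\left[\|u_0\|_{H^s}+\|u_0\|_{L^1}+\|d_0\|_{H^{s+1}}+\|d_0\|_{L^1}+\|{\rm Div}F\|_{L^1((0,\infty);L^1)}+\|g\|_{L^1((0,\infty);L^1)}+\|F\|_{L^2((0,\infty);H^s)}+\|g\|_{L^2((0,\infty);H^s)}\right].$$ -/

import Mathlib

open MeasureTheory
open scoped ENNReal NNReal FourierTransform

noncomputable section

namespace StokesHeat

/-- The Euclidean space `ℝ^N`. -/
abbrev Sp (N : ℕ) : Type := EuclideanSpace ℝ (Fin N)

/-- The values of matrix fields: `ℝ^{N²}` with its Euclidean (Frobenius) norm. -/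
abbrev Mat (N : ℕ) : Type := EuclideanSpace ℝ (Fin N × Fin N)

/-- `L²(ℝ^N; V)`. -/
abbrev L2 (N : ℕ) (V : Type) [NormedAddCommGroup V] : Type :=
  Lp V 2 (volume : Measure (Sp N))

/-- The `k`-th coordinate of a real vector field of class `L²`, as a complex-valued `L²` function. -/
def coordC {N : ℕ} {ι : Type} [Fintype ι] (k : ι) (f : L2 N (EuclideanSpace ℝ ι)) : L2 N ℂ :=
  (Complex.ofRealCLM.comp (EuclideanSpace.proj k : EuclideanSpace ℝ ι →L[ℝ] ℝ)).compLp f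

/-- The norm of `H^s(ℝ^N; ℝ^ι)`, `s ≥ 0`, as an extended number:
`‖f‖_{H^s} = ‖(1 - Δ)^{s/2} f‖_{L²}`, and `f ∈ L²` belongs to `H^s` iff this is finite.
With the Fourier transform `∫ e^{-2πi x·ξ} f(x) dx`, the symbol of `1 - Δ` is
`1 + (2π|ξ|)²`. -/
def hsNorm {N : ℕ} {ι : Type} [Fintype ι] (s : ℝ) (f : L2 N (EuclideanSpace ℝ ι)) : ℝ≥0∞ :=
  (∑ k, ∫⁻ ξ : Sp N,
    ENNReal.ofReal ((1 + (2 * Real.pi * ‖ξ‖) ^ 2) ^ s) * ‖(𝓕 (coordC k f) : L2 N ℂ) ξ‖ₑ ^ 2)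
      ^ (1 / 2 : ℝ)

/-- The time interval `(0, T)`, where `T = ⊤` is allowed. -/
def timeInterval (T : EReal) : Set ℝ := {t | 0 < t ∧ (t : EReal) < T}

/-- Lebesgue measure on `(0, T)`. -/
def timeMeasure (T : EReal) : Measure ℝ := volume.restrict (timeInterval T)

/-- The norm of `L²((0,T); H^s)`. -/
def l2HsNorm {N : ℕ} {ι : Type} [Fintype ι] (T : EReal) (s : ℝ)
    (w : ℝ → L2 N (EuclideanSpace ℝ ι)) : ℝ≥0∞ :=
  (∫⁻ t, hsNorm s (w t) ^ 2 ∂(timeMeasure T)) ^ (1 / 2 : ℝ)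

/-- The norm of `L^∞((0,T); H^s)`. -/
def lInftyHsNorm {N : ℕ} {ι : Type} [Fintype ι] (T : EReal) (s : ℝ)
    (w : ℝ → L2 N (EuclideanSpace ℝ ι)) : ℝ≥0∞ :=
  essSup (fun t => hsNorm s (w t)) (timeMeasure T)

/-- Membership in `L²((0,T); H^s)`. Strong measurability as a map into `L²` together with
finiteness of the `H^s` norm is the same as strong measurability into the separable space `H^s`. -/
def MemL2Hs {N : ℕ} {ι : Type} [Fintype ι] (T : EReal) (s : ℝ)
    (w : ℝ → L2 N (EuclideanSpace ℝ ι)) : Prop :=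
  AEStronglyMeasurable w (timeMeasure T) ∧ l2HsNorm T s w < ∞

/-- The norm of `X^s_T = L^∞((0,T); H^s) ∩ L²((0,T); H^{s+1})`. -/
def xNorm {N : ℕ} {ι : Type} [Fintype ι] (T : EReal) (s : ℝ)
    (w : ℝ → L2 N (EuclideanSpace ℝ ι)) : ℝ≥0∞ :=
  lInftyHsNorm T s w + l2HsNorm T (s + 1) w

/-- Membership in `X^s_T`. -/
def MemX {N : ℕ} {ι : Type} [Fintype ι] (T : EReal) (s : ℝ)
    (w : ℝ → L2 N (EuclideanSpace ℝ ι)) : Prop :=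
  AEStronglyMeasurable w (timeMeasure T) ∧ xNorm T s w < ∞

/-- Membership in `L²((0,T); L²_loc(ℝ^N))`: on each compact set `K`, the function is (a.e.)
an element of the Bochner space `L²((0,T); L²(K))`. -/
def MemL2L2loc {N : ℕ} (T : EReal) (p : ℝ → Sp N → ℝ) : Prop :=
  ∀ K : Set (Sp N), IsCompact K →
    ∃ P : ℝ → Lp ℝ 2 (volume.restrict K : Measure (Sp N)),
      MemLp P 2 (timeMeasure T) ∧
        ∀ᵐ t ∂(timeMeasure T), p t =ᵐ[(volume.restrict K : Measure (Sp N))] P t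

/-- The partial derivative `∂_i ψ (x)`. -/
def pderiv {N : ℕ} (i : Fin N) (ψ : Sp N → ℝ) (x : Sp N) : ℝ :=
  fderiv ℝ ψ x (EuclideanSpace.single i 1)

/-- Test functions on `ℝ^N`. -/
def IsTest {N : ℕ} (ψ : Sp N → ℝ) : Prop := ContDiff ℝ ((⊤ : ℕ∞) : WithTop ℕ∞) ψ ∧ HasCompactSupport ψ

/-- Test functions on `[0,T) × ℝ^N`: restrictions of smooth functions on `ℝ × ℝ^N` with compact
support in `(-∞,T) × ℝ^N`. They need not vanish at `t = 0`. -/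
def IsSpaceTimeTest {N : ℕ} (T : EReal) (φ : ℝ × Sp N → ℝ) : Prop :=
  ContDiff ℝ ((⊤ : ℕ∞) : WithTop ℕ∞) φ ∧ HasCompactSupport φ ∧ ∀ z ∈ tsupport φ, (z.1 : EReal) < T

/-- The time derivative `∂_t φ (t, x)`. -/
def tderiv {N : ℕ} (φ : ℝ × Sp N → ℝ) (t : ℝ) (x : Sp N) : ℝ := deriv (fun τ => φ (τ, x)) t

/-- The spatial Laplacian `Δ φ (t, x)`. -/
def xlap {N : ℕ} (φ : ℝ × Sp N → ℝ) (t : ℝ) (x : Sp N) : ℝ :=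
  Laplacian.laplacian (fun y => φ (t, y)) x

/-- The spatial partial derivative `∂_i φ (t, x)`. -/
def xderiv {N : ℕ} (i : Fin N) (φ : ℝ × Sp N → ℝ) (t : ℝ) (x : Sp N) : ℝ :=
  pderiv i (fun y => φ (t, y)) x

/-- `div v = 0` in the sense of distributions on `ℝ^N`. -/
def IsDivFree {N : ℕ} (v : L2 N (Sp N)) : Prop :=
  ∀ ψ : Sp N → ℝ, IsTest ψ → ∫ x, ∑ j, v x j * pderiv j ψ x = 0

/-- `h = Div F` in the sense of distributions on `ℝ^N`, where `(Div F)_i = ∑_j ∂_j F_{ij}`. -/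
def IsDiv {N : ℕ} (F : L2 N (Mat N)) (h : Sp N → Sp N) : Prop :=
  ∀ (i : Fin N) (ψ : Sp N → ℝ), IsTest ψ →
    ∫ x, h x i * ψ x = - ∫ x, ∑ j, F x (i, j) * pderiv j ψ x

/-- `(u, p, d)` is a weak solution, in the class
`X^s_T × L²((0,T); L²_loc) × X^{s+1}_T`, of
`∂_t u - Δ u + ∇p = Div F`, `div u = 0`, `∂_t d - Δ d = g` in `(0,T) × ℝ^N`,
`u(0) = u₀`, `d(0) = d₀`.
The initial conditions are part of the weak formulation, as the test functions
need not vanish at `t = 0`. -/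
structure IsSolution {N : ℕ} (T : EReal) (s : ℝ) (u₀ d₀ : L2 N (Sp N))
    (F : ℝ → L2 N (Mat N)) (g : ℝ → L2 N (Sp N))
    (u : ℝ → L2 N (Sp N)) (p : ℝ → Sp N → ℝ) (d : ℝ → L2 N (Sp N)) : Prop where
  u_mem : MemX T s u
  p_mem : MemL2L2loc T p
  d_mem : MemX T (s + 1) d
  momentum : ∀ (i : Fin N) (φ : ℝ × Sp N → ℝ), IsSpaceTimeTest T φ →
    (∫ t, (∫ x, (u t x i * (tderiv φ t x + xlap φ t x) + p t x * xderiv i φ t x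
        - ∑ j, F t x (i, j) * xderiv j φ t x)) ∂(timeMeasure T))
      + ∫ x, u₀ x i * φ (0, x) = 0
  incompressible : ∀ᵐ t ∂(timeMeasure T), IsDivFree (u t)
  heat : ∀ (i : Fin N) (φ : ℝ × Sp N → ℝ), IsSpaceTimeTest T φ →
    (∫ t, (∫ x, (d t x i * (tderiv φ t x + xlap φ t x) + g t x i * φ (t, x))) ∂(timeMeasure T))
      + ∫ x, d₀ x i * φ (0, x) = 0

/-- `(u, p, d)` is a solution, and the solutions are exactly the triples that are obtained from it
by adding to the pressure a function `ρ ∈ L²(0,T)` of time (functions being identified when they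
agree almost everywhere). -/
def IsUniqueSolution {N : ℕ} (T : EReal) (s : ℝ) (u₀ d₀ : L2 N (Sp N))
    (F : ℝ → L2 N (Mat N)) (g : ℝ → L2 N (Sp N))
    (u : ℝ → L2 N (Sp N)) (p : ℝ → Sp N → ℝ) (d : ℝ → L2 N (Sp N)) : Prop :=
  IsSolution T s u₀ d₀ F g u p d ∧
    ∀ (u' : ℝ → L2 N (Sp N)) (p' : ℝ → Sp N → ℝ) (d' : ℝ → L2 N (Sp N)),
      IsSolution T s u₀ d₀ F g u' p' d' ↔
        u' =ᵐ[timeMeasure T] u ∧ d' =ᵐ[timeMeasure T] d ∧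
          ∃ ρ : ℝ → ℝ, MemLp ρ 2 (timeMeasure T) ∧
            ∀ᵐ t ∂(timeMeasure T), ∀ᵐ x : Sp N, p' t x = p t x + ρ t

end StokesHeat

end

/-!
The fields are constructed and compared on the frequency side. With `λ = |2πξ|²`, both equations
become scalar equations `∂ₜy + λ y = f` for almost every frequency `ξ`: for `d` the forcing is `ĝ`,
and for `u` it is the transform of `Div F - ∇p`, where `p̂ = ∑ ξ_k ξ_l F̂_{kl} / |ξ|²` is chosen such
that this forcing is orthogonal to `ξ` (`pressureHat`, `stokesForcing`). The solution is given by
Duhamel's formula, and `u` stays divergence-free because `u₀` is (`exists_solution`).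

The bounds only depend on the mass `∫₀ᵀ e^{-λ r} dr` of the kernel. By the inequalities of
Cauchy-Schwarz and Young, a mass of size `κ / (1 + λ)` yields the `L^∞ H^r` and `L² H^{r+1}` norms
from the initial value in `H^r` and the forcing in `L² H^{r-1}` (`heatSol_energy`). If `T` is finite
this holds at all frequencies with `κ = T + 1`. If `T = ∞` the mass is `1 / λ`, which is comparable
with `1 / (1 + λ)` only for `|ξ| ≥ 1`. For `|ξ| < 1` the `L¹` norms of `u₀`, `d₀`, `Div F` and `g`
bound the transforms of the data uniformly in `ξ`, hence also the solution, and the remaining factor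
`1 / λ` is integrable near the origin because `N ≥ 3` (`exists_heatSol_energy_top`).

For uniqueness, the difference of two solutions has zero data. Products `θ(t) η(x)` as test
functions turn the weak equations into equations for the Fourier transforms; for frequencies in a
ball these are linear equations `z' = -Λ z` with a bounded operator `Λ`, whose weak solutions with
zero initial value vanish after mollification in time (`ae_eq_zero_of_weak_ode`,
`ae_eq_zero_of_weak_freq`). This settles `d` directly. For `u`, testing the `i`-th equation with
`∂_j η` and the `j`-th with `∂_i η` eliminates the pressure, so that the curl of the difference
vanishes; so does its divergence, and hence the difference (`ae_eq_zero_of_weak_curl`). The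
difference of the pressures has zero gradient at almost every time and is therefore a function of
time (`exists_pressure_shift`).
-/

noncomputable section

namespace StokesHeat

open Filter Topology

/-! ### Jointly measurable representatives of maps into `L²` -/

section Representatives

variable {α X V : Type*} [MeasurableSpace α] [MeasurableSpace X] {μ : Measure X}
  [NormedAddCommGroup V]

/-- A map into a separable metric space whose distances to all fixed points are measurable is
approximated, at any prescribed rate, by values of a fixed sequence with measurably chosen
indices. -/
theorem exists_measurable_index {Y : Type*} [MetricSpace Y] [SecondCountableTopology Y]
    [Nonempty Y] (w : α → Y) (hw : ∀ e, Measurable fun t => dist e (w t)) :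
    ∃ k : ℕ → α → ℕ, (∀ n, Measurable (k n)) ∧
      ∀ n t, dist (TopologicalSpace.denseSeq Y (k n t)) (w t) < (1 / 2) ^ n := by
  classical
  have hex : ∀ (n : ℕ) (t : α), ∃ j, dist (TopologicalSpace.denseSeq Y j) (w t) < (1 / 2) ^ n := by
    intro n t
    obtain ⟨j, hj⟩ := (TopologicalSpace.denseRange_denseSeq Y).exists_dist_lt (w t)
      (ε := (1 / 2) ^ n) (by positivity)
    exact ⟨j, by rwa [dist_comm]⟩
  refine ⟨fun n t => Nat.find (hex n t), fun n => measurable_find (hex n) fun j => ?_,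
    fun n t => Nat.find_spec (hex n t)⟩
  exact measurableSet_lt (hw _) measurable_const

/-- Strong measurability follows from measurability of the distances to fixed points. For maps into
`L²` these are integrals depending on a parameter. -/
theorem stronglyMeasurable_of_dist {Y : Type*} [MetricSpace Y] [SecondCountableTopology Y]
    [Nonempty Y] (w : α → Y) (hw : ∀ e, Measurable fun t => dist e (w t)) :
    StronglyMeasurable w := by
  obtain ⟨k, hk, hkd⟩ := exists_measurable_index w hw
  refine stronglyMeasurable_of_tendsto atTop
    (f := fun n t => TopologicalSpace.denseSeq Y (k n t)) (fun n => ?_) ?_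
  · borelize Y
    exact ((measurable_from_nat).comp (hk n)).stronglyMeasurable
  · rw [tendsto_pi_nhds]
    intro t
    rw [tendsto_iff_dist_tendsto_zero]
    refine squeeze_zero (fun _ => dist_nonneg) (fun n => (hkd n t).le) ?_
    exact tendsto_pow_atTop_nhds_zero_of_lt_one (by norm_num) (by norm_num)

/-- A jointly measurable function whose slices are in `L²` defines a strongly measurable map into
`L²`. -/
theorem stronglyMeasurable_of_joint [SFinite μ] [SecondCountableTopology (Lp V 2 μ)]
    (G : α × X → V) (hG : StronglyMeasurable G) (w : α → Lp V 2 μ)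
    (hw : ∀ t, w t =ᵐ[μ] fun x => G (t, x)) : StronglyMeasurable w := by
  apply stronglyMeasurable_of_dist
  intro e
  have h : ∀ t, dist e (w t) = ((∫⁻ x, ‖e x - G (t, x)‖ₑ ^ (2 : ℝ) ∂μ) ^ (1 / 2 : ℝ)).toReal := by
    intro t
    rw [Lp.dist_def, eLpNorm_eq_lintegral_rpow_enorm_toReal (by norm_num) (by norm_num)]
    simp only [ENNReal.toReal_ofNat]
    congr 2
    apply lintegral_congr_ae
    filter_upwards [hw t] with x hx
    simp [hx]
  simp_rw [h]
  refine (Measurable.pow_const ?_ _).ennreal_toReal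
  refine Measurable.lintegral_prod_right (f := fun t x => ‖e x - G (t, x)‖ₑ ^ (2 : ℝ)) ?_
  exact ((((Lp.stronglyMeasurable e).comp_measurable measurable_snd).sub hG).enorm).pow_const _

/-- A sequence in `Lp` with measurable index, evaluated pointwise, is jointly measurable. -/
theorem stronglyMeasurable_uncurry_seq (e : ℕ → Lp V 2 μ) (k : α → ℕ) (hk : Measurable k) :
    StronglyMeasurable (fun z : α × X => e (k z.1) z.2) := by
  have h1 : StronglyMeasurable (fun z : ℕ × X => e z.1 z.2) := by
    refine stronglyMeasurable_of_tendsto atTop (f := fun (n : ℕ) (z : ℕ × X) =>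
      ∑ j ∈ Finset.range n, Set.indicator {z : ℕ × X | z.1 = j} (fun z => e j z.2) z)
      (fun n => ?_) ?_
    · refine Finset.stronglyMeasurable_fun_sum _ fun j _ => ?_
      exact ((Lp.stronglyMeasurable _).comp_measurable measurable_snd).indicator
        (measurable_fst (measurableSet_singleton j))
    · rw [tendsto_pi_nhds]
      intro z
      refine tendsto_const_nhds.congr' ?_
      filter_upwards [eventually_gt_atTop z.1] with n hn
      rw [Finset.sum_eq_single z.1]
      · simp
      · intro j _ hj
        simp [Ne.symm hj]
      · intro h
        exact absurd (Finset.mem_range.2 hn) h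
  exact h1.comp_measurable ((hk.comp measurable_fst).prodMk measurable_snd)

/-- Fast convergence in `L²` implies pointwise convergence almost everywhere. -/
theorem ae_tendsto_of_dist_lt [CompleteSpace V] (f : ℕ → Lp V 2 μ) (g : Lp V 2 μ)
    (h : ∀ n, dist (f n) g < (1 / 2) ^ n) :
    ∀ᵐ x ∂μ, Tendsto (fun n => f n x) atTop (𝓝 (g x)) := by
  have hlim : Tendsto f atTop (𝓝 g) := by
    rw [tendsto_iff_dist_tendsto_zero]
    refine squeeze_zero (fun _ => dist_nonneg) (fun n => (h n).le) ?_
    exact tendsto_pow_atTop_nhds_zero_of_lt_one (by norm_num) (by norm_num)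
  have hcau : ∀ᵐ x ∂μ, ∃ l, Tendsto (fun n => f n x) atTop (𝓝 l) := by
    refine Lp.ae_tendsto_of_cauchy_eLpNorm (p := 2) (fun n => Lp.aestronglyMeasurable _)
      (by norm_num) (B := fun n => ENNReal.ofReal (2 * (1 / 2) ^ n)) ?_ ?_
    · rw [← ENNReal.ofReal_tsum_of_nonneg]
      · exact ENNReal.ofReal_ne_top
      · intro n; positivity
      · exact (summable_geometric_of_lt_one (by norm_num) (by norm_num)).mul_left 2
    · intro N n m hn hm
      rw [← eLpNorm_congr_ae (Lp.coeFn_sub (f n) (f m)), ← Lp.enorm_def, ← ofReal_norm,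
        ← dist_eq_norm]
      refine (ENNReal.ofReal_lt_ofReal_iff (by positivity)).2 ?_
      calc dist (f n) (f m) ≤ dist (f n) g + dist (f m) g := dist_triangle_right _ _ _
        _ < (1 / 2) ^ n + (1 / 2) ^ m := add_lt_add (h n) (h m)
        _ ≤ (1 / 2) ^ N + (1 / 2) ^ N := add_le_add
            (pow_le_pow_of_le_one (by norm_num) (by norm_num) hn)
            (pow_le_pow_of_le_one (by norm_num) (by norm_num) hm)
        _ = 2 * (1 / 2) ^ N := by ring
  obtain ⟨ns, hns, hsub⟩ := (tendstoInMeasure_of_tendsto_Lp hlim).exists_seq_tendsto_ae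
  filter_upwards [hcau, hsub] with x ⟨l, hl⟩ hx
  have : l = g x := tendsto_nhds_unique (hl.comp hns.tendsto_atTop) hx
  rwa [← this]

/-- A strongly measurable map into `L²` is represented by a jointly measurable function. -/
theorem exists_joint_representative [CompleteSpace V]
    [SecondCountableTopology (Lp V 2 μ)] {τ : Measure α} (w : α → Lp V 2 μ)
    (hw : AEStronglyMeasurable w τ) :
    ∃ G : α × X → V, StronglyMeasurable G ∧ ∀ᵐ t ∂τ, w t =ᵐ[μ] fun x => G (t, x) := by
  obtain ⟨k, hk, hkd⟩ := exists_measurable_index (hw.mk w)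
    fun e => (stronglyMeasurable_const.dist hw.stronglyMeasurable_mk).measurable
  have hG : ∀ n, StronglyMeasurable
      fun z : α × X => TopologicalSpace.denseSeq (Lp V 2 μ) (k n z.1) z.2 :=
    fun n => stronglyMeasurable_uncurry_seq _ _ (hk n)
  refine ⟨fun z => limUnder atTop fun n => TopologicalSpace.denseSeq (Lp V 2 μ) (k n z.1) z.2,
    StronglyMeasurable.limUnder hG, ?_⟩
  filter_upwards [hw.ae_eq_mk] with t ht
  rw [ht]
  filter_upwards [ae_tendsto_of_dist_lt
    (fun n => TopologicalSpace.denseSeq (Lp V 2 μ) (k n t)) _ (fun n => hkd n t)] with x hx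
  exact hx.limUnder_eq.symm

end Representatives

open Set

/-! ### Duhamel's formula for the scalar equation `y' + λ y = f` -/

section Scalar

theorem ennreal_add_sq_le (a b : ℝ≥0∞) : (a + b) ^ 2 ≤ 2 * a ^ 2 + 2 * b ^ 2 := by
  by_cases ha : a = ∞
  · simp [ha]
  by_cases hb : b = ∞
  · simp [hb]
  lift a to ℝ≥0 using ha
  lift b to ℝ≥0 using hb
  norm_cast
  rw [← NNReal.coe_le_coe]
  push_cast
  nlinarith [sq_nonneg ((a : ℝ) - b)]

/-- The Cauchy-Schwarz inequality for the measure with density `k`. -/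
theorem sq_lintegral_mul_le {α : Type*} [MeasurableSpace α] (μ : Measure α) {k a : α → ℝ≥0∞}
    (hk : AEMeasurable k μ) (ha : AEMeasurable a μ) :
    (∫⁻ x, k x * a x ∂μ) ^ 2 ≤ (∫⁻ x, k x ∂μ) * ∫⁻ x, k x * a x ^ 2 ∂μ := by
  have hpq : (2 : ℝ).HolderConjugate 2 := by constructor <;> norm_num
  have h := ENNReal.lintegral_mul_le_Lp_mul_Lq μ hpq (hk.pow_const (1 / 2 : ℝ))
    ((hk.pow_const (1 / 2 : ℝ)).mul ha)
  have e1 : ∀ x, (k x ^ (1 / 2 : ℝ)) * (k x ^ (1 / 2 : ℝ)) = k x := fun x => by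
    rw [← ENNReal.rpow_add_of_nonneg _ _ (by norm_num) (by norm_num)]; norm_num
  have e2 : ∀ z : ℝ≥0∞, (z ^ (1 / 2 : ℝ)) ^ 2 = z := fun z => by
    rw [← ENNReal.rpow_natCast, ← ENNReal.rpow_mul]; norm_num
  have e3 : ∀ x, (fun x => (k x ^ (1 / 2 : ℝ))) x * ((fun x => (k x ^ (1 / 2 : ℝ))) * a) x =
      k x * a x := fun x => by
    simp only [Pi.mul_apply]
    rw [← mul_assoc, e1]
  have e4 : ∀ x, (((fun x => (k x ^ (1 / 2 : ℝ))) * a) x) ^ (2 : ℝ) = k x * a x ^ 2 := fun x => by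
    simp only [Pi.mul_apply]
    rw [ENNReal.rpow_ofNat, mul_pow, e2]
  have e5 : ∀ x, (k x ^ (1 / 2 : ℝ)) ^ (2 : ℝ) = k x := fun x => by
    rw [← ENNReal.rpow_mul]; norm_num
  simp only [Pi.mul_apply] at h e4 e3
  simp only [e3, e4, e5] at h
  calc _ ≤ ((∫⁻ x, k x ∂μ) ^ (1 / 2 : ℝ) * (∫⁻ x, k x * a x ^ 2 ∂μ) ^ (1 / 2 : ℝ)) ^ 2 := by
        gcongr
    _ = _ := by rw [mul_pow, e2, e2]

/-- The kernel `r ↦ e^{-λ r}` on `r > 0`, extended by zero. -/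
def expKernel (lam r : ℝ) : ℝ := if 0 < r then Real.exp (-(lam * r)) else 0

theorem measurable_expKernel : Measurable fun z : ℝ × ℝ => expKernel z.1 z.2 := by
  unfold expKernel
  refine Measurable.ite (measurableSet_lt measurable_const measurable_snd) ?_ measurable_const
  fun_prop

theorem expKernel_nonneg (lam r : ℝ) : 0 ≤ expKernel lam r := by
  unfold expKernel; split_ifs <;> positivity

theorem expKernel_le_one {lam : ℝ} (hl : 0 ≤ lam) (r : ℝ) : expKernel lam r ≤ 1 := by
  unfold expKernel
  split_ifs with h
  · exact Real.exp_le_one_iff.2 (by nlinarith)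
  · norm_num

theorem measurableSet_timeInterval (T : EReal) : MeasurableSet (timeInterval T) := by
  unfold timeInterval
  exact (measurableSet_lt measurable_const measurable_id).inter
    (measurableSet_lt measurable_coe_real_ereal measurable_const)

instance (T : EReal) : SFinite (timeMeasure T) := by unfold timeMeasure; infer_instance

theorem ae_mem_timeInterval (T : EReal) : ∀ᵐ t ∂(timeMeasure T), t ∈ timeInterval T :=
  ae_restrict_mem (measurableSet_timeInterval T)

/-- The mass of the kernel `e^{-λ r}` on `(0, T)`. For `T = ∞` and `λ = 0` it is infinite. -/
def kernelMass (T : EReal) (lam : ℝ) : ℝ≥0∞ :=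
  ∫⁻ r, ENNReal.ofReal (expKernel lam r) ∂(timeMeasure T)

theorem measurable_expKernel_right (lam : ℝ) : Measurable fun r => expKernel lam r :=
  measurable_expKernel.comp (measurable_const.prodMk measurable_id)

theorem lintegral_kernel_sub_le {T : EReal} {lam t : ℝ} (ht : t ∈ timeInterval T) :
    ∫⁻ s, ENNReal.ofReal (expKernel lam (t - s)) ∂(timeMeasure T) ≤ kernelMass T lam := by
  unfold kernelMass timeMeasure
  rw [← lintegral_indicator (measurableSet_timeInterval T),
    ← lintegral_indicator (measurableSet_timeInterval T),
    ← lintegral_sub_left_eq_self (fun r => (timeInterval T).indicator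
      (fun r => ENNReal.ofReal (expKernel lam r)) r) t]
  refine lintegral_mono fun s => ?_
  by_cases hs : s ∈ timeInterval T
  · rw [indicator_of_mem hs]
    by_cases hst : 0 < t - s
    · rw [indicator_of_mem]
      refine ⟨hst, lt_of_le_of_lt ?_ ht.2⟩
      exact EReal.coe_le_coe_iff.2 (by linarith [hs.1])
    · simp [expKernel, hst]
  · rw [indicator_of_notMem hs]; exact zero_le

theorem lintegral_kernel_sub_le' {T : EReal} {lam s : ℝ} (hs : s ∈ timeInterval T) :
    ∫⁻ t, ENNReal.ofReal (expKernel lam (t - s)) ∂(timeMeasure T) ≤ kernelMass T lam := by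
  unfold kernelMass timeMeasure
  rw [← lintegral_indicator (measurableSet_timeInterval T),
    ← lintegral_indicator (measurableSet_timeInterval T),
    ← lintegral_sub_right_eq_self (fun r => (timeInterval T).indicator
      (fun r => ENNReal.ofReal (expKernel lam r)) r) s]
  refine lintegral_mono fun t => ?_
  by_cases ht : t ∈ timeInterval T
  · rw [indicator_of_mem ht]
    by_cases hst : 0 < t - s
    · rw [indicator_of_mem]
      refine ⟨hst, lt_of_le_of_lt ?_ ht.2⟩
      exact EReal.coe_le_coe_iff.2 (by linarith [hs.1])
    · simp [expKernel, hst]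
  · rw [indicator_of_notMem ht]; exact zero_le

/-- For finite `T`, `∫₀ᵀ e^{-λ r} dr ≤ (T + 1) / (1 + λ)`. -/
theorem kernelMass_le {T : ℝ} (hT : 0 < T) {lam : ℝ} (hl : 0 ≤ lam) :
    kernelMass (T : EReal) lam ≤ ENNReal.ofReal ((T + 1) / (1 + lam)) := by
  have hI : timeInterval (T : EReal) = Ioo 0 T := by
    ext t; simp [timeInterval]
  have h1 : kernelMass (T : EReal) lam =
      ENNReal.ofReal (∫ r in (0 : ℝ)..T, Real.exp (-(lam * r))) := by
    unfold kernelMass timeMeasure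
    rw [hI, intervalIntegral.integral_of_le hT.le, integral_Ioc_eq_integral_Ioo,
      ofReal_integral_eq_lintegral_ofReal]
    · refine setLIntegral_congr_fun measurableSet_Ioo fun r hr => ?_
      simp [expKernel, hr.1]
    · exact (Continuous.integrableOn_Icc (by fun_prop)).mono_set Ioo_subset_Icc_self
    · exact ae_of_all _ fun r => (Real.exp_pos _).le
  rw [h1]
  apply ENNReal.ofReal_le_ofReal
  rw [le_div_iff₀ (by positivity)]
  have h2 : (∫ r in (0 : ℝ)..T, Real.exp (-(lam * r))) * lam = 1 - Real.exp (-(lam * T)) := by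
    rw [← intervalIntegral.integral_mul_const]
    rw [intervalIntegral.integral_eq_sub_of_hasDerivAt
      (f := fun r => -Real.exp (-(lam * r)))]
    · simp; ring
    · intro r _
      have h := (((hasDerivAt_id' r).const_mul lam).fun_neg.exp).fun_neg
      simpa using h
    · apply Continuous.intervalIntegrable; fun_prop
  have h3 : (∫ r in (0 : ℝ)..T, Real.exp (-(lam * r))) ≤ T := by
    calc _ ≤ ∫ r in (0 : ℝ)..T, (1 : ℝ) := by
          apply intervalIntegral.integral_mono_on hT.le
          · apply Continuous.intervalIntegrable; fun_prop
          · simp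
          · intro r hr
            exact Real.exp_le_one_iff.2 (by nlinarith [hr.1])
      _ = T := by simp
  have := Real.exp_pos (-(lam * T))
  -- the mass is at most `T`, and `λ` times the mass is at most `1`
  nlinarith

theorem kernelMass_top_le {lam : ℝ} (hl : 0 < lam) :
    kernelMass ⊤ lam ≤ ENNReal.ofReal (1 / lam) := by
  have hI : timeInterval ⊤ = Ioi 0 := by
    ext t; simp [timeInterval, EReal.coe_lt_top]
  have hint : IntegrableOn (fun r : ℝ => Real.exp (-lam * r)) (Ioi 0) :=
    integrableOn_exp_mul_Ioi (by linarith) 0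
  unfold kernelMass timeMeasure
  rw [hI]
  calc _ = ∫⁻ r in Ioi (0 : ℝ), ENNReal.ofReal (Real.exp (-lam * r)) := by
        refine setLIntegral_congr_fun measurableSet_Ioi fun r hr => ?_
        simp [expKernel, mem_Ioi.1 hr]
    _ = ENNReal.ofReal (∫ r in Ioi (0 : ℝ), Real.exp (-lam * r)) := by
        rw [ofReal_integral_eq_lintegral_ofReal hint (ae_of_all _ fun r => (Real.exp_pos _).le)]
    _ ≤ _ := by
        rw [integral_exp_mul_Ioi (by linarith)]
        simp [neg_div_neg_eq]

/-- The solution of `y' + λ y = f`, `y(0) = y₀`, on `(0, T)`, by Duhamel's formula. As the kernel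
vanishes at negative times, the integral extends over `(0, T)` instead of `(0, t)`. -/
def duhamel (T : EReal) (lam : ℝ) (y₀ : ℂ) (f : ℝ → ℂ) (t : ℝ) : ℂ :=
  (Real.exp (-(lam * t)) : ℂ) * y₀ + ∫ s, (expKernel lam (t - s) : ℂ) * f s ∂(timeMeasure T)

/-- The convolution of the kernel with a nonnegative function on `(0, T)`. -/
def kernelConv (T : EReal) (lam : ℝ) (a : ℝ → ℝ≥0∞) (t : ℝ) : ℝ≥0∞ :=
  ∫⁻ s, ENNReal.ofReal (expKernel lam (t - s)) * a s ∂(timeMeasure T)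

theorem measurable_kernel_sub (lam t : ℝ) :
    Measurable fun s => ENNReal.ofReal (expKernel lam (t - s)) :=
  ((measurable_expKernel_right lam).comp (measurable_const.sub measurable_id)).ennreal_ofReal

theorem measurable_kernel_sub₂ (lam : ℝ) :
    Measurable fun z : ℝ × ℝ => ENNReal.ofReal (expKernel lam (z.1 - z.2)) :=
  ((measurable_expKernel_right lam).comp (measurable_fst.sub measurable_snd)).ennreal_ofReal

theorem measurable_kernelConv {T : EReal} {lam : ℝ} {a : ℝ → ℝ≥0∞} (ha : Measurable a) :
    Measurable (kernelConv T lam a) := by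
  unfold kernelConv
  exact Measurable.lintegral_prod_right
    (f := fun t s => ENNReal.ofReal (expKernel lam (t - s)) * a s)
    ((measurable_kernel_sub₂ lam).mul (ha.comp measurable_snd))

theorem kernel_le_one {lam : ℝ} (hl : 0 ≤ lam) (r : ℝ) : ENNReal.ofReal (expKernel lam r) ≤ 1 :=
  ENNReal.ofReal_le_one.2 (expKernel_le_one hl r)

theorem kernelConv_le {T : EReal} {lam : ℝ} (hl : 0 ≤ lam) (a : ℝ → ℝ≥0∞) (t : ℝ) :
    kernelConv T lam a t ≤ ∫⁻ s, a s ∂(timeMeasure T) :=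
  lintegral_mono fun _ => mul_le_of_le_one_left zero_le (kernel_le_one hl _)

theorem lintegral_kernelConv_le {T : EReal} {lam : ℝ} {a : ℝ → ℝ≥0∞}
    (ha : Measurable a) :
    ∫⁻ t, kernelConv T lam a t ∂(timeMeasure T) ≤
      kernelMass T lam * ∫⁻ s, a s ∂(timeMeasure T) := by
  unfold kernelConv
  rw [lintegral_lintegral_swap, ← lintegral_const_mul _ ha]
  · refine lintegral_mono_ae ?_
    filter_upwards [ae_mem_timeInterval T] with s hs
    have hm : Measurable fun t => ENNReal.ofReal (expKernel lam (t - s)) :=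
      ((measurable_expKernel_right lam).comp (measurable_id.sub measurable_const)).ennreal_ofReal
    rw [lintegral_mul_const _ hm]
    gcongr
    exact lintegral_kernel_sub_le' hs
  · exact ((measurable_kernel_sub₂ lam).mul (ha.comp measurable_snd)).aemeasurable

theorem sq_kernelConv_le {T : EReal} {lam : ℝ} {a : ℝ → ℝ≥0∞}
    (ha : Measurable a) {t : ℝ} (ht : t ∈ timeInterval T) :
    kernelConv T lam a t ^ 2 ≤ kernelMass T lam * kernelConv T lam (fun s => a s ^ 2) t := by
  unfold kernelConv
  refine (sq_lintegral_mul_le _ (measurable_kernel_sub lam t).aemeasurable ha.aemeasurable).trans ?_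
  gcongr
  exact lintegral_kernel_sub_le ht

theorem enorm_duhamel_le (T : EReal) (lam : ℝ) (y₀ : ℂ) (f : ℝ → ℂ) {t : ℝ} (ht : 0 < t) :
    ‖duhamel T lam y₀ f t‖ₑ ≤ ENNReal.ofReal (expKernel lam t) * ‖y₀‖ₑ +
      kernelConv T lam (fun s => ‖f s‖ₑ) t := by
  unfold duhamel kernelConv
  refine (enorm_add_le _ _).trans (add_le_add ?_ ?_)
  · rw [enorm_mul]
    gcongr
    simp only [expKernel, ht, if_true]
    rw [← ofReal_norm, Complex.norm_real, Real.norm_of_nonneg (Real.exp_pos _).le]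
  · refine (enorm_integral_le_lintegral_enorm _).trans (le_of_eq ?_)
    congr 1
    funext s
    rw [enorm_mul, ← ofReal_norm, Complex.norm_real, Real.norm_of_nonneg (expKernel_nonneg _ _)]

theorem sq_enorm_duhamel_le {T : EReal} {lam : ℝ} (hl : 0 ≤ lam) (y₀ : ℂ) {f : ℝ → ℂ}
    (hf : Measurable f) {t : ℝ} (ht : t ∈ timeInterval T) :
    ‖duhamel T lam y₀ f t‖ₑ ^ 2 ≤ 2 * ‖y₀‖ₑ ^ 2 +
      2 * (kernelMass T lam * ∫⁻ s, ‖f s‖ₑ ^ 2 ∂(timeMeasure T)) := by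
  calc _ ≤ (‖y₀‖ₑ + kernelConv T lam (fun s => ‖f s‖ₑ) t) ^ 2 := by
        gcongr
        refine (enorm_duhamel_le T lam y₀ f ht.1).trans ?_
        gcongr
        exact mul_le_of_le_one_left zero_le (kernel_le_one hl _)
    _ ≤ _ := ennreal_add_sq_le _ _
    _ ≤ _ := by
        gcongr
        refine (sq_kernelConv_le hf.enorm ht).trans ?_
        gcongr
        exact kernelConv_le hl _ _

/-- Young's inequality for the convolution with the kernel, in `L²(0, T)`. -/
theorem lintegral_sq_enorm_duhamel_le {T : EReal} {lam : ℝ} (hl : 0 ≤ lam) (y₀ : ℂ) {f : ℝ → ℂ}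
    (hf : Measurable f) :
    ∫⁻ t, ‖duhamel T lam y₀ f t‖ₑ ^ 2 ∂(timeMeasure T) ≤ 2 * (kernelMass T lam * ‖y₀‖ₑ ^ 2) +
      2 * (kernelMass T lam ^ 2 * ∫⁻ s, ‖f s‖ₑ ^ 2 ∂(timeMeasure T)) := by
  have hm : Measurable fun s => ‖f s‖ₑ ^ 2 := hf.enorm.pow_const 2
  calc _ ≤ ∫⁻ t, (2 * (ENNReal.ofReal (expKernel lam t) * ‖y₀‖ₑ ^ 2) +
        2 * (kernelMass T lam * kernelConv T lam (fun s => ‖f s‖ₑ ^ 2) t)) ∂(timeMeasure T) := by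
        refine lintegral_mono_ae ?_
        filter_upwards [ae_mem_timeInterval T] with t ht
        refine (pow_le_pow_left₀ zero_le (enorm_duhamel_le T lam y₀ f ht.1) 2).trans ?_
        refine (ennreal_add_sq_le _ _).trans ?_
        rw [mul_pow]
        gcongr
        · rw [sq]
          exact mul_le_of_le_one_left zero_le (kernel_le_one hl _)
        · exact sq_kernelConv_le hf.enorm ht
    _ ≤ _ := by
        have hk : Measurable fun t => ENNReal.ofReal (expKernel lam t) :=
          (measurable_expKernel_right lam).ennreal_ofReal
        rw [lintegral_add_right _ (((measurable_kernelConv hm).const_mul _).const_mul _),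
          lintegral_const_mul _ (hk.mul_const _), lintegral_mul_const _ hk,
          lintegral_const_mul _ ((measurable_kernelConv hm).const_mul _),
          lintegral_const_mul _ (measurable_kernelConv hm), sq (kernelMass T lam), mul_assoc]
        gcongr
        · exact le_rfl
        · exact lintegral_kernelConv_le hm

theorem enorm_duhamel_le_L1 {T : EReal} {lam : ℝ} (hl : 0 ≤ lam) (y₀ : ℂ) (f : ℝ → ℂ)
    {t : ℝ} (ht : t ∈ timeInterval T) :
    ‖duhamel T lam y₀ f t‖ₑ ≤ ‖y₀‖ₑ + ∫⁻ s, ‖f s‖ₑ ∂(timeMeasure T) := by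
  refine (enorm_duhamel_le T lam y₀ f ht.1).trans ?_
  gcongr
  · exact mul_le_of_le_one_left zero_le (kernel_le_one hl _)
  · exact kernelConv_le hl _ _

/-- One factor of the square is bounded uniformly in time, the other one is integrated. -/
theorem lintegral_sq_enorm_duhamel_le_L1 {T : EReal} {lam : ℝ} (hl : 0 ≤ lam) (y₀ : ℂ) {f : ℝ → ℂ}
    (hf : Measurable f) :
    ∫⁻ t, ‖duhamel T lam y₀ f t‖ₑ ^ 2 ∂(timeMeasure T) ≤
      kernelMass T lam * (‖y₀‖ₑ + ∫⁻ s, ‖f s‖ₑ ∂(timeMeasure T)) ^ 2 := by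
  have hk : Measurable fun t => ENNReal.ofReal (expKernel lam t) :=
    (measurable_expKernel_right lam).ennreal_ofReal
  have hm : Measurable fun t => ENNReal.ofReal (expKernel lam t) * ‖y₀‖ₑ +
        kernelConv T lam (fun s => ‖f s‖ₑ) t :=
    (hk.mul_const _).add (measurable_kernelConv hf.enorm)
  calc _ ≤ ∫⁻ t, (‖y₀‖ₑ + ∫⁻ s, ‖f s‖ₑ ∂(timeMeasure T)) *
        (ENNReal.ofReal (expKernel lam t) * ‖y₀‖ₑ +
        kernelConv T lam (fun s => ‖f s‖ₑ) t) ∂(timeMeasure T) := by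
        refine lintegral_mono_ae ?_
        filter_upwards [ae_mem_timeInterval T] with t ht
        rw [sq]
        exact mul_le_mul' (enorm_duhamel_le_L1 hl y₀ f ht) (enorm_duhamel_le T lam y₀ f ht.1)
    _ ≤ _ := by
        rw [lintegral_const_mul _ hm, lintegral_add_left (hk.mul_const _),
          lintegral_mul_const _ hk, sq]
        rw [mul_left_comm]
        gcongr
        rw [mul_add]
        gcongr
        · exact le_rfl
        · exact lintegral_kernelConv_le hf.enorm

theorem integral_timeMeasure_eq {T : EReal} {b : ℝ} (hb : (b : EReal) < T) {g : ℝ → ℂ}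
    (hg : ∀ t, b ≤ t → g t = 0) :
    ∫ t, g t ∂(timeMeasure T) = ∫ t in Ioo 0 b, g t := by
  unfold timeMeasure
  refine setIntegral_eq_of_subset_of_forall_sdiff_eq_zero (measurableSet_timeInterval T) ?_ ?_
  · intro t ht
    exact ⟨ht.1, lt_trans (EReal.coe_lt_coe_iff.2 ht.2) hb⟩
  · intro t ht
    refine hg t ?_
    by_contra h
    exact ht.2 ⟨ht.1.1, not_le.1 h⟩

/-- The kernel inverts the adjoint operator `ψ ↦ ψ' - λ ψ`, with final condition at `b`. -/
theorem integral_expKernel_mul {lam b s : ℝ} (hs : s ∈ Ico 0 b) {ψ ψ' : ℝ → ℂ}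
    (hψ : ∀ t, HasDerivAt ψ (ψ' t) t) (hψ' : Continuous ψ') (hb : ψ b = 0) :
    ∫ t in Ioo 0 b, (expKernel lam (t - s) : ℂ) * (ψ' t - lam * ψ t) = - ψ s := by
  have hc : Continuous ψ := continuous_iff_continuousAt.2 fun t => (hψ t).continuousAt
  have h1 : ∫ t in Ioo 0 b, (expKernel lam (t - s) : ℂ) * (ψ' t - lam * ψ t) =
      ∫ t in Ioc s b, (Real.exp (-(lam * (t - s))) : ℂ) * (ψ' t - lam * ψ t) := by
    rw [← integral_Ioc_eq_integral_Ioo]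
    symm
    rw [setIntegral_eq_of_subset_of_forall_sdiff_eq_zero measurableSet_Ioc
      (Ioc_subset_Ioc_left hs.1) (f := fun t => (expKernel lam (t - s) : ℂ) * (ψ' t - lam * ψ t))]
    · refine setIntegral_congr_fun measurableSet_Ioc fun t ht => ?_
      simp [expKernel, ht.1]
    · intro t ht
      have : ¬ s < t := fun h => ht.2 ⟨h, ht.1.2⟩
      simp [expKernel, this]
  rw [h1, ← intervalIntegral.integral_of_le hs.2.le]
  rw [intervalIntegral.integral_eq_sub_of_hasDerivAt
    (f := fun t => (Real.exp (-(lam * (t - s))) : ℂ) * ψ t)]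
  · simp [hb]
  · intro t _
    have h2 : HasDerivAt (fun t : ℝ => Real.exp (-(lam * (t - s))))
        (Real.exp (-(lam * (t - s))) * (-lam)) t := by
      have := ((((hasDerivAt_id t).sub_const s).const_mul lam).neg).exp
      simpa using this
    have h3 := h2.ofReal_comp.mul (hψ t)
    refine h3.congr_deriv ?_
    push_cast
    ring
  · apply Continuous.intervalIntegrable
    fun_prop

/-- Duhamel's formula solves `y' + λ y = f`, `y(0) = y₀` in the weak sense, including the initial
condition. -/
theorem duhamel_weak {T : EReal} {lam : ℝ} (hl : 0 ≤ lam) (y₀ : ℂ) {f : ℝ → ℂ} {b : ℝ}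
    (hb0 : 0 < b) (hbT : (b : EReal) < T) (hf : IntegrableOn f (Ioo 0 b)) {ψ ψ' : ℝ → ℂ}
    (hψ : ∀ t, HasDerivAt ψ (ψ' t) t) (hψ' : Continuous ψ') (h0 : ∀ t, b ≤ t → ψ t = 0)
    (h0' : ∀ t, b ≤ t → ψ' t = 0) :
    ∫ t, (duhamel T lam y₀ f t * (ψ' t - lam * ψ t) + f t * ψ t) ∂(timeMeasure T) + y₀ * ψ 0
      = 0 := by
  have hc : Continuous ψ := continuous_iff_continuousAt.2 fun t => (hψ t).continuousAt
  set χ : ℝ → ℂ := fun t => ψ' t - lam * ψ t with hχ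
  have hχc : Continuous χ := by fun_prop
  rw [integral_timeMeasure_eq hbT (fun t ht => by simp [h0 t ht, h0' t ht])]
  set ν : Measure ℝ := volume.restrict (Ioo 0 b) with hν
  have hdu : ∀ t ∈ Ioo 0 b, duhamel T lam y₀ f t * χ t + f t * ψ t =
      y₀ * ((expKernel lam (t - 0) : ℂ) * χ t) +
        (∫ s, (expKernel lam (t - s) : ℂ) * χ t * f s ∂ν) + f t * ψ t := by
    intro t ht
    unfold duhamel
    rw [integral_timeMeasure_eq hbT (g := fun s => (expKernel lam (t - s) : ℂ) * f s)]
    · rw [add_mul, ← integral_mul_const]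
      have : (expKernel lam (t - 0) : ℂ) = (Real.exp (-(lam * t)) : ℂ) := by
        simp [expKernel, ht.1]
      rw [this]
      congr 2
      · ring
      · congr 1
        funext s
        ring
    · intro s hs
      have : ¬ s < t := by linarith [ht.2]
      simp [expKernel, this]
  rw [setIntegral_congr_fun measurableSet_Ioo hdu]
  have hmk : Measurable fun z : ℝ × ℝ => (expKernel lam (z.1 - z.2) : ℂ) :=
    Complex.measurable_ofReal.comp
      ((measurable_expKernel_right lam).comp (measurable_fst.sub measurable_snd))
  have hkb : ∀ r, ‖(expKernel lam r : ℂ)‖ ≤ 1 := fun r => by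
    rw [Complex.norm_real, Real.norm_of_nonneg (expKernel_nonneg _ _)]
    exact expKernel_le_one hl r
  have hχi : Integrable χ ν :=
    (hχc.integrableOn_Icc (a := 0) (b := b)).mono_set Ioo_subset_Icc_self
  have hi : Integrable (fun z : ℝ × ℝ => (expKernel lam (z.1 - z.2) : ℂ) * χ z.1 * f z.2)
      (ν.prod ν) := by
    have := (hχi.mul_prod hf).bdd_mul (c := 1) hmk.aestronglyMeasurable
      (ae_of_all _ fun z => hkb (z.1 - z.2))
    refine this.congr (ae_of_all _ fun z => ?_)
    simp [mul_assoc]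
  have h1i : Integrable (fun t => y₀ * ((expKernel lam (t - 0) : ℂ) * χ t)) ν := by
    refine Integrable.const_mul ?_ _
    exact hχi.bdd_mul (c := 1)
      (hmk.comp (measurable_id.prodMk measurable_const)).aestronglyMeasurable
      (ae_of_all _ fun t => hkb (t - 0))
  have h3i : Integrable (fun t => f t * ψ t) ν := by
    have hψb : ∃ C, ∀ t ∈ Icc 0 b, ‖ψ t‖ ≤ C := isCompact_Icc.exists_bound_of_continuousOn
      hc.continuousOn
    obtain ⟨C, hC⟩ := hψb
    refine hf.mul_bdd (c := C) hc.aestronglyMeasurable ?_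
    filter_upwards [ae_restrict_mem measurableSet_Ioo] with t ht
    exact hC t (Ioo_subset_Icc_self ht)
  have h2i : Integrable (fun t => ∫ s, (expKernel lam (t - s) : ℂ) * χ t * f s ∂ν) ν :=
    hi.integral_prod_left
  rw [integral_add (f := fun t => y₀ * ((expKernel lam (t - 0) : ℂ) * χ t) +
    ∫ s, (expKernel lam (t - s) : ℂ) * χ t * f s ∂ν) (h1i.add h2i) h3i, integral_add h1i h2i,
    integral_integral_swap hi, integral_const_mul]
  have e1 := integral_expKernel_mul (lam := lam) (s := 0) ⟨le_rfl, hb0⟩ hψ hψ' (h0 b le_rfl)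
  rw [e1]
  have e2 : ∫ s, ∫ t, (expKernel lam (t - s) : ℂ) * χ t * f s ∂ν ∂ν = ∫ s, - (f s * ψ s) ∂ν := by
    refine setIntegral_congr_fun measurableSet_Ioo fun s hs => ?_
    rw [integral_mul_const, integral_expKernel_mul ⟨hs.1.le, hs.2⟩ hψ hψ' (h0 b le_rfl)]
    ring
  rw [e2, integral_neg]
  ring

end Scalar

open scoped SchwartzMap ContDiff LineDeriv Laplacian

variable {N : ℕ}

/-! ### Test functions in the Schwartz space -/

section Density

/-- A real test function as a complex-valued Schwartz function. -/
def IsTest.schwartz {ψ : Sp N → ℝ} (h : IsTest ψ) : 𝓢(Sp N, ℂ) :=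
  HasCompactSupport.toSchwartzMap (f := fun x => (ψ x : ℂ)) (h.2.comp_left Complex.ofReal_zero)
    (Complex.ofRealCLM.contDiff.comp h.1)

@[simp]
theorem IsTest.schwartz_apply {ψ : Sp N → ℝ} (h : IsTest ψ) (x : Sp N) :
    h.schwartz x = (ψ x : ℂ) := rfl

/-- Compactly supported functions are dense in the Schwartz space: `χ(x / n) f → f`. -/
theorem exists_tendsto_compactSupport (f : 𝓢(Sp N, ℂ)) :
    ∃ F : ℕ → 𝓢(Sp N, ℂ), (∀ n, HasCompactSupport (F n)) ∧ Tendsto F atTop (𝓝 f) := by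
  let χ : ContDiffBump (0 : Sp N) := ⟨1, 2, one_pos, one_lt_two⟩
  have hχ : ContDiff ℝ ∞ (χ : Sp N → ℝ) := χ.contDiff
  have hχc : HasCompactSupport (χ : Sp N → ℝ) := χ.hasCompactSupport
  let c : ℕ → ℝ := fun n => ((n : ℝ) + 1)⁻¹
  have hc0 : ∀ n, 0 < c n := fun n => by positivity
  have hc1 : ∀ n, c n ≤ 1 := fun n => inv_le_one_of_one_le₀ (by linarith [n.cast_nonneg (α := ℝ)])
  let χn : ℕ → Sp N → ℝ := fun n x => χ (c n • x)
  have hχn : ∀ n, ContDiff ℝ ∞ (χn n) := fun n => hχ.comp (contDiff_const_smul (c n))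
  have hχnc : ∀ n, HasCompactSupport (χn n) := fun n =>
    hχc.comp_homeomorph (Homeomorph.smulOfNeZero (c n) (hc0 n).ne')
  let g : ℕ → Sp N → ℝ := fun n x => 1 - χn n x
  have hg : ∀ n, ContDiff ℝ ∞ (g n) := fun n => contDiff_const.sub (hχn n)
  have hM : ∀ i, ∃ M, 0 ≤ M ∧ ∀ x, ‖iteratedFDeriv ℝ i χ x‖ ≤ M := by
    intro i
    obtain ⟨M, hM⟩ := (hχc.iteratedFDeriv (𝕜 := ℝ) i).exists_bound_of_continuous
      (hχ.continuous_iteratedFDeriv (m := i) (mod_cast le_top))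
    exact ⟨M, (norm_nonneg _).trans (hM 0), hM⟩
  choose M hM0 hM using hM
  have hgb : ∀ n i x, ‖iteratedFDeriv ℝ i (g n) x‖ ≤ 1 + M i := by
    intro n i x
    have e1 : iteratedFDeriv ℝ i (g n) x = iteratedFDeriv ℝ i (fun _ : Sp N => (1 : ℝ)) x -
        iteratedFDeriv ℝ i (χn n) x := by
      exact iteratedFDeriv_sub_apply (f := fun _ : Sp N => (1 : ℝ)) (g := χn n)
        contDiff_const.contDiffAt ((hχn n).of_le (mod_cast le_top)).contDiffAt
    have e2 : ‖iteratedFDeriv ℝ i (fun _ : Sp N => (1 : ℝ)) x‖ ≤ 1 := by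
      rcases Nat.eq_zero_or_pos i with rfl | hi
      · simp
      · rw [iteratedFDeriv_const_of_ne hi.ne']; simp
    have e3 : ‖iteratedFDeriv ℝ i (χn n) x‖ ≤ M i := by
      have h3 := congrFun (iteratedFDeriv_comp_const_smul (i := i) (c n)
        (hχ.of_le (mod_cast le_top) : ContDiff ℝ i (χ : Sp N → ℝ))) x
      have h4 : iteratedFDeriv ℝ i (χn n) x = c n ^ i • iteratedFDeriv ℝ i χ (c n • x) := h3
      rw [h4, norm_smul, norm_pow, Real.norm_of_nonneg (hc0 n).le]
      exact (mul_le_of_le_one_left (norm_nonneg _) (pow_le_one₀ (hc0 n).le (hc1 n))).trans (hM i _)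
    rw [e1]
    exact (norm_sub_le _ _).trans (add_le_add e2 e3)
  -- all derivatives of `1 - χ(x / n)` vanish for `‖x‖ < n`, so a factor `‖x‖ / n` comes for free
  have hgb' : ∀ n i x, ‖iteratedFDeriv ℝ i (g n) x‖ ≤ (1 + M i) * (c n * ‖x‖) := by
    intro n i x
    rcases lt_or_ge (c n * ‖x‖) 1 with h | h
    · have h0 : g n =ᶠ[𝓝 x] fun _ => 0 := by
        have hopen : ∀ᶠ y in 𝓝 x, c n * ‖y‖ < 1 :=
          (by fun_prop : Continuous fun y : Sp N => c n * ‖y‖).continuousAt.eventually_lt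
            continuousAt_const h
        filter_upwards [hopen] with y hy
        have : χ (c n • y) = 1 := by
          apply χ.one_of_mem_closedBall
          simp only [mem_closedBall_zero_iff, norm_smul, Real.norm_of_nonneg (hc0 n).le]
          exact hy.le
        simp [g, χn, this]
      rw [(h0.iteratedFDeriv ℝ i).eq_of_nhds]
      have : iteratedFDeriv ℝ i (fun _ : Sp N => (0 : ℝ)) x = 0 := by
        simp
      rw [this, norm_zero]
      have := hM0 i; have := hc0 n
      positivity
    · refine (hgb n i x).trans (le_mul_of_one_le_right ?_ h)
      have := hM0 i
      positivity
  let F : ℕ → 𝓢(Sp N, ℂ) := fun n =>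
    HasCompactSupport.toSchwartzMap (f := fun x => χn n x • f x) ((hχnc n).smul_right)
      ((hχn n).smul (f.smooth ⊤))
  have hFf : ∀ n, ((f - F n : 𝓢(Sp N, ℂ)) : Sp N → ℂ) = fun x => g n x • f x := by
    intro n
    funext x
    simp [F, g, sub_mul]
  refine ⟨F, fun n => (hχnc n).smul_right, ?_⟩
  rw [(schwartz_withSeminorms ℝ (Sp N) ℂ).tendsto_nhds F f]
  intro ⟨k, m⟩ ε hε
  set S : ℝ := ∑ i ∈ Finset.range (m + 1), (m.choose i : ℝ) * (1 + M i) *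
    SchwartzMap.seminorm ℝ (k + 1) (m - i) f with hS
  have hS0 : 0 ≤ S := Finset.sum_nonneg fun i _ => by
    have := hM0 i
    have := apply_nonneg (SchwartzMap.seminorm ℝ (k + 1) (m - i)) f
    positivity
  have key : ∀ n, schwartzSeminormFamily ℝ (Sp N) ℂ (k, m) (F n - f) ≤ c n * S := by
    intro n
    rw [SchwartzMap.schwartzSeminormFamily_apply, ← neg_sub, map_neg_eq_map]
    refine SchwartzMap.seminorm_le_bound ℝ k m _ (mul_nonneg (hc0 n).le hS0) fun x => ?_
    rw [hFf n]
    have h1 := norm_iteratedFDeriv_smul_le (hg n) (f.smooth ⊤) x (n := m) (mod_cast le_top)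
    calc ‖x‖ ^ k * ‖iteratedFDeriv ℝ m (fun x => g n x • f x) x‖
        ≤ ‖x‖ ^ k * ∑ i ∈ Finset.range (m + 1), (m.choose i : ℝ) * ‖iteratedFDeriv ℝ i (g n) x‖ *
          ‖iteratedFDeriv ℝ (m - i) f x‖ := by gcongr
      _ ≤ c n * S := by
          rw [Finset.mul_sum, hS, Finset.mul_sum]
          refine Finset.sum_le_sum fun i _ => ?_
          have h2 := SchwartzMap.le_seminorm ℝ (k + 1) (m - i) f x
          have := hM0 i; have := hc0 n
          calc ‖x‖ ^ k * ((m.choose i : ℝ) * ‖iteratedFDeriv ℝ i (g n) x‖ *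
                ‖iteratedFDeriv ℝ (m - i) f x‖)
              ≤ ‖x‖ ^ k * ((m.choose i : ℝ) * ((1 + M i) * (c n * ‖x‖)) *
                ‖iteratedFDeriv ℝ (m - i) f x‖) := by
                gcongr
                exact hgb' n i x
            _ = c n * ((m.choose i : ℝ) * (1 + M i) *
                (‖x‖ ^ (k + 1) * ‖iteratedFDeriv ℝ (m - i) f x‖)) := by ring
            _ ≤ _ := by gcongr
  have hlim : Tendsto (fun n => c n * S) atTop (𝓝 0) := by
    have := (tendsto_one_div_add_atTop_nhds_zero_nat (𝕜 := ℝ)).mul_const S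
    simpa [c] using this
  filter_upwards [hlim.eventually_lt_const hε] with n hn
  exact (key n).trans_lt hn

/-- A continuous functional on the Schwartz space that vanishes on real test functions is zero. -/
theorem clm_eq_zero_of_test (Λ : 𝓢(Sp N, ℂ) →L[ℂ] ℂ)
    (h : ∀ (ψ : Sp N → ℝ) (hψ : IsTest ψ), Λ hψ.schwartz = 0) (f : 𝓢(Sp N, ℂ)) : Λ f = 0 := by
  have hc : ∀ f : 𝓢(Sp N, ℂ), HasCompactSupport f → Λ f = 0 := by
    intro f hf
    have h1 : IsTest fun x => (f x).re :=
      ⟨Complex.reCLM.contDiff.comp (f.smooth ⊤), hf.comp_left (g := Complex.re) Complex.zero_re⟩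
    have h2 : IsTest fun x => (f x).im :=
      ⟨Complex.imCLM.contDiff.comp (f.smooth ⊤), hf.comp_left (g := Complex.im) Complex.zero_im⟩
    have : f = h1.schwartz + Complex.I • h2.schwartz := by
      ext x
      simp [mul_comm Complex.I, Complex.re_add_im]
    rw [this, map_add, map_smul, h _ h1, h _ h2]
    simp
  obtain ⟨F, hF, hlim⟩ := exists_tendsto_compactSupport f
  have h1 := (Λ.continuous.tendsto f).comp hlim
  have h2 : (Λ ∘ F) = fun _ => 0 := funext fun n => hc _ (hF n)
  rw [h2] at h1
  exact (tendsto_nhds_unique h1 tendsto_const_nhds)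

end Density

/-! ### Tempered functions on the frequency side -/

section Tempered

/-- The Plancherel identity in bilinear form: no complex conjugation, and the inverse transform on
the test function. -/
theorem integral_mul_schwartz (f : L2 N ℂ) (ψ : 𝓢(Sp N, ℂ)) :
    ∫ x, f x * ψ x = ∫ ξ, (𝓕 f : L2 N ℂ) ξ * (𝓕⁻ ψ) ξ := by
  have h := congrArg (fun D : 𝓢'(Sp N, ℂ) => D (𝓕⁻ ψ))
    (Lp.fourier_toTemperedDistribution_eq (E := Sp N) (F := ℂ) f)
  simp only [TemperedDistribution.fourier_apply, FourierTransform.fourier_fourierInv_eq,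
    Lp.toTemperedDistribution_apply, smul_eq_mul] at h
  simpa [mul_comm] using h

/-- A function that is integrable after division by a power of `1 + |ξ|²`. Such functions are
tempered distributions, and the class is stable under multiplication by symbols of polynomial
growth. -/
def Tempered (G : Sp N → ℂ) : Prop :=
  ∃ k : ℕ, Integrable fun ξ => ((((1 + ‖ξ‖ ^ 2) ^ k)⁻¹ : ℝ) : ℂ) * G ξ

theorem norm_weight_le (k : ℕ) (ξ : Sp N) : ‖((((1 + ‖ξ‖ ^ 2) ^ k)⁻¹ : ℝ) : ℂ)‖ ≤ 1 := by
  rw [Complex.norm_real, Real.norm_of_nonneg (by positivity)]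
  exact inv_le_one_of_one_le₀ (one_le_pow₀ (by nlinarith [sq_nonneg ‖ξ‖]))

theorem continuous_weight (k : ℕ) :
    Continuous fun ξ : Sp N => ((((1 + ‖ξ‖ ^ 2) ^ k)⁻¹ : ℝ) : ℂ) := by
  refine Complex.continuous_ofReal.comp (Continuous.inv₀ (by fun_prop) fun ξ => ?_)
  positivity

theorem Tempered.mul {G p : Sp N → ℂ} (hG : Tempered G) (hp : AEStronglyMeasurable p volume)
    {C : ℝ} {m : ℕ} (h : ∀ ξ, ‖p ξ‖ ≤ C * (1 + ‖ξ‖ ^ 2) ^ m) : Tempered fun ξ => p ξ * G ξ := by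
  obtain ⟨k, hk⟩ := hG
  refine ⟨m + k, ?_⟩
  have h1 := hk.bdd_mul (f := fun ξ => ((((1 + ‖ξ‖ ^ 2) ^ m)⁻¹ : ℝ) : ℂ) * p ξ) (c := C)
    ((continuous_weight m).aestronglyMeasurable.mul hp) (ae_of_all _ fun ξ => by
      have hq : 0 < (1 + ‖ξ‖ ^ 2) ^ m := by positivity
      rw [norm_mul, Complex.norm_real, Real.norm_of_nonneg (by positivity), inv_mul_le_iff₀ hq,
        mul_comm]
      exact h ξ)
  refine h1.congr (ae_of_all _ fun ξ => ?_)
  simp only [pow_add, mul_inv]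
  push_cast
  ring

theorem Tempered.mono {G : Sp N → ℂ} {k l : ℕ} (hkl : k ≤ l)
    (h : Integrable fun ξ => ((((1 + ‖ξ‖ ^ 2) ^ k)⁻¹ : ℝ) : ℂ) * G ξ) :
    Integrable fun ξ => ((((1 + ‖ξ‖ ^ 2) ^ l)⁻¹ : ℝ) : ℂ) * G ξ := by
  obtain ⟨m, rfl⟩ := Nat.exists_eq_add_of_le hkl
  have h1 := h.bdd_mul (c := 1) (continuous_weight m).aestronglyMeasurable
    (ae_of_all _ fun ξ => norm_weight_le m ξ)
  refine h1.congr (ae_of_all _ fun ξ => ?_)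
  simp only [pow_add, mul_inv]
  push_cast
  ring

theorem Tempered.add {G H : Sp N → ℂ} (hG : Tempered G) (hH : Tempered H) :
    Tempered fun ξ => G ξ + H ξ := by
  obtain ⟨k, hk⟩ := hG
  obtain ⟨l, hl⟩ := hH
  refine ⟨max k l, ((Tempered.mono (le_max_left k l) hk).add
    (Tempered.mono (le_max_right k l) hl)).congr (ae_of_all _ fun ξ => ?_)⟩
  simp [mul_add]

theorem Tempered.const_mul {G : Sp N → ℂ} (hG : Tempered G) (c : ℂ) :
    Tempered fun ξ => c * G ξ :=
  hG.mul (C := ‖c‖) (m := 0) aestronglyMeasurable_const (by simp)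

theorem Tempered.sub {G H : Sp N → ℂ} (hG : Tempered G) (hH : Tempered H) :
    Tempered fun ξ => G ξ - H ξ := by
  simpa [sub_eq_add_neg] using hG.add (hH.const_mul (-1))

theorem Tempered.sum {ι : Type*} (s : Finset ι) {G : ι → Sp N → ℂ}
    (hG : ∀ i ∈ s, Tempered (G i)) : Tempered fun ξ => ∑ i ∈ s, G i ξ := by
  classical
  induction s using Finset.induction_on with
  | empty => exact ⟨0, by simp⟩
  | insert a s ha ih =>
    simp only [Finset.sum_insert ha]
    exact (hG a (by simp)).add (ih fun i hi => hG i (by simp [hi]))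

theorem Tempered.congr {G H : Sp N → ℂ} (hG : Tempered G) (h : G =ᵐ[volume] H) : Tempered H := by
  obtain ⟨k, hk⟩ := hG
  refine ⟨k, hk.congr ?_⟩
  filter_upwards [h] with ξ hξ
  rw [hξ]

theorem integrable_weight : Integrable fun ξ : Sp N => ((1 + ‖ξ‖ ^ 2) ^ (N + 1))⁻¹ := by
  have h := integrable_rpow_neg_one_add_norm_sq (E := Sp N) (μ := volume) (r := 2 * (N + 1))
    (by simp; linarith)
  refine h.congr (ae_of_all _ fun ξ => ?_)
  simp only
  rw [show (-(2 * ((N : ℝ) + 1)) / 2) = -((N + 1 : ℕ) : ℝ) by push_cast; ring,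
    Real.rpow_neg (by positivity), Real.rpow_natCast]

theorem tempered_of_memLp_two {G : Sp N → ℂ} (hG : MemLp G 2 volume) : Tempered G := by
  refine ⟨N + 1, MemLp.integrable_mul (p := 2) (q := 2) ?_ hG⟩
  refine (memLp_two_iff_integrable_sq_norm
    (continuous_weight (N + 1)).aestronglyMeasurable).2 ?_
  refine integrable_weight.mono' (by
    exact ((continuous_weight (N + 1)).norm.pow 2).aestronglyMeasurable) (ae_of_all _ fun ξ => ?_)
  have h1 := norm_weight_le (N + 1) ξ
  have h2 : ‖((((1 + ‖ξ‖ ^ 2) ^ (N + 1))⁻¹ : ℝ) : ℂ)‖ = ((1 + ‖ξ‖ ^ 2) ^ (N + 1))⁻¹ := by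
    rw [Complex.norm_real, Real.norm_of_nonneg (by positivity)]
  rw [Real.norm_of_nonneg (by positivity), sq]
  rw [h2] at h1 ⊢
  exact mul_le_of_le_one_left (by positivity) h1

theorem tempered_coe (f : L2 N ℂ) : Tempered f := tempered_of_memLp_two (Lp.memLp f)

theorem tempered_of_bounded {G : Sp N → ℂ} (hG : AEStronglyMeasurable G volume) {C : ℝ}
    (h : ∀ ξ, ‖G ξ‖ ≤ C) : Tempered G := by
  have h1 : Tempered fun _ : Sp N => (1 : ℂ) :=
    ⟨N + 1, by simpa using integrable_weight.ofReal (𝕜 := ℂ)⟩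
  simpa using h1.mul hG (C := C) (m := 0) (by simpa using h)

theorem hasTemperateGrowth_weight (k : ℕ) :
    Function.HasTemperateGrowth fun ξ : Sp N => (((1 + ‖ξ‖ ^ 2) ^ k : ℝ) : ℂ) := by
  have h1 : Function.HasTemperateGrowth fun ξ : Sp N => 1 + ‖ξ‖ ^ 2 :=
    (Function.HasTemperateGrowth.const 1).add (Function.hasTemperateGrowth_norm_sq (Sp N))
  exact Function.HasTemperateGrowth.comp Function.Complex.hasTemperateGrowth_ofReal (h1.pow k)

/-- The power of `1 + |ξ|²` can be moved to the Schwartz function. -/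
theorem weight_mul_eq {G : Sp N → ℂ} (k : ℕ) (ζ : 𝓢(Sp N, ℂ)) (ξ : Sp N) :
    (((((1 + ‖ξ‖ ^ 2) ^ k)⁻¹ : ℝ) : ℂ) * G ξ) *
      SchwartzMap.smulLeftCLM ℂ (fun ξ : Sp N => (((1 + ‖ξ‖ ^ 2) ^ k : ℝ) : ℂ)) ζ ξ =
      G ξ * ζ ξ := by
  rw [SchwartzMap.smulLeftCLM_apply_apply (hasTemperateGrowth_weight k)]
  have h0 : (((1 + ‖ξ‖ ^ 2) ^ k : ℝ) : ℂ) ≠ 0 := by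
    exact_mod_cast (by positivity : ((1 + ‖ξ‖ ^ 2) ^ k : ℝ) ≠ 0)
  rw [Complex.ofReal_inv, smul_eq_mul]
  field_simp

theorem integrable_mul_schwartz {g : Sp N → ℂ} (hg : Integrable g) (ζ : 𝓢(Sp N, ℂ)) :
    Integrable fun ξ => g ξ * ζ ξ :=
  hg.mul_bdd (c := ‖ζ.toBoundedContinuousFunction‖) ζ.continuous.aestronglyMeasurable
    (ae_of_all _ fun ξ => ζ.toBoundedContinuousFunction.norm_coe_le_norm ξ)

theorem Tempered.integrable_mul {G : Sp N → ℂ} (hG : Tempered G) (ζ : 𝓢(Sp N, ℂ)) :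
    Integrable fun ξ => G ξ * ζ ξ := by
  obtain ⟨k, hk⟩ := hG
  refine (integrable_mul_schwartz hk (SchwartzMap.smulLeftCLM ℂ
    (fun ξ : Sp N => (((1 + ‖ξ‖ ^ 2) ^ k : ℝ) : ℂ)) ζ)).congr (ae_of_all _ fun ξ => ?_)
  exact weight_mul_eq k ζ ξ

theorem Tempered.locallyIntegrable {G : Sp N → ℂ} (hG : Tempered G) :
    LocallyIntegrable G volume := by
  obtain ⟨k, hk⟩ := hG
  have hc : Continuous fun ξ : Sp N => (((1 + ‖ξ‖ ^ 2) ^ k : ℝ) : ℂ) := by fun_prop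
  have h1 := hk.locallyIntegrable.continuous_mul hc
  refine h1.congr (ae_of_all _ fun ξ => ?_)
  have h0 : (((1 + ‖ξ‖ ^ 2) ^ k : ℝ) : ℂ) ≠ 0 := by
    exact_mod_cast (by positivity : ((1 + ‖ξ‖ ^ 2) ^ k : ℝ) ≠ 0)
  beta_reduce
  rw [Complex.ofReal_inv]
  field_simp

/-- Integration against an integrable function, as a continuous functional on the Schwartz
space. -/
theorem exists_clm_integral {g : Sp N → ℂ} (hg : Integrable g) :
    ∃ Λ : 𝓢(Sp N, ℂ) →L[ℂ] ℂ, ∀ ζ, Λ ζ = ∫ ξ, g ξ * ζ ξ := by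
  refine ⟨((ContinuousLinearMap.mul ℂ ℂ).lpPairing volume 1 ∞
    ((memLp_one_iff_integrable.2 hg).toLp g)) ∘L (SchwartzMap.toLpCLM ℂ ℂ ∞ volume), fun ζ => ?_⟩
  rw [ContinuousLinearMap.comp_apply, ContinuousLinearMap.lpPairing_eq_integral]
  apply integral_congr_ae
  filter_upwards [(memLp_one_iff_integrable.2 hg).coeFn_toLp,
    SchwartzMap.coeFn_toLp ζ ∞ (volume : Measure (Sp N))] with ξ h1 h2
  simp only [SchwartzMap.toLpCLM_apply, ContinuousLinearMap.mul_apply']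
  rw [h1, h2]

theorem Tempered.exists_clm {G : Sp N → ℂ} (hG : Tempered G) :
    ∃ Λ : 𝓢(Sp N, ℂ) →L[ℂ] ℂ, ∀ ζ, Λ ζ = ∫ ξ, G ξ * ζ ξ := by
  obtain ⟨k, hk⟩ := hG
  obtain ⟨Λ, hΛ⟩ := exists_clm_integral hk
  refine ⟨Λ ∘L SchwartzMap.smulLeftCLM ℂ (fun ξ : Sp N => (((1 + ‖ξ‖ ^ 2) ^ k : ℝ) : ℂ)),
    fun ζ => ?_⟩
  rw [ContinuousLinearMap.comp_apply, hΛ]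
  exact integral_congr_ae (ae_of_all _ fun ξ => weight_mul_eq k ζ ξ)

/-- A tempered function on the frequency side whose pairings with the (inverse) Fourier transforms
of all real test functions vanish is zero. -/
theorem Tempered.ae_eq_zero {G : Sp N → ℂ} (hG : Tempered G)
    (h : ∀ (ψ : Sp N → ℝ) (hψ : IsTest ψ), ∫ ξ, G ξ * (𝓕⁻ hψ.schwartz) ξ = 0) :
    ∀ᵐ ξ, G ξ = 0 := by
  obtain ⟨Λ, hΛ⟩ := hG.exists_clm
  have h1 : ∀ ζ : 𝓢(Sp N, ℂ), ∫ ξ, G ξ * ζ ξ = 0 := by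
    intro ζ
    have h2 := clm_eq_zero_of_test (Λ ∘L FourierTransform.fourierInvCLM ℂ 𝓢(Sp N, ℂ)) (fun ψ hψ => by
      rw [ContinuousLinearMap.comp_apply, FourierTransform.fourierInvCLM_apply, hΛ]
      exact h ψ hψ) (𝓕 ζ)
    rw [ContinuousLinearMap.comp_apply, FourierTransform.fourierInvCLM_apply, hΛ,
      FourierTransform.fourierInv_fourier_eq] at h2
    exact h2
  refine ae_eq_zero_of_integral_contDiff_smul_eq_zero hG.locallyIntegrable fun g hg hgc => ?_
  have hgt : IsTest g := ⟨hg, hgc⟩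
  have h2 := h1 hgt.schwartz
  rw [← h2]
  congr 1
  funext ξ
  rw [IsTest.schwartz_apply, Complex.real_smul, mul_comm]

end Tempered

/-! ### Derivatives and their symbols -/

section Derivatives

/-- The symbol `|2πξ|²` of `-Δ`. -/
def freq (ξ : Sp N) : ℝ := (2 * Real.pi * ‖ξ‖) ^ 2

theorem freq_nonneg (ξ : Sp N) : 0 ≤ freq ξ := sq_nonneg _

theorem continuous_freq : Continuous (freq : Sp N → ℝ) := by unfold freq; fun_prop

theorem contDiff_pderiv {ψ : Sp N → ℝ} (h : ContDiff ℝ ∞ ψ) (j : Fin N) :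
    ContDiff ℝ ∞ (pderiv j ψ) := by
  unfold pderiv
  exact (h.fderiv_right (m := ∞) (by simp)).clm_apply contDiff_const

theorem IsTest.pderiv {ψ : Sp N → ℝ} (h : IsTest ψ) (j : Fin N) : IsTest (pderiv j ψ) :=
  ⟨contDiff_pderiv h.1 j, h.2.fderiv_apply ℝ _⟩

theorem IsTest.add {ψ φ : Sp N → ℝ} (h : IsTest ψ) (h' : IsTest φ) : IsTest (ψ + φ) :=
  ⟨h.1.add h'.1, h.2.add h'.2⟩

theorem isTest_zero : IsTest (fun _ : Sp N => (0 : ℝ)) :=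
  ⟨contDiff_const, HasCompactSupport.zero⟩

theorem laplacian_eq_sum_pderiv {ψ : Sp N → ℝ} (h : ContDiff ℝ ∞ ψ) (x : Sp N) :
    Laplacian.laplacian ψ x = ∑ j, pderiv j (pderiv j ψ) x := by
  have h1 := congrFun (InnerProductSpace.laplacian_eq_iteratedFDeriv_orthonormalBasis ψ
    (EuclideanSpace.basisFun (Fin N) ℝ)) x
  rw [h1]
  refine Finset.sum_congr rfl fun j _ => ?_
  rw [iteratedFDeriv_two_apply]
  simp only [EuclideanSpace.basisFun_apply, Matrix.cons_val_zero, Matrix.cons_val_one]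
  unfold StokesHeat.pderiv
  rw [fderiv_clm_apply ((h.fderiv_right (m := ∞) (by simp)).differentiable (by simp) x)
    (by fun_prop)]
  simp

theorem IsTest.sum {ι : Type*} (s : Finset ι) {ψ : ι → Sp N → ℝ} (h : ∀ i ∈ s, IsTest (ψ i)) :
    IsTest fun x => ∑ i ∈ s, ψ i x := by
  classical
  induction s using Finset.induction_on with
  | empty => simpa using isTest_zero
  | insert a s ha ih =>
    simp only [Finset.sum_insert ha]
    exact (h a (by simp)).add (ih fun i hi => h i (by simp [hi]))

theorem IsTest.laplacian {ψ : Sp N → ℝ} (h : IsTest ψ) : IsTest (Laplacian.laplacian ψ) := by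
  have : (Laplacian.laplacian ψ : Sp N → ℝ) = fun x => ∑ j, StokesHeat.pderiv j (StokesHeat.pderiv j ψ) x :=
    funext fun x => laplacian_eq_sum_pderiv h.1 x
  rw [this]
  exact IsTest.sum _ fun j _ => (h.pderiv j).pderiv j

theorem IsTest.schwartz_pderiv {ψ : Sp N → ℝ} (h : IsTest ψ) (j : Fin N) :
    (h.pderiv j).schwartz = ∂_{(EuclideanSpace.single j (1 : ℝ) : Sp N)} h.schwartz := by
  ext x
  rw [SchwartzMap.lineDerivOp_apply_eq_fderiv, IsTest.schwartz_apply]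
  have h1 : HasFDerivAt (fun x => (ψ x : ℂ)) (Complex.ofRealCLM.comp (fderiv ℝ ψ x)) x :=
    Complex.ofRealCLM.hasFDerivAt.comp x
      ((h.1.differentiable (by simp)) x).hasFDerivAt
  have h2 : fderiv ℝ (h.schwartz : Sp N → ℂ) x = Complex.ofRealCLM.comp (fderiv ℝ ψ x) := h1.fderiv
  rw [h2]
  rfl

theorem IsTest.fourierInv_pderiv {ψ : Sp N → ℝ} (h : IsTest ψ) (j : Fin N) (ξ : Sp N) :
    (𝓕⁻ (h.pderiv j).schwartz) ξ = -(2 * Real.pi * Complex.I) * (ξ j : ℂ) * (𝓕⁻ h.schwartz) ξ := by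
  rw [h.schwartz_pderiv, SchwartzMap.fourierInv_lineDerivOp_eq]
  have : (inner ℝ · (EuclideanSpace.single j (1 : ℝ)) : Sp N → ℝ).HasTemperateGrowth := by fun_prop
  rw [smul_apply, SchwartzMap.smulLeftCLM_apply_apply this]
  simp [EuclideanSpace.inner_single_right]
  ring

theorem IsTest.fourierInv_laplacian {ψ : Sp N → ℝ} (h : IsTest ψ) (ξ : Sp N) :
    (𝓕⁻ h.laplacian.schwartz) ξ = -(freq ξ : ℂ) * (𝓕⁻ h.schwartz) ξ := by
  have h1 : h.laplacian.schwartz = ∑ j, ((h.pderiv j).pderiv j).schwartz := by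
    ext x
    rw [sum_apply, IsTest.schwartz_apply, laplacian_eq_sum_pderiv h.1]
    simp
  have h2 : (𝓕⁻ h.laplacian.schwartz) ξ = ∑ j, (𝓕⁻ ((h.pderiv j).pderiv j).schwartz) ξ := by
    have := congrArg (fun f : 𝓢(Sp N, ℂ) => (FourierTransform.fourierInvCLM ℂ 𝓢(Sp N, ℂ) f) ξ) h1
    simpa [map_sum, sum_apply] using this
  rw [h2]
  have h4 : ∀ j, (𝓕⁻ ((h.pderiv j).pderiv j).schwartz) ξ = -(2 * Real.pi * Complex.I) * (ξ j : ℂ) *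
      (-(2 * Real.pi * Complex.I) * (ξ j : ℂ) * (𝓕⁻ h.schwartz) ξ) := fun j => by
    rw [(h.pderiv j).fourierInv_pderiv j, h.fourierInv_pderiv j]
  simp_rw [h4]
  have h3 : (freq ξ : ℂ) = (2 * Real.pi) ^ 2 * ∑ j, (ξ j : ℂ) ^ 2 := by
    unfold freq
    rw [mul_pow, EuclideanSpace.norm_sq_eq]
    push_cast
    simp [← Complex.ofReal_pow]
  rw [h3, Finset.mul_sum, ← Finset.sum_neg_distrib, Finset.sum_mul]
  refine Finset.sum_congr rfl fun j _ => ?_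
  have := Complex.I_sq
  ring_nf
  rw [this]
  ring

end Derivatives

/-! ### Real fields with prescribed Fourier transforms -/

section RealPart

variable {ι : Type} [Fintype ι]

theorem coeFn_coordC (k : ι) (f : L2 N (EuclideanSpace ℝ ι)) :
    ∀ᵐ x, coordC k f x = (f x k : ℂ) := by
  filter_upwards [ContinuousLinearMap.coeFn_compLp
    (Complex.ofRealCLM.comp (EuclideanSpace.proj k : EuclideanSpace ℝ ι →L[ℝ] ℝ)) f] with x hx
  unfold coordC
  rw [hx]
  rfl

theorem continuous_coordC (k : ι) :
    Continuous (coordC k : L2 N (EuclideanSpace ℝ ι) → L2 N ℂ) :=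
  ((Complex.ofRealCLM.comp (EuclideanSpace.proj k : EuclideanSpace ℝ ι →L[ℝ] ℝ)).compLpL 2
    (volume : Measure (Sp N))).continuous

theorem coordC_sub (k : ι) (f g : L2 N (EuclideanSpace ℝ ι)) :
    coordC k (f - g) = coordC k f - coordC k g :=
  ((Complex.ofRealCLM.comp (EuclideanSpace.proj k : EuclideanSpace ℝ ι →L[ℝ] ℝ)).compLpL 2
    (volume : Measure (Sp N))).map_sub f g

theorem memLp_coord (k : ι) (f : L2 N (EuclideanSpace ℝ ι)) :
    MemLp (fun x => f x k) 2 (volume : Measure (Sp N)) :=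
  (EuclideanSpace.proj k : EuclideanSpace ℝ ι →L[ℝ] ℝ).comp_memLp' (Lp.memLp f)

theorem IsTest.memLp {ψ : Sp N → ℝ} (h : IsTest ψ) (p : ℝ≥0∞) (μ : Measure (Sp N))
    [IsFiniteMeasureOnCompacts μ] : MemLp ψ p μ :=
  h.1.continuous.memLp_of_hasCompactSupport h.2

theorem integrable_coord_mul (k : ι) (f : L2 N (EuclideanSpace ℝ ι)) {ψ : Sp N → ℝ}
    (h : IsTest ψ) : Integrable fun x => f x k * ψ x :=
  (memLp_coord k f).integrable_mul (h.memLp 2 volume)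

/-- Plancherel for a component of a real field against a real test function. -/
theorem integral_coord_mul (k : ι) (f : L2 N (EuclideanSpace ℝ ι)) {ψ : Sp N → ℝ}
    (h : IsTest ψ) :
    ((∫ x, f x k * ψ x : ℝ) : ℂ) =
      ∫ ξ, (𝓕 (coordC k f) : L2 N ℂ) ξ * (𝓕⁻ h.schwartz) ξ := by
  rw [← integral_mul_schwartz, ← integral_complex_ofReal]
  apply integral_congr_ae
  filter_upwards [coeFn_coordC k f] with x hx
  simp [hx]

/-- The real vector field whose components are the real parts of given complex functions. Taking
real parts makes it unnecessary to keep track of the Hermitian symmetry of Fourier transforms. -/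
def assemble (U : ι → L2 N ℂ) : L2 N (EuclideanSpace ℝ ι) := by
  classical
  exact ∑ i, (Complex.reCLM.smulRight (EuclideanSpace.single i (1 : ℝ))).compLp (U i)

theorem coeFn_assemble (U : ι → L2 N ℂ) : ∀ᵐ x, ∀ k, assemble U x k = (U k x).re := by
  classical
  have h1 : ∀ᵐ x : Sp N, ∀ i, (Complex.reCLM.smulRight
      (EuclideanSpace.single i (1 : ℝ) : EuclideanSpace ℝ ι)).compLp (U i) x =
      (U i x).re • EuclideanSpace.single i (1 : ℝ) := by
    rw [ae_all_iff]
    intro i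
    filter_upwards [ContinuousLinearMap.coeFn_compLp (Complex.reCLM.smulRight
      (EuclideanSpace.single i (1 : ℝ) : EuclideanSpace ℝ ι)) (U i)] with x hx
    rw [hx]
    rfl
  have h2 := Lp.coeFn_finsetSum Finset.univ (fun i => (Complex.reCLM.smulRight
      (EuclideanSpace.single i (1 : ℝ) : EuclideanSpace ℝ ι)).compLp (U i))
  filter_upwards [h1, h2] with x hx1 hx2 k
  unfold assemble
  rw [hx2, Finset.sum_apply]
  simp_rw [hx1]
  simp [Pi.single_apply]

theorem continuous_assemble : Continuous (assemble : (ι → L2 N ℂ) → L2 N (EuclideanSpace ℝ ι)) := by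
  classical
  unfold assemble
  refine continuous_finsetSum _ fun i _ => ?_
  exact ((Complex.reCLM.smulRight (EuclideanSpace.single i (1 : ℝ) : EuclideanSpace ℝ ι)).compLpL 2
    (volume : Measure (Sp N))).continuous.comp (continuous_apply i)

theorem integral_mul_test (U : L2 N ℂ) {ψ : Sp N → ℝ} (h : IsTest ψ) :
    Integrable fun x => U x * (ψ x : ℂ) := by
  have h2 : MemLp (fun x => (ψ x : ℂ)) 2 (volume : Measure (Sp N)) :=
    Complex.ofRealCLM.comp_memLp' (h.memLp 2 volume)
  exact (Lp.memLp U).integrable_mul h2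

theorem integral_assemble_mul (U : ι → L2 N ℂ) (k : ι) {ψ : Sp N → ℝ} (h : IsTest ψ) :
    ∫ x, assemble U x k * ψ x = (∫ ξ, (𝓕 (U k) : L2 N ℂ) ξ * (𝓕⁻ h.schwartz) ξ).re := by
  rw [← integral_mul_schwartz]
  have h1 := integral_mul_test (U k) h
  have h2 := integral_re h1
  simp only [RCLike.re_eq_complex_re] at h2
  simp only [IsTest.schwartz_apply]
  rw [← h2]
  apply integral_congr_ae
  filter_upwards [coeFn_assemble U] with x hx
  simp [hx]

theorem IsTest.conj_fourierInv {ψ : Sp N → ℝ} (h : IsTest ψ) (ξ : Sp N) :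
    (starRingEnd ℂ) ((𝓕⁻ h.schwartz) ξ) = (𝓕⁻ h.schwartz) (-ξ) := by
  rw [SchwartzMap.fourierInv_coe, Real.fourierInv_eq', Real.fourierInv_eq', ← integral_conj]
  congr 1
  funext x
  simp only [IsTest.schwartz_apply, smul_eq_mul, map_mul, Complex.conj_ofReal, ← Complex.exp_conj,
    Complex.conj_I, inner_neg_right]
  congr 2
  push_cast
  ring

theorem memLp_fourier_neg (f : L2 N ℂ) :
    MemLp (fun ξ => (starRingEnd ℂ) ((f : Sp N → ℂ) (-ξ))) 2 (volume : Measure (Sp N)) := by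
  have h1 : MemLp (fun ξ => (f : Sp N → ℂ) (-ξ)) 2 (volume : Measure (Sp N)) :=
    (Lp.memLp f).comp_measurePreserving (Measure.measurePreserving_neg _)
  exact (Complex.conjCLE : ℂ →L[ℝ] ℂ).comp_memLp' h1

/-- The Fourier transform of the real part is the Hermitian part of the Fourier transform. -/
theorem fourier_coordC_assemble (U : ι → L2 N ℂ) (k : ι) :
    ∀ᵐ ξ, (𝓕 (coordC k (assemble U)) : L2 N ℂ) ξ =
      2⁻¹ * ((𝓕 (U k) : L2 N ℂ) ξ + (starRingEnd ℂ) ((𝓕 (U k) : L2 N ℂ) (-ξ))) := by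
  set A : L2 N ℂ := 𝓕 (coordC k (assemble U)) with hA
  set B : L2 N ℂ := 𝓕 (U k) with hB
  have hB' : Tempered fun ξ => (starRingEnd ℂ) ((B : Sp N → ℂ) (-ξ)) :=
    tempered_of_memLp_two (memLp_fourier_neg B)
  have hT : Tempered fun ξ => A ξ - 2⁻¹ * (B ξ + (starRingEnd ℂ) ((B : Sp N → ℂ) (-ξ))) :=
    (tempered_coe A).sub (((tempered_coe B).add hB').const_mul _)
  have h0 := hT.ae_eq_zero fun ψ hψ => by
    have e1 := integral_coord_mul k (assemble U) hψ
    rw [integral_assemble_mul U k hψ] at e1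
    have e2 : ∫ ξ, (starRingEnd ℂ) ((B : Sp N → ℂ) (-ξ)) * (𝓕⁻ hψ.schwartz) ξ =
        (starRingEnd ℂ) (∫ ξ, B ξ * (𝓕⁻ hψ.schwartz) ξ) := by
      rw [← integral_conj, ← integral_neg_eq_self]
      congr 1
      funext ξ
      rw [neg_neg, map_mul, hψ.conj_fourierInv]
    have i1 := (tempered_coe A).integrable_mul (𝓕⁻ hψ.schwartz)
    have i2 := (tempered_coe B).integrable_mul (𝓕⁻ hψ.schwartz)
    have i3 := hB'.integrable_mul (𝓕⁻ hψ.schwartz)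
    have e3 : ∀ ξ, (A ξ - 2⁻¹ * (B ξ + (starRingEnd ℂ) ((B : Sp N → ℂ) (-ξ)))) *
        (𝓕⁻ hψ.schwartz) ξ = A ξ * (𝓕⁻ hψ.schwartz) ξ - 2⁻¹ * (B ξ * (𝓕⁻ hψ.schwartz) ξ +
        (starRingEnd ℂ) ((B : Sp N → ℂ) (-ξ)) * (𝓕⁻ hψ.schwartz) ξ) := fun ξ => by ring
    simp_rw [e3]
    have i4 : Integrable fun ξ => B ξ * (𝓕⁻ hψ.schwartz) ξ +
        (starRingEnd ℂ) ((B : Sp N → ℂ) (-ξ)) * (𝓕⁻ hψ.schwartz) ξ := i2.add i3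
    rw [integral_sub i1 (i4.const_mul _), integral_const_mul, integral_add i2 i3, e2,
      ← e1, Complex.add_conj]
    push_cast
    ring
  filter_upwards [h0] with ξ hξ
  exact sub_eq_zero.1 hξ

/-- Taking real parts does not increase weighted `L²` norms of the Fourier transform, as long as
the weight is even. -/
theorem lintegral_fourier_assemble_le (U : ι → L2 N ℂ) (k : ι) (W : Sp N → ℝ≥0∞)
    (hW : Measurable W) (hWe : ∀ ξ, W (-ξ) = W ξ) :
    ∫⁻ ξ, W ξ * ‖(𝓕 (coordC k (assemble U)) : L2 N ℂ) ξ‖ₑ ^ 2 ≤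
      ∫⁻ ξ, W ξ * ‖(𝓕 (U k) : L2 N ℂ) ξ‖ₑ ^ 2 := by
  set B : L2 N ℂ := 𝓕 (U k) with hB
  have hm : Measurable fun ξ => W ξ * ‖B ξ‖ₑ ^ 2 :=
    hW.mul ((Lp.stronglyMeasurable B).enorm.pow_const 2)
  calc _ ≤ ∫⁻ ξ, 2⁻¹ * (W ξ * ‖B ξ‖ₑ ^ 2 + W (-ξ) * ‖(B : Sp N → ℂ) (-ξ)‖ₑ ^ 2) := by
        refine lintegral_mono_ae ?_
        filter_upwards [fourier_coordC_assemble U k] with ξ hξ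
        have h2 : ‖(2⁻¹ : ℂ)‖ₑ = 2⁻¹ := by
          rw [← ofReal_norm, norm_inv, Complex.norm_ofNat, ENNReal.ofReal_inv_of_pos (by norm_num)]
          simp
        have h3 : ‖B ξ + (starRingEnd ℂ) ((B : Sp N → ℂ) (-ξ))‖ₑ ^ 2 ≤
            2 * (‖B ξ‖ₑ ^ 2 + ‖(B : Sp N → ℂ) (-ξ)‖ₑ ^ 2) := by
          refine (pow_le_pow_left₀ zero_le (enorm_add_le _ _) 2).trans ?_
          refine (ennreal_add_sq_le _ _).trans (le_of_eq ?_)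
          rw [mul_add]
          congr 3
          rw [← ofReal_norm, ← ofReal_norm, RCLike.norm_conj]
        rw [hξ, hWe, enorm_mul, mul_pow, h2]
        calc _ ≤ W ξ * (2⁻¹ ^ 2 * (2 * (‖B ξ‖ₑ ^ 2 + ‖(B : Sp N → ℂ) (-ξ)‖ₑ ^ 2))) := by
              gcongr
          _ = W ξ * (2⁻¹ * (2⁻¹ * 2) * (‖B ξ‖ₑ ^ 2 + ‖(B : Sp N → ℂ) (-ξ)‖ₑ ^ 2)) := by ring
          _ = _ := by
              rw [ENNReal.inv_mul_cancel (by norm_num) (by norm_num)]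
              ring
    _ = ∫⁻ ξ, W ξ * ‖B ξ‖ₑ ^ 2 := by
        have hm' : Measurable fun ξ => W (-ξ) * ‖(B : Sp N → ℂ) (-ξ)‖ₑ ^ 2 :=
          hm.comp measurable_neg
        have hms : Measurable fun ξ => W ξ * ‖B ξ‖ₑ ^ 2 +
            W (-ξ) * ‖(B : Sp N → ℂ) (-ξ)‖ₑ ^ 2 := hm.add hm'
        rw [lintegral_const_mul _ hms, lintegral_add_left hm,
          lintegral_neg_eq_self (fun ξ => W ξ * ‖B ξ‖ₑ ^ 2), ← two_mul, ← mul_assoc,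
          ENNReal.inv_mul_cancel (by norm_num) (by norm_num), one_mul]

/-- The weight of `H^r` on the frequency side. -/
def weight (r : ℝ) (ξ : Sp N) : ℝ≥0∞ := ENNReal.ofReal ((1 + freq ξ) ^ r)

theorem continuous_weight_real (r : ℝ) : Continuous fun ξ : Sp N => (1 + freq ξ) ^ r :=
  (continuous_const.add continuous_freq).rpow_const
    fun ξ => Or.inl (add_pos_of_pos_of_nonneg one_pos (freq_nonneg ξ)).ne'

theorem measurable_weight (r : ℝ) : Measurable (weight r : Sp N → ℝ≥0∞) :=
  (continuous_weight_real r).measurable.ennreal_ofReal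

theorem weight_neg (r : ℝ) (ξ : Sp N) : weight r (-ξ) = weight r ξ := by
  simp [weight, freq]

theorem weight_add (r q : ℝ) (ξ : Sp N) : weight (r + q) ξ = weight r ξ * weight q ξ := by
  have h := freq_nonneg ξ
  unfold weight
  rw [Real.rpow_add (by positivity), ENNReal.ofReal_mul (by positivity)]

theorem weight_ne_top (r : ℝ) (ξ : Sp N) : weight r ξ ≠ ⊤ := ENNReal.ofReal_ne_top

theorem one_le_weight {r : ℝ} (hr : 0 ≤ r) (ξ : Sp N) : 1 ≤ weight r ξ :=
  ENNReal.one_le_ofReal.2 (Real.one_le_rpow (by linarith [freq_nonneg ξ]) hr)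

theorem weight_mono {r q : ℝ} (h : r ≤ q) (ξ : Sp N) : weight r ξ ≤ weight q ξ :=
  ENNReal.ofReal_le_ofReal (Real.rpow_le_rpow_of_exponent_le (by linarith [freq_nonneg ξ]) h)

theorem ennreal_sqrt_sq (z : ℝ≥0∞) : (z ^ (1 / 2 : ℝ)) ^ 2 = z := by
  rw [← ENNReal.rpow_natCast, ← ENNReal.rpow_mul]; norm_num

theorem sq_hsNorm (r : ℝ) (f : L2 N (EuclideanSpace ℝ ι)) :
    hsNorm r f ^ 2 = ∑ k, ∫⁻ ξ, weight r ξ * ‖(𝓕 (coordC k f) : L2 N ℂ) ξ‖ₑ ^ 2 := by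
  unfold hsNorm
  rw [ennreal_sqrt_sq]
  rfl

theorem hsNorm_assemble_le (r : ℝ) (U : ι → L2 N ℂ) :
    hsNorm r (assemble U) ^ 2 ≤ ∑ k, ∫⁻ ξ, weight r ξ * ‖(𝓕 (U k) : L2 N ℂ) ξ‖ₑ ^ 2 := by
  rw [sq_hsNorm]
  exact Finset.sum_le_sum fun k _ => lintegral_fourier_assemble_le U k _ (measurable_weight r)
    (weight_neg r)

end RealPart

/-! ### Bounded Fourier multipliers -/

section Multiplier

variable {ι : Type} [Fintype ι]

/-- Multiplication by a bounded function, as an operator on `L²`. -/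
def mulL (m : Sp N → ℂ) (hm : MemLp m ⊤ volume) : L2 N ℂ →L[ℂ] L2 N ℂ :=
  (ContinuousLinearMap.mul ℂ ℂ).holderL volume ⊤ 2 2 (hm.toLp m)

theorem coeFn_mulL (m : Sp N → ℂ) (hm : MemLp m ⊤ volume) (f : L2 N ℂ) :
    ∀ᵐ ξ, mulL m hm f ξ = m ξ * f ξ := by
  filter_upwards [(ContinuousLinearMap.mul ℂ ℂ).coeFn_holder (r := 2) (hm.toLp m) f,
    hm.coeFn_toLp] with ξ h1 h2
  have : mulL m hm f ξ = ((ContinuousLinearMap.mul ℂ ℂ).holder 2 (hm.toLp m) f : L2 N ℂ) ξ := rfl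
  rw [this, h1, h2]
  rfl

theorem memLp_top_of_le {m : Sp N → ℂ} (hm : Measurable m) {C : ℝ} (h : ∀ ξ, ‖m ξ‖ ≤ C) :
    MemLp m ⊤ volume :=
  memLp_top_of_bound hm.aestronglyMeasurable C (ae_of_all _ h)

end Multiplier

/-! ### Space-time test functions and their partial Fourier transforms -/

section SpaceTime

/-- Smooth, compactly supported functions on `ℝ × ℝ^N`. -/
def IsSmoothCompact (φ : ℝ × Sp N → ℝ) : Prop := ContDiff ℝ ∞ φ ∧ HasCompactSupport φ

theorem IsSpaceTimeTest.smooth {T : EReal} {φ : ℝ × Sp N → ℝ} (h : IsSpaceTimeTest T φ) :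
    IsSmoothCompact φ := ⟨h.1, h.2.1⟩

theorem IsSmoothCompact.slice {φ : ℝ × Sp N → ℝ} (h : IsSmoothCompact φ) (t : ℝ) :
    IsTest fun x => φ (t, x) := by
  refine ⟨h.1.comp (contDiff_const.prodMk contDiff_id), ?_⟩
  refine HasCompactSupport.intro (h.2.isCompact.image continuous_snd) fun x hx => ?_
  by_contra hne
  exact hx ⟨(t, x), subset_tsupport _ hne, rfl⟩

theorem IsSmoothCompact.fderiv {φ : ℝ × Sp N → ℝ} (h : IsSmoothCompact φ) (v : ℝ × Sp N) :
    IsSmoothCompact fun z => fderiv ℝ φ z v :=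
  ⟨(h.1.fderiv_right (m := ∞) (by simp)).clm_apply contDiff_const, h.2.fderiv_apply ℝ v⟩

theorem IsSmoothCompact.add {φ ψ : ℝ × Sp N → ℝ} (h : IsSmoothCompact φ)
    (h' : IsSmoothCompact ψ) : IsSmoothCompact fun z => φ z + ψ z :=
  ⟨h.1.add h'.1, h.2.add h'.2⟩

theorem IsSmoothCompact.sub {φ ψ : ℝ × Sp N → ℝ} (h : IsSmoothCompact φ)
    (h' : IsSmoothCompact ψ) : IsSmoothCompact fun z => φ z - ψ z :=
  ⟨h.1.sub h'.1, h.2.sub h'.2⟩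

theorem isSmoothCompact_zero : IsSmoothCompact fun _ : ℝ × Sp N => (0 : ℝ) :=
  ⟨contDiff_const, HasCompactSupport.zero⟩

theorem IsSmoothCompact.sum {ι : Type*} (s : Finset ι) {φ : ι → ℝ × Sp N → ℝ}
    (h : ∀ i ∈ s, IsSmoothCompact (φ i)) : IsSmoothCompact fun z => ∑ i ∈ s, φ i z := by
  classical
  induction s using Finset.induction_on with
  | empty => simpa using isSmoothCompact_zero
  | insert a s ha ih =>
    simp only [Finset.sum_insert ha]
    exact (h a (by simp)).add (ih fun i hi => h i (by simp [hi]))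

theorem IsSmoothCompact.hasDerivAt_slice {φ : ℝ × Sp N → ℝ} (h : IsSmoothCompact φ) (t : ℝ)
    (x : Sp N) : HasDerivAt (fun τ => φ (τ, x)) (_root_.fderiv ℝ φ (t, x) (1, 0)) t :=
  ((h.1.differentiable (by simp)) (t, x)).hasFDerivAt.comp_hasDerivAt t
    ((hasDerivAt_id t).prodMk (hasDerivAt_const t x))

theorem IsSmoothCompact.tderiv_eq {φ : ℝ × Sp N → ℝ} (h : IsSmoothCompact φ) (t : ℝ) (x : Sp N) :
    tderiv φ t x = _root_.fderiv ℝ φ (t, x) (1, 0) := (h.hasDerivAt_slice t x).deriv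

theorem IsSmoothCompact.xderiv_eq {φ : ℝ × Sp N → ℝ} (h : IsSmoothCompact φ) (j : Fin N) (t : ℝ)
    (x : Sp N) : xderiv j φ t x = _root_.fderiv ℝ φ (t, x) (0, EuclideanSpace.single j 1) := by
  have h1 : HasFDerivAt (fun y => φ (t, y)) ((_root_.fderiv ℝ φ (t, x)).comp
      (ContinuousLinearMap.inr ℝ ℝ (Sp N))) x :=
    HasFDerivAt.comp x ((h.1.differentiable (by simp)) (t, x)).hasFDerivAt
      (hasFDerivAt_prodMk_right t x)
  unfold xderiv pderiv
  rw [h1.fderiv]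
  rfl

theorem IsSmoothCompact.tderiv {φ : ℝ × Sp N → ℝ} (h : IsSmoothCompact φ) :
    IsSmoothCompact fun z => tderiv φ z.1 z.2 := by
  simp_rw [h.tderiv_eq]
  exact h.fderiv _

theorem IsSmoothCompact.xderiv {φ : ℝ × Sp N → ℝ} (h : IsSmoothCompact φ) (j : Fin N) :
    IsSmoothCompact fun z => xderiv j φ z.1 z.2 := by
  simp_rw [h.xderiv_eq]
  exact h.fderiv _

theorem IsSmoothCompact.xlap_eq {φ : ℝ × Sp N → ℝ} (h : IsSmoothCompact φ) (t : ℝ) (x : Sp N) :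
    xlap φ t x = ∑ j, StokesHeat.xderiv j (fun z => StokesHeat.xderiv j φ z.1 z.2) t x :=
  laplacian_eq_sum_pderiv (h.slice t).1 x

theorem IsSmoothCompact.xlap {φ : ℝ × Sp N → ℝ} (h : IsSmoothCompact φ) :
    IsSmoothCompact fun z => xlap φ z.1 z.2 := by
  simp_rw [h.xlap_eq]
  exact IsSmoothCompact.sum _ fun j _ => (h.xderiv j).xderiv j

theorem IsSmoothCompact.memLp {φ : ℝ × Sp N → ℝ} (h : IsSmoothCompact φ) (p : ℝ≥0∞)
    (μ : Measure (ℝ × Sp N)) [IsFiniteMeasureOnCompacts μ] : MemLp φ p μ :=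
  h.1.continuous.memLp_of_hasCompactSupport h.2

/-- The inverse Fourier transform in the space variable. It is the inverse transform that pairs
with the Fourier transforms of the fields. -/
def sliceF (φ : ℝ × Sp N → ℝ) (t : ℝ) (ξ : Sp N) : ℂ := 𝓕⁻ (fun x => (φ (t, x) : ℂ)) ξ

theorem IsSmoothCompact.sliceF_eq {φ : ℝ × Sp N → ℝ} (h : IsSmoothCompact φ) (t : ℝ) (ξ : Sp N) :
    sliceF φ t ξ = (𝓕⁻ (h.slice t).schwartz) ξ := by
  rw [SchwartzMap.fourierInv_coe]
  rfl

theorem sliceF_eq_integral (φ : ℝ × Sp N → ℝ) (t : ℝ) (ξ : Sp N) :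
    sliceF φ t ξ = ∫ x, Complex.exp (2 * Real.pi * inner ℝ x ξ * Complex.I) * (φ (t, x) : ℂ) := by
  unfold sliceF
  rw [Real.fourierInv_eq']
  simp

theorem IsSmoothCompact.stronglyMeasurable_sliceF {φ : ℝ × Sp N → ℝ} (h : IsSmoothCompact φ) :
    StronglyMeasurable fun z : ℝ × Sp N => sliceF φ z.1 z.2 := by
  simp_rw [sliceF_eq_integral]
  have hc : Continuous fun q : (ℝ × Sp N) × Sp N =>
      Complex.exp (2 * Real.pi * inner ℝ q.2 q.1.2 * Complex.I) * (φ (q.1.1, q.2) : ℂ) := by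
    have := h.1.continuous
    fun_prop
  exact hc.stronglyMeasurable.integral_prod_right

theorem IsSmoothCompact.hasDerivAt_sliceF {φ : ℝ × Sp N → ℝ} (h : IsSmoothCompact φ) (t : ℝ)
    (ξ : Sp N) :
    HasDerivAt (fun τ => sliceF φ τ ξ)
      (sliceF (fun z => StokesHeat.tderiv φ z.1 z.2) t ξ) t := by
  simp_rw [sliceF_eq_integral]
  obtain ⟨C, hC⟩ := h.tderiv.2.exists_bound_of_continuous h.tderiv.1.continuous
  set K : Set (Sp N) := Prod.snd '' tsupport (fun z => StokesHeat.tderiv φ z.1 z.2) with hK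
  have hKc : IsCompact K := h.tderiv.2.isCompact.image continuous_snd
  have hexp : ∀ x : Sp N, ‖Complex.exp (2 * Real.pi * inner ℝ x ξ * Complex.I)‖ = 1 := fun x => by
    have := Complex.norm_exp_ofReal_mul_I (2 * Real.pi * inner ℝ x ξ)
    push_cast at this
    exact this
  have hcont : ∀ (ψ : ℝ × Sp N → ℝ) (_ : Continuous ψ) (τ : ℝ), Continuous fun x : Sp N =>
      Complex.exp (2 * Real.pi * inner ℝ x ξ * Complex.I) * (ψ (τ, x) : ℂ) := by
    intro ψ hψ τ
    fun_prop
  refine (hasDerivAt_integral_of_dominated_loc_of_deriv_le (𝕜 := ℝ) (E := ℂ) (μ := volume)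
    (F := fun τ x => Complex.exp (2 * Real.pi * inner ℝ x ξ * Complex.I) * (φ (τ, x) : ℂ))
    (F' := fun τ x => Complex.exp (2 * Real.pi * inner ℝ x ξ * Complex.I) *
      (StokesHeat.tderiv φ τ x : ℂ))
    (bound := K.indicator fun _ => C) (s := Set.univ) univ_mem ?_ ?_ ?_ ?_ ?_ ?_).2
  · exact Eventually.of_forall fun τ => (hcont φ h.1.continuous τ).aestronglyMeasurable
  · refine Continuous.integrable_of_hasCompactSupport (hcont φ h.1.continuous t) ?_
    exact HasCompactSupport.mul_left ((h.slice t).2.comp_left (g := fun r : ℝ => (r : ℂ)) (by simp))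
  · exact (hcont _ h.tderiv.1.continuous t).aestronglyMeasurable
  · refine ae_of_all _ fun x τ _ => ?_
    rw [norm_mul, hexp, one_mul, Complex.norm_real]
    by_cases hx : x ∈ K
    · rw [indicator_of_mem hx]; exact hC (τ, x)
    · rw [indicator_of_notMem hx]
      have : StokesHeat.tderiv φ τ x = 0 := by
        by_contra hne
        exact hx ⟨(τ, x), subset_tsupport _ hne, rfl⟩
      simp [this]
  · exact (integrable_indicator_iff hKc.measurableSet).2
      (integrableOn_const hKc.measure_lt_top.ne)
  · refine ae_of_all _ fun x τ _ => ?_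
    have h1 := h.hasDerivAt_slice τ x
    rw [← h.tderiv_eq] at h1
    exact h1.ofReal_comp.const_mul _

theorem IsSmoothCompact.continuous_sliceF {φ : ℝ × Sp N → ℝ} (h : IsSmoothCompact φ) (ξ : Sp N) :
    Continuous fun τ => sliceF φ τ ξ :=
  continuous_iff_continuousAt.2 fun t => (h.hasDerivAt_sliceF t ξ).continuousAt

theorem IsSmoothCompact.sliceF_xderiv {φ : ℝ × Sp N → ℝ} (h : IsSmoothCompact φ) (j : Fin N)
    (t : ℝ) (ξ : Sp N) :
    sliceF (fun z => StokesHeat.xderiv j φ z.1 z.2) t ξ =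
      -(2 * Real.pi * Complex.I) * (ξ j : ℂ) * sliceF φ t ξ := by
  rw [h.sliceF_eq, (h.xderiv j).sliceF_eq, ← (h.slice t).fourierInv_pderiv j ξ]
  rfl

theorem IsSmoothCompact.sliceF_xlap {φ : ℝ × Sp N → ℝ} (h : IsSmoothCompact φ)
    (t : ℝ) (ξ : Sp N) :
    sliceF (fun z => StokesHeat.xlap φ z.1 z.2) t ξ = -(freq ξ : ℂ) * sliceF φ t ξ := by
  rw [h.sliceF_eq, h.xlap.sliceF_eq, ← (h.slice t).fourierInv_laplacian ξ]
  rfl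

theorem IsSmoothCompact.sliceF_add {φ ψ : ℝ × Sp N → ℝ} (h : IsSmoothCompact φ)
    (h' : IsSmoothCompact ψ) (t : ℝ) (ξ : Sp N) :
    sliceF (fun z => φ z + ψ z) t ξ = sliceF φ t ξ + sliceF ψ t ξ := by
  rw [h.sliceF_eq, h'.sliceF_eq, (h.add h').sliceF_eq]
  have : ((h.add h').slice t).schwartz = (h.slice t).schwartz + (h'.slice t).schwartz := by
    ext x; simp
  rw [this, FourierTransform.fourierInv_add]
  rfl

theorem IsSmoothCompact.sliceF_sub {φ ψ : ℝ × Sp N → ℝ} (h : IsSmoothCompact φ)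
    (h' : IsSmoothCompact ψ) (t : ℝ) (ξ : Sp N) :
    sliceF (fun z => φ z - ψ z) t ξ = sliceF φ t ξ - sliceF ψ t ξ := by
  have h1 := (h.sub h').sliceF_add h' t ξ
  simp only [sub_add_cancel] at h1
  rw [h1, add_sub_cancel_right]

/-- Plancherel for a slice. -/
theorem IsTest.lintegral_fourierInv {ψ : Sp N → ℝ} (h : IsTest ψ) :
    ∫⁻ ξ, ‖(𝓕⁻ h.schwartz) ξ‖ₑ ^ 2 = ∫⁻ x, ‖ψ x‖ₑ ^ 2 := by
  have h1 := SchwartzMap.norm_fourier_toL2_eq (𝓕⁻ h.schwartz)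
  rw [FourierTransform.fourier_fourierInv_eq, SchwartzMap.norm_toLp, SchwartzMap.norm_toLp] at h1
  have f1 : eLpNorm (h.schwartz : Sp N → ℂ) 2 volume ≠ ⊤ :=
    (h.schwartz.memLp 2 volume).eLpNorm_ne_top
  have f2 : eLpNorm ((𝓕⁻ h.schwartz : 𝓢(Sp N, ℂ)) : Sp N → ℂ) 2 volume ≠ ⊤ :=
    ((𝓕⁻ h.schwartz : 𝓢(Sp N, ℂ)).memLp 2 volume).eLpNorm_ne_top
  have h3 := (ENNReal.toReal_eq_toReal_iff' f1 f2).1 h1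
  have h2 : ∀ f : Sp N → ℂ, eLpNorm f 2 volume ^ 2 = ∫⁻ x, ‖f x‖ₑ ^ 2 := fun f => by
    rw [eLpNorm_eq_lintegral_rpow_enorm_toReal (by norm_num) (by norm_num)]
    simp only [ENNReal.toReal_ofNat]
    rw [ennreal_sqrt_sq]
    simp
  rw [← h2, ← h3, h2]
  refine lintegral_congr fun x => ?_
  rw [IsTest.schwartz_apply, ← ofReal_norm, ← ofReal_norm, Complex.norm_real]

theorem IsSmoothCompact.lintegral_sliceF_lt_top {φ : ℝ × Sp N → ℝ} (h : IsSmoothCompact φ) :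
    ∫⁻ t : ℝ, ∫⁻ ξ : Sp N, ‖sliceF φ t ξ‖ₑ ^ 2 < ⊤ := by
  simp_rw [h.sliceF_eq, (h.slice _).lintegral_fourierInv]
  rw [← lintegral_prod (μ := volume) (ν := volume) (fun z : ℝ × Sp N => ‖φ z‖ₑ ^ 2)
    (by have := h.1.continuous; fun_prop)]
  have h1 := (h.memLp 2 ((volume : Measure ℝ).prod (volume : Measure (Sp N)))).2
  rw [eLpNorm_lt_top_iff_lintegral_rpow_enorm_lt_top (by norm_num) (by norm_num)] at h1
  simpa using h1

/-- The support of a test function on `[0, T) × ℝ^N` ends before a time `b < T`. -/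
theorem IsSpaceTimeTest.exists_bound {T : EReal} (hT : 0 < T) {φ : ℝ × Sp N → ℝ}
    (h : IsSpaceTimeTest T φ) :
    ∃ b : ℝ, 0 < b ∧ (b : EReal) < T ∧ ∀ z ∈ tsupport φ, z.1 < b := by
  obtain ⟨c, hc0, hcT⟩ := EReal.lt_iff_exists_real_btwn.1 hT
  have hc0' : 0 < c := by exact_mod_cast hc0
  rcases (tsupport φ).eq_empty_or_nonempty with he | hne
  · exact ⟨c, hc0', hcT, by simp [he]⟩
  · obtain ⟨z, hz, hmax⟩ := h.2.1.isCompact.exists_isMaxOn hne continuous_fst.continuousOn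
    obtain ⟨b, hb1, hb2⟩ := EReal.lt_iff_exists_real_btwn.1 (max_lt (h.2.2 z hz) hcT)
    rw [max_lt_iff] at hb1
    refine ⟨b, ?_, hb2, fun z' hz' => ?_⟩
    · exact hc0'.trans (EReal.coe_lt_coe_iff.1 hb1.2)
    · exact lt_of_le_of_lt (hmax hz') (EReal.coe_lt_coe_iff.1 hb1.1)

theorem sliceF_eq_zero {φ : ℝ × Sp N → ℝ} {b t : ℝ} (hb : ∀ z ∈ tsupport φ, z.1 < b) (ht : b ≤ t)
    (ξ : Sp N) : sliceF φ t ξ = 0 := by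
  have : ∀ x, φ (t, x) = 0 := fun x => by
    by_contra hne
    exact absurd (hb (t, x) (subset_tsupport _ hne)) (not_lt.2 ht)
  rw [sliceF_eq_integral]
  simp [this]

theorem IsSmoothCompact.tsupport_tderiv {φ : ℝ × Sp N → ℝ} (h : IsSmoothCompact φ) :
    tsupport (fun z => StokesHeat.tderiv φ z.1 z.2) ⊆ tsupport φ := by
  simp_rw [h.tderiv_eq]
  exact tsupport_fderiv_apply_subset ℝ _

end SpaceTime

/-! ### Pairings of time-dependent fields with test functions -/

section TimeIntegrals

instance : Fact ((2 : ℝ≥0∞) ≠ ⊤) := ⟨by norm_num⟩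

/-- Pairing an `L²` in time family with a smooth compactly supported function. -/
theorem integrable_pairing {μ : Measure (Sp N)} [SFinite μ] [IsFiniteMeasureOnCompacts μ]
    [SecondCountableTopology (Lp ℝ 2 μ)] {τ : Measure ℝ} [SFinite τ]
    [IsFiniteMeasureOnCompacts τ] {f : ℝ → Lp ℝ 2 μ}
    (hf : MemLp f 2 τ) {φ : ℝ × Sp N → ℝ} (h : IsSmoothCompact φ) :
    Integrable (fun t => ∫ x, f t x * φ (t, x) ∂μ) τ := by
  obtain ⟨G, hG, hGf⟩ := exists_joint_representative f hf.1
  have hae : ∀ᵐ t ∂τ, ∫ x, G (t, x) * φ (t, x) ∂μ = ∫ x, f t x * φ (t, x) ∂μ := by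
    filter_upwards [hGf] with t ht
    refine integral_congr_ae ?_
    filter_upwards [ht] with x hx
    rw [hx]
  refine Integrable.congr ?_ hae
  have hm : StronglyMeasurable fun z : ℝ × Sp N => G z * φ z :=
    hG.mul h.1.continuous.stronglyMeasurable
  have hsq : ∀ᵐ t ∂τ, ∫⁻ x, ‖G (t, x)‖ₑ ^ 2 ∂μ = ‖f t‖ₑ ^ 2 := by
    filter_upwards [hGf] with t ht
    rw [Lp.enorm_def, eLpNorm_eq_lintegral_rpow_enorm_toReal (by norm_num) (by norm_num)]
    simp only [ENNReal.toReal_ofNat]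
    rw [ennreal_sqrt_sq]
    refine lintegral_congr_ae ?_
    filter_upwards [ht] with x hx
    rw [hx]
    simp
  have hint : Integrable (fun z : ℝ × Sp N => G z * φ z) (τ.prod μ) := by
    refine MemLp.integrable_mul (p := 2) (q := 2) ⟨hG.aestronglyMeasurable, ?_⟩ (h.memLp 2 _)
    rw [eLpNorm_lt_top_iff_lintegral_rpow_enorm_lt_top (by norm_num) (by norm_num)]
    simp only [ENNReal.toReal_ofNat, ENNReal.rpow_ofNat]
    rw [lintegral_prod _ (hG.enorm.pow_const 2).aemeasurable, lintegral_congr_ae hsq]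
    have h1 := hf.2
    rw [eLpNorm_lt_top_iff_lintegral_rpow_enorm_lt_top (by norm_num) (by norm_num)] at h1
    simpa using h1
  exact hint.integral_prod_left

variable {ι : Type} [Fintype ι]

theorem enorm_sq_eq_sum (f : L2 N (EuclideanSpace ℝ ι)) :
    ‖f‖ₑ ^ 2 = ∑ k, ‖coordC k f‖ₑ ^ 2 := by
  have h2 : ∀ {V : Type} [NormedAddCommGroup V] (f : L2 N V), ‖f‖ₑ ^ 2 = ∫⁻ x, ‖f x‖ₑ ^ 2 := by
    intro V _ f
    rw [Lp.enorm_def, eLpNorm_eq_lintegral_rpow_enorm_toReal (by norm_num) (by norm_num)]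
    simp only [ENNReal.toReal_ofNat]
    rw [ennreal_sqrt_sq]
    simp
  simp_rw [h2]
  rw [← lintegral_finsetSum' _ fun k _ =>
    ((Lp.stronglyMeasurable (coordC k f)).enorm.pow_const 2).aemeasurable]
  refine lintegral_congr_ae ?_
  have h3 : ∀ᵐ x, ∀ k, coordC k f x = (f x k : ℂ) := ae_all_iff.2 fun k => coeFn_coordC k f
  filter_upwards [h3] with x hx
  simp_rw [hx]
  rw [← ofReal_norm, ← ENNReal.ofReal_pow (norm_nonneg _), EuclideanSpace.norm_sq_eq,
    ENNReal.ofReal_sum_of_nonneg fun _ _ => sq_nonneg _]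
  refine Finset.sum_congr rfl fun k _ => ?_
  rw [← ofReal_norm, ← ENNReal.ofReal_pow (norm_nonneg _), Complex.norm_real]

theorem lintegral_fourier_eq (f : L2 N ℂ) :
    ∫⁻ ξ, ‖(𝓕 f : L2 N ℂ) ξ‖ₑ ^ 2 = ‖f‖ₑ ^ 2 := by
  have h1 : ‖(𝓕 f : L2 N ℂ)‖ₑ = ‖f‖ₑ := by
    rw [← ofReal_norm, ← ofReal_norm, Lp.norm_fourier_eq]
  rw [← h1, Lp.enorm_def, eLpNorm_eq_lintegral_rpow_enorm_toReal (by norm_num) (by norm_num)]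
  simp only [ENNReal.toReal_ofNat]
  rw [ennreal_sqrt_sq]
  simp

theorem enorm_le_hsNorm {r : ℝ} (hr : 0 ≤ r) (f : L2 N (EuclideanSpace ℝ ι)) :
    ‖f‖ₑ ≤ hsNorm r f := by
  rw [← ENNReal.pow_le_pow_left_iff (n := 2) (by norm_num), sq_hsNorm, enorm_sq_eq_sum]
  refine Finset.sum_le_sum fun k _ => ?_
  rw [← lintegral_fourier_eq]
  exact lintegral_mono fun ξ => le_mul_of_one_le_left zero_le (one_le_weight hr ξ)

theorem sq_l2HsNorm (T : EReal) (r : ℝ) (w : ℝ → L2 N (EuclideanSpace ℝ ι)) :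
    l2HsNorm T r w ^ 2 = ∫⁻ t, hsNorm r (w t) ^ 2 ∂(timeMeasure T) := by
  unfold l2HsNorm
  rw [ennreal_sqrt_sq]

theorem memLp_of_l2HsNorm {T : EReal} {r : ℝ} (hr : 0 ≤ r) {w : ℝ → L2 N (EuclideanSpace ℝ ι)}
    (hm : AEStronglyMeasurable w (timeMeasure T)) (h : l2HsNorm T r w < ⊤) :
    MemLp w 2 (timeMeasure T) := by
  refine ⟨hm, ?_⟩
  rw [eLpNorm_lt_top_iff_lintegral_rpow_enorm_lt_top (by norm_num) (by norm_num)]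
  simp only [ENNReal.toReal_ofNat, ENNReal.rpow_ofNat]
  calc _ ≤ ∫⁻ t, hsNorm r (w t) ^ 2 ∂(timeMeasure T) :=
        lintegral_mono fun t => pow_le_pow_left₀ zero_le (enorm_le_hsNorm hr _) 2
    _ = l2HsNorm T r w ^ 2 := (sq_l2HsNorm T r w).symm
    _ < ⊤ := ENNReal.pow_lt_top h

theorem MemL2Hs.memLp {T : EReal} {r : ℝ} (hr : 0 ≤ r) {w : ℝ → L2 N (EuclideanSpace ℝ ι)}
    (h : MemL2Hs T r w) : MemLp w 2 (timeMeasure T) := memLp_of_l2HsNorm hr h.1 h.2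

theorem MemX.memLp {T : EReal} {r : ℝ} (hr : 0 ≤ r) {w : ℝ → L2 N (EuclideanSpace ℝ ι)}
    (h : MemX T r w) : MemLp w 2 (timeMeasure T) :=
  memLp_of_l2HsNorm (by linarith) h.1 (lt_of_le_of_lt le_add_self h.2)

instance (T : EReal) : IsFiniteMeasureOnCompacts (timeMeasure T) := by
  unfold timeMeasure; infer_instance

theorem memLp_coordReal {T : EReal} {w : ℝ → L2 N (EuclideanSpace ℝ ι)}
    (h : MemLp w 2 (timeMeasure T)) (k : ι) :
    MemLp (fun t => (EuclideanSpace.proj k : EuclideanSpace ℝ ι →L[ℝ] ℝ).compLp (w t)) 2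
      (timeMeasure T) :=
  ((EuclideanSpace.proj k : EuclideanSpace ℝ ι →L[ℝ] ℝ).compLpL 2
    (volume : Measure (Sp N))).comp_memLp' h

theorem memLp_coordC {T : EReal} {w : ℝ → L2 N (EuclideanSpace ℝ ι)}
    (h : MemLp w 2 (timeMeasure T)) (k : ι) :
    MemLp (fun t => coordC k (w t)) 2 (timeMeasure T) :=
  ((Complex.ofRealCLM.comp (EuclideanSpace.proj k : EuclideanSpace ℝ ι →L[ℝ] ℝ)).compLpL 2
    (volume : Measure (Sp N))).comp_memLp' h

theorem memLp_fourier {τ : Measure ℝ} {w : ℝ → L2 N ℂ} (h : MemLp w 2 τ) :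
    MemLp (fun t => (𝓕 (w t) : L2 N ℂ)) 2 τ :=
  ((Lp.fourierTransformₗᵢ (Sp N) ℂ).toContinuousLinearEquiv : L2 N ℂ →L[ℂ] L2 N ℂ).comp_memLp' h

theorem integrable_pairing_coord {T : EReal} {w : ℝ → L2 N (EuclideanSpace ℝ ι)}
    (hw : MemLp w 2 (timeMeasure T)) (k : ι) {φ : ℝ × Sp N → ℝ} (h : IsSmoothCompact φ) :
    Integrable (fun t => ∫ x, w t x k * φ (t, x)) (timeMeasure T) := by
  refine (integrable_pairing (memLp_coordReal hw k) h).congr (ae_of_all _ fun t => ?_)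
  refine integral_congr_ae ?_
  filter_upwards [ContinuousLinearMap.coeFn_compLp
    (EuclideanSpace.proj k : EuclideanSpace ℝ ι →L[ℝ] ℝ) (w t)] with x hx
  rw [hx]
  rfl

end TimeIntegrals

/-! ### The heat equation on the frequency side -/

section HeatSolution

/-- The frequency side of the solution of the heat equation with data `Y₀` and forcing `f`. -/
def heatSol (T : EReal) (Y₀ : Sp N → ℂ) (f : ℝ × Sp N → ℂ) (z : ℝ × Sp N) : ℂ :=
  duhamel T (freq z.2) (Y₀ z.2) (fun s => f (s, z.2)) z.1

theorem heatSol_apply (T : EReal) (Y₀ : Sp N → ℂ) (f : ℝ × Sp N → ℂ) (t : ℝ) (ξ : Sp N) :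
    heatSol T Y₀ f (t, ξ) = duhamel T (freq ξ) (Y₀ ξ) (fun s => f (s, ξ)) t := rfl

theorem stronglyMeasurable_heatSol (T : EReal) {Y₀ : Sp N → ℂ} {f : ℝ × Sp N → ℂ}
    (hY : StronglyMeasurable Y₀) (hf : StronglyMeasurable f) :
    StronglyMeasurable (heatSol T Y₀ f) := by
  unfold heatSol duhamel
  refine StronglyMeasurable.add ?_ ?_
  · refine StronglyMeasurable.mul ?_ (hY.comp_measurable measurable_snd)
    have : Continuous fun z : ℝ × Sp N => (Real.exp (-(freq z.2 * z.1)) : ℂ) := by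
      have := continuous_freq (N := N)
      fun_prop
    exact this.stronglyMeasurable
  · have h : StronglyMeasurable fun q : (ℝ × Sp N) × ℝ =>
        (expKernel (freq q.1.2) (q.1.1 - q.2) : ℂ) * f (q.2, q.1.2) := by
      refine StronglyMeasurable.mul ?_ (hf.comp_measurable (by fun_prop))
      refine (Complex.measurable_ofReal.comp (measurable_expKernel.comp
        ((continuous_freq.measurable.comp (by fun_prop)).prodMk
          (by fun_prop)))).stronglyMeasurable
    exact h.integral_prod_right

theorem measurable_slice {f : ℝ × Sp N → ℂ} (hf : StronglyMeasurable f) (ξ : Sp N) :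
    Measurable fun s => f (s, ξ) := hf.measurable.comp (measurable_id.prodMk measurable_const)

theorem measurable_time_energy (T : EReal) {f : ℝ × Sp N → ℂ} (hf : StronglyMeasurable f) :
    Measurable fun ξ => ∫⁻ t, ‖f (t, ξ)‖ₑ ^ 2 ∂(timeMeasure T) :=
  (hf.enorm.pow_const 2).lintegral_prod_left'

/-- The weighted forcing energy `∫ (1 + |2πξ|²)^r ∫ |f(t, ξ)|² dt dξ`: the square of the norm of
`L²((0, T); H^r)`, on the frequency side. -/
def forcingEnergy (T : EReal) (r : ℝ) (f : ℝ × Sp N → ℂ) : ℝ≥0∞ :=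
  ∫⁻ ξ, weight r ξ * ∫⁻ t, ‖f (t, ξ)‖ₑ ^ 2 ∂(timeMeasure T)

theorem forcingEnergy_eq (T : EReal) (r : ℝ) {f : ℝ × Sp N → ℂ} (hf : StronglyMeasurable f) :
    forcingEnergy T r f = ∫⁻ t, (∫⁻ ξ, weight r ξ * ‖f (t, ξ)‖ₑ ^ 2) ∂(timeMeasure T) := by
  unfold forcingEnergy
  rw [lintegral_lintegral_swap]
  · refine lintegral_congr fun ξ => ?_
    rw [lintegral_const_mul' _ _ (weight_ne_top r ξ)]
  · exact (((measurable_weight r).comp measurable_snd).mul (hf.enorm.pow_const 2)).aemeasurable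

theorem ae_time_energy_lt_top {T : EReal} {r : ℝ} {f : ℝ × Sp N → ℂ} (hf : StronglyMeasurable f)
    (hB : forcingEnergy T r f < ⊤) :
    ∀ᵐ ξ : Sp N, ∫⁻ t, ‖f (t, ξ)‖ₑ ^ 2 ∂(timeMeasure T) < ⊤ := by
  have := ae_lt_top ((measurable_weight r).mul (measurable_time_energy T hf)) hB.ne
  filter_upwards [this] with ξ hξ
  by_contra hne
  have hw : weight r ξ ≠ 0 := by
    unfold weight
    rw [ENNReal.ofReal_ne_zero_iff]
    have := freq_nonneg ξ
    positivity
  simp only [Pi.mul_apply, not_lt_top_iff.1 hne, ENNReal.mul_top hw] at hξ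
  exact lt_irrefl _ hξ

theorem weight_mul_mass {T : EReal} {κ : ℝ} (hκ : 0 ≤ κ) {ξ : Sp N}
    (h : kernelMass T (freq ξ) ≤ ENNReal.ofReal (κ / (1 + freq ξ))) (r : ℝ) :
    weight r ξ * kernelMass T (freq ξ) ≤ ENNReal.ofReal κ * weight (r - 1) ξ := by
  have h0 : 0 < 1 + freq ξ := by linarith [freq_nonneg ξ]
  calc _ ≤ weight r ξ * ENNReal.ofReal (κ / (1 + freq ξ)) := by gcongr
    _ = _ := by
      unfold weight
      rw [← ENNReal.ofReal_mul (by positivity), ← ENNReal.ofReal_mul hκ, Real.rpow_sub_one h0.ne']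
      congr 1
      ring

theorem lintegral_heatSol_le {T : EReal} {κ : ℝ} (hκ : 0 ≤ κ) {S : Set (Sp N)}
    (hS : MeasurableSet S)
    (h : ∀ ξ ∈ S, kernelMass T (freq ξ) ≤ ENNReal.ofReal (κ / (1 + freq ξ))) (r : ℝ)
    {Y₀ : Sp N → ℂ} {f : ℝ × Sp N → ℂ} (hY : StronglyMeasurable Y₀) (hf : StronglyMeasurable f)
    {t : ℝ} (ht : t ∈ timeInterval T) :
    ∫⁻ ξ in S, weight r ξ * ‖heatSol T Y₀ f (t, ξ)‖ₑ ^ 2 ≤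
      2 * (∫⁻ ξ, weight r ξ * ‖Y₀ ξ‖ₑ ^ 2) +
      2 * (ENNReal.ofReal κ * forcingEnergy T (r - 1) f) := by
  have m1 : Measurable fun ξ => weight r ξ * ‖Y₀ ξ‖ₑ ^ 2 :=
    (measurable_weight r).mul (hY.enorm.pow_const 2)
  have m2 : Measurable fun ξ => weight (r - 1) ξ * ∫⁻ t, ‖f (t, ξ)‖ₑ ^ 2 ∂(timeMeasure T) :=
    (measurable_weight _).mul (measurable_time_energy T hf)
  calc _ ≤ ∫⁻ ξ in S, (2 * (weight r ξ * ‖Y₀ ξ‖ₑ ^ 2) + 2 * (ENNReal.ofReal κ *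
        (weight (r - 1) ξ * ∫⁻ t, ‖f (t, ξ)‖ₑ ^ 2 ∂(timeMeasure T)))) := by
        refine setLIntegral_mono' hS fun ξ hξ => ?_
        calc _ ≤ weight r ξ * (2 * ‖Y₀ ξ‖ₑ ^ 2 + 2 * (kernelMass T (freq ξ) *
              ∫⁻ s, ‖f (s, ξ)‖ₑ ^ 2 ∂(timeMeasure T))) := by
              gcongr
              exact sq_enorm_duhamel_le (freq_nonneg ξ) _ (measurable_slice hf ξ) ht
          _ = 2 * (weight r ξ * ‖Y₀ ξ‖ₑ ^ 2) + 2 * ((weight r ξ * kernelMass T (freq ξ)) *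
              ∫⁻ s, ‖f (s, ξ)‖ₑ ^ 2 ∂(timeMeasure T)) := by ring
          _ ≤ _ := by
              rw [← mul_assoc (ENNReal.ofReal κ)]
              have := weight_mul_mass hκ (h ξ hξ) r
              exact add_le_add le_rfl (mul_le_mul' le_rfl (mul_le_mul' this le_rfl))
    _ ≤ ∫⁻ ξ, (2 * (weight r ξ * ‖Y₀ ξ‖ₑ ^ 2) + 2 * (ENNReal.ofReal κ *
        (weight (r - 1) ξ * ∫⁻ t, ‖f (t, ξ)‖ₑ ^ 2 ∂(timeMeasure T)))) := setLIntegral_le_lintegral _ _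
    _ = _ := by
        rw [lintegral_add_left (m1.const_mul _), lintegral_const_mul _ m1,
          lintegral_const_mul _ (m2.const_mul _), lintegral_const_mul _ m2]
        rfl

/-- Each factor of the kernel mass gains one order of the weight. -/
theorem ennreal_weight_chain {w₁ w₀ w₂ k c : ℝ≥0∞} (h₁ : w₁ * k ≤ c * w₀) (h₀ : w₀ * k ≤ c * w₂)
    (a b : ℝ≥0∞) :
    w₁ * (2 * (k * a) + 2 * (k ^ 2 * b)) ≤ 2 * (c * (w₀ * a)) + 2 * (c ^ 2 * (w₂ * b)) := by
  calc _ = 2 * (w₁ * k * a) + 2 * (w₁ * k * (k * b)) := by ring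
    _ ≤ 2 * (c * w₀ * a) + 2 * (c * w₀ * (k * b)) := by gcongr
    _ = 2 * (c * w₀ * a) + 2 * (c * (w₀ * k * b)) := by ring
    _ ≤ 2 * (c * w₀ * a) + 2 * (c * (c * w₂ * b)) := by gcongr
    _ = _ := by ring

theorem lintegral_time_heatSol_le {T : EReal} {κ : ℝ} (hκ : 0 ≤ κ) {S : Set (Sp N)}
    (hS : MeasurableSet S)
    (h : ∀ ξ ∈ S, kernelMass T (freq ξ) ≤ ENNReal.ofReal (κ / (1 + freq ξ))) (r : ℝ)
    {Y₀ : Sp N → ℂ} {f : ℝ × Sp N → ℂ} (hY : StronglyMeasurable Y₀) (hf : StronglyMeasurable f) :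
    ∫⁻ t, (∫⁻ ξ in S, weight (r + 1) ξ * ‖heatSol T Y₀ f (t, ξ)‖ₑ ^ 2) ∂(timeMeasure T) ≤
      2 * (ENNReal.ofReal κ * ∫⁻ ξ, weight r ξ * ‖Y₀ ξ‖ₑ ^ 2) +
      2 * (ENNReal.ofReal κ ^ 2 * forcingEnergy T (r - 1) f) := by
  have m1 : Measurable fun ξ => weight r ξ * ‖Y₀ ξ‖ₑ ^ 2 :=
    (measurable_weight r).mul (hY.enorm.pow_const 2)
  have m2 : Measurable fun ξ => weight (r - 1) ξ * ∫⁻ t, ‖f (t, ξ)‖ₑ ^ 2 ∂(timeMeasure T) :=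
    (measurable_weight _).mul (measurable_time_energy T hf)
  have m3 := stronglyMeasurable_heatSol T hY hf
  have m4 : Measurable (Function.uncurry fun (t : ℝ) (ξ : Sp N) =>
      weight (r + 1) ξ * ‖heatSol T Y₀ f (t, ξ)‖ₑ ^ 2) :=
    ((measurable_weight (r + 1)).comp measurable_snd).mul (m3.enorm.pow_const 2)
  rw [lintegral_lintegral_swap m4.aemeasurable]
  calc _ ≤ ∫⁻ ξ in S, (2 * (ENNReal.ofReal κ * (weight r ξ * ‖Y₀ ξ‖ₑ ^ 2)) +
        2 * (ENNReal.ofReal κ ^ 2 *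
        (weight (r - 1) ξ * ∫⁻ t, ‖f (t, ξ)‖ₑ ^ 2 ∂(timeMeasure T)))) := by
        refine setLIntegral_mono' hS fun ξ hξ => ?_
        have w1 := weight_mul_mass hκ (h ξ hξ) (r + 1)
        have w2 := weight_mul_mass hκ (h ξ hξ) r
        rw [add_sub_cancel_right] at w1
        rw [lintegral_const_mul' _ _ (weight_ne_top _ ξ)]
        simp only [heatSol_apply]
        exact (mul_le_mul' le_rfl (lintegral_sq_enorm_duhamel_le (freq_nonneg ξ) _
          (measurable_slice hf ξ))).trans (ennreal_weight_chain w1 w2 _ _)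
    _ ≤ ∫⁻ ξ, (2 * (ENNReal.ofReal κ * (weight r ξ * ‖Y₀ ξ‖ₑ ^ 2)) +
        2 * (ENNReal.ofReal κ ^ 2 *
        (weight (r - 1) ξ * ∫⁻ t, ‖f (t, ξ)‖ₑ ^ 2 ∂(timeMeasure T)))) :=
        setLIntegral_le_lintegral _ _
    _ = _ := by
        rw [lintegral_add_left ((m1.const_mul _).const_mul _),
          lintegral_const_mul _ (m1.const_mul _), lintegral_const_mul _ m1,
          lintegral_const_mul _ (m2.const_mul _), lintegral_const_mul _ m2]
        rfl

/-- Low frequencies, controlled by an `L¹` in time bound on the forcing. -/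
theorem lintegral_heatSol_le_low {T : EReal} {S : Set (Sp N)} {r : ℝ} {c m : ℝ≥0∞}
    (hS : MeasurableSet S) (hc : ∀ ξ ∈ S, weight r ξ ≤ c)
    {Y₀ : Sp N → ℂ} {f : ℝ × Sp N → ℂ}
    (hm : ∀ᵐ ξ, ‖Y₀ ξ‖ₑ + ∫⁻ s, ‖f (s, ξ)‖ₑ ∂(timeMeasure T) ≤ m)
    {t : ℝ} (ht : t ∈ timeInterval T) :
    ∫⁻ ξ in S, weight r ξ * ‖heatSol T Y₀ f (t, ξ)‖ₑ ^ 2 ≤ c * m ^ 2 * volume S := by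
  rw [← setLIntegral_const]
  refine lintegral_mono_ae ?_
  filter_upwards [ae_restrict_mem hS, ae_restrict_of_ae hm] with ξ hξ hmξ
  refine mul_le_mul' (hc ξ hξ) (pow_le_pow_left₀ zero_le ?_ 2)
  exact (enorm_duhamel_le_L1 (freq_nonneg ξ) _ _ ht).trans hmξ

theorem lintegral_time_heatSol_le_low {T : EReal} {S : Set (Sp N)} {r : ℝ} {c m : ℝ≥0∞}
    (hS : MeasurableSet S) (hc : ∀ ξ ∈ S, weight (r + 1) ξ ≤ c)
    {Y₀ : Sp N → ℂ} {f : ℝ × Sp N → ℂ} (hY : StronglyMeasurable Y₀) (hf : StronglyMeasurable f)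
    (hm : ∀ᵐ ξ, ‖Y₀ ξ‖ₑ + ∫⁻ s, ‖f (s, ξ)‖ₑ ∂(timeMeasure T) ≤ m) {K : Sp N → ℝ≥0∞}
    (hK : Measurable K) (hKm : ∀ ξ ∈ S, kernelMass T (freq ξ) ≤ K ξ) :
    ∫⁻ t, (∫⁻ ξ in S, weight (r + 1) ξ * ‖heatSol T Y₀ f (t, ξ)‖ₑ ^ 2) ∂(timeMeasure T) ≤
      c * m ^ 2 * ∫⁻ ξ in S, K ξ := by
  have m3 := stronglyMeasurable_heatSol T hY hf
  have m4 : Measurable (Function.uncurry fun (t : ℝ) (ξ : Sp N) =>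
      weight (r + 1) ξ * ‖heatSol T Y₀ f (t, ξ)‖ₑ ^ 2) :=
    ((measurable_weight (r + 1)).comp measurable_snd).mul (m3.enorm.pow_const 2)
  rw [lintegral_lintegral_swap m4.aemeasurable, ← lintegral_const_mul _ hK]
  refine lintegral_mono_ae ?_
  filter_upwards [ae_restrict_mem hS, ae_restrict_of_ae hm] with ξ hξ hmξ
  rw [lintegral_const_mul' _ _ (weight_ne_top _ ξ), mul_assoc, mul_comm (m ^ 2)]
  refine mul_le_mul' (hc ξ hξ) ?_
  simp only [heatSol_apply]
  refine (lintegral_sq_enorm_duhamel_le_L1 (freq_nonneg ξ) _ (measurable_slice hf ξ)).trans ?_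
  gcongr
  exact hKm ξ hξ

theorem memLp_two_of_weight {r : ℝ} (hr : 0 ≤ r) {G : Sp N → ℂ} (hG : AEStronglyMeasurable G volume)
    (h : ∫⁻ ξ, weight r ξ * ‖G ξ‖ₑ ^ 2 < ⊤) : MemLp G 2 volume := by
  refine ⟨hG, ?_⟩
  rw [eLpNorm_lt_top_iff_lintegral_rpow_enorm_lt_top (by norm_num) (by norm_num)]
  simp only [ENNReal.toReal_ofNat, ENNReal.rpow_ofNat]
  exact lt_of_le_of_lt (lintegral_mono fun ξ => le_mul_of_one_le_left zero_le
    (one_le_weight hr ξ)) h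

/-- The physical-space field with prescribed Fourier transform (up to taking real parts): it
inherits the norms, and its pairings with test functions are computed on the frequency side. -/
theorem exists_field {T : EReal} {r : ℝ} (hr : 0 ≤ r) {y : Fin N → ℝ × Sp N → ℂ}
    (hy : ∀ k, StronglyMeasurable (y k)) {M : ℝ≥0∞} (hM : M < ⊤)
    (h1 : ∀ t ∈ timeInterval T, ∑ k, ∫⁻ ξ, weight r ξ * ‖y k (t, ξ)‖ₑ ^ 2 ≤ M)
    (h2 : ∫⁻ t, (∑ k, ∫⁻ ξ, weight (r + 1) ξ * ‖y k (t, ξ)‖ₑ ^ 2) ∂(timeMeasure T) ≤ M) :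
    ∃ v : ℝ → L2 N (Sp N), AEStronglyMeasurable v (timeMeasure T) ∧
      xNorm T r v ≤ 2 * M ^ (1 / 2 : ℝ) ∧
      ∀ t ∈ timeInterval T, ∀ k (ψ : Sp N → ℝ) (hψ : IsTest ψ),
        ∫ x, v t x k * ψ x = (∫ ξ, y k (t, ξ) * (𝓕⁻ hψ.schwartz) ξ).re := by
  classical
  -- outside `(0, T)` nothing is known about `y`, so it is replaced by zero there
  set G : Fin N → ℝ × Sp N → ℂ := fun k => (timeInterval T ×ˢ univ).indicator (y k) with hGdef
  have hG : ∀ k, StronglyMeasurable (G k) := fun k =>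
    (hy k).indicator ((measurableSet_timeInterval T).prod MeasurableSet.univ)
  have hGin : ∀ k, ∀ t ∈ timeInterval T, ∀ ξ, G k (t, ξ) = y k (t, ξ) := fun k t ht ξ => by
    simp [G, ht]
  have hGout : ∀ k, ∀ t ∉ timeInterval T, ∀ ξ, G k (t, ξ) = 0 := fun k t ht ξ => by
    simp [G, ht]
  have hslice : ∀ k t, StronglyMeasurable fun ξ => G k (t, ξ) := fun k t =>
    (hG k).comp_measurable (measurable_const.prodMk measurable_id)
  have hmem : ∀ k t, MemLp (fun ξ => G k (t, ξ)) 2 volume := by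
    intro k t
    by_cases ht : t ∈ timeInterval T
    · refine memLp_two_of_weight hr (hslice k t).aestronglyMeasurable ?_
      simp_rw [hGin k t ht]
      refine lt_of_le_of_lt ?_ hM
      refine le_trans ?_ (h1 t ht)
      exact Finset.single_le_sum (f := fun k => ∫⁻ ξ, weight r ξ * ‖y k (t, ξ)‖ₑ ^ 2)
        (fun _ _ => zero_le) (Finset.mem_univ k)
    · simp_rw [hGout k t ht]
      exact MemLp.zero'
  set W : Fin N → ℝ → L2 N ℂ := fun k t => (hmem k t).toLp _ with hW
  have hWc : ∀ k t, W k t =ᵐ[volume] fun ξ => G k (t, ξ) := fun k t => (hmem k t).coeFn_toLp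
  have hWm : ∀ k, StronglyMeasurable (W k) := fun k =>
    stronglyMeasurable_of_joint (G k) (hG k) (W k) (hWc k)
  set U : ℝ → Fin N → L2 N ℂ := fun t k => 𝓕⁻ (W k t) with hU
  have hUF : ∀ t k, (𝓕 (U t k) : L2 N ℂ) = W k t := fun t k =>
    FourierTransform.fourier_fourierInv_eq _
  have hUm : StronglyMeasurable U := by
    borelize (L2 N ℂ)
    refine (measurable_pi_iff.2 fun k => ?_).stronglyMeasurable
    exact ((Lp.fourierTransformₗᵢ (Sp N) ℂ).symm.continuous.comp_stronglyMeasurable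
      (hWm k)).measurable
  have hnorm : ∀ q t, t ∈ timeInterval T → hsNorm q (assemble (U t)) ^ 2 ≤
      ∑ k, ∫⁻ ξ, weight q ξ * ‖y k (t, ξ)‖ₑ ^ 2 := by
    intro q t ht
    refine (hsNorm_assemble_le q (U t)).trans (le_of_eq ?_)
    refine Finset.sum_congr rfl fun k _ => lintegral_congr_ae ?_
    rw [hUF]
    filter_upwards [hWc k t] with ξ hξ
    rw [hξ, hGin k t ht]
  refine ⟨fun t => assemble (U t),
    (continuous_assemble.comp_stronglyMeasurable hUm).aestronglyMeasurable, ?_, ?_⟩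
  · unfold xNorm
    rw [two_mul]
    refine add_le_add ?_ ?_
    · unfold lInftyHsNorm
      refine essSup_le_of_ae_le _ ?_
      filter_upwards [ae_mem_timeInterval T] with t ht
      rw [← ENNReal.pow_le_pow_left_iff (n := 2) (by norm_num), ennreal_sqrt_sq]
      exact (hnorm r t ht).trans (h1 t ht)
    · rw [← ENNReal.pow_le_pow_left_iff (n := 2) (by norm_num), ennreal_sqrt_sq, sq_l2HsNorm]
      refine le_trans (lintegral_mono_ae ?_) h2
      filter_upwards [ae_mem_timeInterval T] with t ht
      exact hnorm (r + 1) t ht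
  · intro t ht k ψ hψ
    rw [integral_assemble_mul (U t) k hψ, hUF]
    congr 1
    refine integral_congr_ae ?_
    filter_upwards [hWc k t] with ξ hξ
    rw [hξ, hGin k t ht]

theorem memLp_two_prod_iff {τ : Measure ℝ} [SFinite τ] {G : ℝ × Sp N → ℂ}
    (hG : StronglyMeasurable G) (h : ∫⁻ t, (∫⁻ ξ, ‖G (t, ξ)‖ₑ ^ 2) ∂τ < ⊤) :
    MemLp G 2 (τ.prod volume) := by
  refine ⟨hG.aestronglyMeasurable, ?_⟩
  rw [eLpNorm_lt_top_iff_lintegral_rpow_enorm_lt_top (by norm_num) (by norm_num)]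
  simp only [ENNReal.toReal_ofNat, ENNReal.rpow_ofNat]
  rwa [lintegral_prod _ (hG.enorm.pow_const 2).aemeasurable]

theorem IsSmoothCompact.memLp_sliceF {φ : ℝ × Sp N → ℝ} (h : IsSmoothCompact φ) (T : EReal) :
    MemLp (fun z : ℝ × Sp N => sliceF φ z.1 z.2) 2 ((timeMeasure T).prod volume) := by
  refine memLp_two_prod_iff h.stronglyMeasurable_sliceF ?_
  exact lt_of_le_of_lt (setLIntegral_le_lintegral _ _) h.lintegral_sliceF_lt_top

/-- The forcing is only in `H^{-1}` when `r = 0`; the missing factor `1 + |2πξ|²` is moved to the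
test function, where it acts as `1 - Δ`. -/
theorem integrable_forcing_mul {T : EReal} {r : ℝ} (hr : 0 ≤ r) {f : ℝ × Sp N → ℂ}
    (hf : StronglyMeasurable f) (hB : forcingEnergy T (r - 1) f < ⊤) {φ : ℝ × Sp N → ℝ}
    (h : IsSmoothCompact φ) :
    Integrable (fun z : ℝ × Sp N => f z * sliceF φ z.1 z.2) ((timeMeasure T).prod volume) := by
  have h1 : MemLp (fun z : ℝ × Sp N => ((1 + freq z.2 : ℝ) : ℂ)⁻¹ * f z) 2
      ((timeMeasure T).prod volume) := by
    have hc : Continuous fun z : ℝ × Sp N => ((1 + freq z.2 : ℝ) : ℂ)⁻¹ := by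
      refine Continuous.inv₀ ?_ fun z => ?_
      · have := continuous_freq (N := N)
        fun_prop
      · exact_mod_cast (add_pos_of_pos_of_nonneg one_pos (freq_nonneg z.2)).ne'
    refine memLp_two_prod_iff (hc.stronglyMeasurable.mul hf) ?_
    rw [forcingEnergy_eq T _ hf] at hB
    refine lt_of_le_of_lt (lintegral_mono fun t => lintegral_mono fun ξ => ?_) hB
    have h0 : 0 < 1 + freq ξ := by linarith [freq_nonneg ξ]
    rw [enorm_mul, mul_pow]
    gcongr
    rw [← ofReal_norm, norm_inv, Complex.norm_real, Real.norm_of_nonneg h0.le,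
      ← ENNReal.ofReal_pow (by positivity)]
    refine ENNReal.ofReal_le_ofReal ?_
    rw [inv_pow, ← Real.rpow_natCast, ← Real.rpow_neg h0.le]
    refine Real.rpow_le_rpow_of_exponent_le (by linarith [freq_nonneg ξ]) ?_
    push_cast
    linarith
  have h2 := (h.sub h.xlap).memLp_sliceF T
  refine (h1.integrable_mul h2).congr (ae_of_all _ fun z => ?_)
  simp only [Pi.mul_apply]
  rw [h.sliceF_sub h.xlap, h.sliceF_xlap]
  have h0 : ((1 + freq z.2 : ℝ) : ℂ) ≠ 0 := by
    exact_mod_cast (add_pos_of_pos_of_nonneg one_pos (freq_nonneg z.2)).ne'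
  have e : sliceF φ z.1 z.2 - -(freq z.2 : ℂ) * sliceF φ z.1 z.2 =
      ((1 + freq z.2 : ℝ) : ℂ) * sliceF φ z.1 z.2 := by
    push_cast; ring
  rw [e]
  field_simp

/-- The frequency-side form of the weak heat equation with initial condition. -/
theorem heatSol_weak {T : EReal} (hT : 0 < T) {r : ℝ} (hr : 0 ≤ r) (v₀ : L2 N (Sp N)) (k : Fin N)
    {f : ℝ × Sp N → ℂ} (hf : StronglyMeasurable f) (hB : forcingEnergy T (r - 1) f < ⊤)
    {v : ℝ → L2 N (Sp N)}
    (hy : ∫⁻ t, (∫⁻ ξ, weight (r + 1) ξ *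
      ‖heatSol T (𝓕 (coordC k v₀) : L2 N ℂ) f (t, ξ)‖ₑ ^ 2) ∂(timeMeasure T) < ⊤)
    (hv : ∀ t ∈ timeInterval T, ∀ (ψ : Sp N → ℝ) (hψ : IsTest ψ),
      ∫ x, v t x k * ψ x =
        (∫ ξ, heatSol T (𝓕 (coordC k v₀) : L2 N ℂ) f (t, ξ) * (𝓕⁻ hψ.schwartz) ξ).re)
    {φ : ℝ × Sp N → ℝ} (h : IsSpaceTimeTest T φ) :
    (∫ t, (∫ x, v t x k * (tderiv φ t x + xlap φ t x)) ∂(timeMeasure T)) +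
      (∫ t, (∫ ξ, f (t, ξ) * sliceF φ t ξ).re ∂(timeMeasure T)) +
      ∫ x, v₀ x k * φ (0, x) = 0 := by
  obtain ⟨b, hb0, hbT, hb⟩ := h.exists_bound hT
  have hs := h.smooth
  set Y : L2 N ℂ := 𝓕 (coordC k v₀) with hY
  have hYm : StronglyMeasurable Y := Lp.stronglyMeasurable Y
  set y := heatSol T Y f with hydef
  have hym : StronglyMeasurable y := stronglyMeasurable_heatSol T hYm hf
  have hQ := hs.tderiv.add hs.xlap
  set Q : ℝ × Sp N → ℝ := fun z => tderiv φ z.1 z.2 + xlap φ z.1 z.2 with hQdef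
  have hQF : ∀ t ξ, sliceF Q t ξ =
      sliceF (fun z => tderiv φ z.1 z.2) t ξ - freq ξ * sliceF φ t ξ := by
    intro t ξ
    rw [hQdef, hs.tderiv.sliceF_add hs.xlap, hs.sliceF_xlap]
    ring
  have hyL : MemLp y 2 ((timeMeasure T).prod volume) := by
    refine memLp_two_prod_iff hym (lt_of_le_of_lt ?_ hy)
    exact lintegral_mono fun t => lintegral_mono fun ξ =>
      le_mul_of_one_le_left zero_le (one_le_weight (by linarith) ξ)
  have i1 : Integrable (fun z : ℝ × Sp N => y z * sliceF Q z.1 z.2) ((timeMeasure T).prod volume) :=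
    hyL.integrable_mul (hQ.memLp_sliceF T)
  have i2 := integrable_forcing_mul hr hf hB hs
  have e1 : ∫ t, (∫ x, v t x k * (tderiv φ t x + xlap φ t x)) ∂(timeMeasure T) =
      (∫ t, (∫ ξ, y (t, ξ) * sliceF Q t ξ) ∂(timeMeasure T)).re := by
    have hre := integral_re i1.integral_prod_left
    simp only [RCLike.re_eq_complex_re] at hre
    rw [← hre]
    refine integral_congr_ae ?_
    filter_upwards [ae_mem_timeInterval T] with t ht
    have := hv t ht _ (hQ.slice t)
    simp_rw [hQ.sliceF_eq]
    exact this
  have e2 : ∫ t, (∫ ξ, f (t, ξ) * sliceF φ t ξ).re ∂(timeMeasure T) =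
      (∫ t, (∫ ξ, f (t, ξ) * sliceF φ t ξ) ∂(timeMeasure T)).re := by
    have hre := integral_re i2.integral_prod_left
    simpa only [RCLike.re_eq_complex_re] using hre
  have e3 : ∫ x, v₀ x k * φ (0, x) = (∫ ξ, Y ξ * sliceF φ 0 ξ).re := by
    have := congrArg Complex.re (integral_coord_mul k v₀ (hs.slice 0))
    rw [Complex.ofReal_re] at this
    rw [this]
    simp_rw [hs.sliceF_eq]
    rfl
  have hB' := ae_time_energy_lt_top hf hB
  -- at almost every frequency, the scalar equation is tested with `t ↦ 𝓕⁻ (φ (t, ·)) ξ`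
  have key : ∀ᵐ ξ : Sp N, ∫ t, (y (t, ξ) * sliceF Q t ξ + f (t, ξ) * sliceF φ t ξ)
      ∂(timeMeasure T) = - (Y ξ * sliceF φ 0 ξ) := by
    filter_upwards [hB'] with ξ hξ
    have hfi : IntegrableOn (fun s => f (s, ξ)) (Ioo 0 b) := by
      have h1 : MemLp (fun s => f (s, ξ)) 2 (volume.restrict (Ioo 0 b)) := by
        refine ⟨(measurable_slice hf ξ).aestronglyMeasurable, ?_⟩
        rw [eLpNorm_lt_top_iff_lintegral_rpow_enorm_lt_top (by norm_num) (by norm_num)]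
        simp only [ENNReal.toReal_ofNat, ENNReal.rpow_ofNat]
        refine lt_of_le_of_lt (lintegral_mono_set ?_) hξ
        intro t ht
        exact ⟨ht.1, lt_trans (EReal.coe_lt_coe_iff.2 ht.2) hbT⟩
      exact h1.integrable (by norm_num)
    have h1 := duhamel_weak (freq_nonneg ξ) (Y ξ) hb0 hbT hfi
      (ψ := fun t => sliceF φ t ξ) (ψ' := fun t => sliceF (fun z => tderiv φ z.1 z.2) t ξ)
      (fun t => hs.hasDerivAt_sliceF t ξ) (hs.tderiv.continuous_sliceF ξ)
      (fun t ht => sliceF_eq_zero hb ht ξ)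
      (fun t ht => sliceF_eq_zero (fun z hz => hb z (hs.tsupport_tderiv hz)) ht ξ)
    rw [← eq_neg_iff_add_eq_zero] at h1
    rw [← h1]
    refine integral_congr_ae (ae_of_all _ fun t => ?_)
    simp only [hQF]
    rfl
  have hsum : (∫ t, (∫ ξ, y (t, ξ) * sliceF Q t ξ) ∂(timeMeasure T)) +
      (∫ t, (∫ ξ, f (t, ξ) * sliceF φ t ξ) ∂(timeMeasure T)) = - ∫ ξ, Y ξ * sliceF φ 0 ξ := by
    have h1 := integral_prod_symm _ (i1.add i2)
    simp only [Pi.add_apply] at h1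
    rw [← integral_prod _ i1, ← integral_prod _ i2, ← integral_add i1 i2, h1, ← integral_neg]
    exact integral_congr_ae key
  rw [e1, e2, e3, ← Complex.add_re, hsum, ← Complex.add_re, neg_add_cancel, Complex.zero_re]

end HeatSolution

/-! ### Energy bounds for the heat equation -/

section EnergyBounds

/-- The uniform-in-time and integrated energy bounds of the heat solution, on a set of frequencies
on which the kernel mass is at most `κ / (1 + |2πξ|²)`. -/
theorem heatSol_energy {T : EReal} {κ : ℝ} (hκ : 0 ≤ κ) {S : Set (Sp N)} (hS : MeasurableSet S)
    (h : ∀ ξ ∈ S, kernelMass T (freq ξ) ≤ ENNReal.ofReal (κ / (1 + freq ξ))) (r : ℝ)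
    {Y₀ : Sp N → ℂ} {f : ℝ × Sp N → ℂ} (hY : StronglyMeasurable Y₀) (hf : StronglyMeasurable f) :
    (∀ t ∈ timeInterval T, ∫⁻ ξ in S, weight r ξ * ‖heatSol T Y₀ f (t, ξ)‖ₑ ^ 2 ≤
      2 * (1 + ENNReal.ofReal κ) ^ 2 *
        ((∫⁻ ξ, weight r ξ * ‖Y₀ ξ‖ₑ ^ 2) + forcingEnergy T (r - 1) f)) ∧
    ∫⁻ t, (∫⁻ ξ in S, weight (r + 1) ξ * ‖heatSol T Y₀ f (t, ξ)‖ₑ ^ 2) ∂(timeMeasure T) ≤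
      2 * (1 + ENNReal.ofReal κ) ^ 2 *
        ((∫⁻ ξ, weight r ξ * ‖Y₀ ξ‖ₑ ^ 2) + forcingEnergy T (r - 1) f) := by
  set c := ENNReal.ofReal κ
  have c0 : 1 ≤ (1 + c) ^ 2 := one_le_pow₀ le_self_add
  have c1 : c ≤ (1 + c) ^ 2 :=
    le_add_self.trans (le_self_pow₀ (le_self_add : (1 : ℝ≥0∞) ≤ 1 + c) two_ne_zero)
  have c2 : c ^ 2 ≤ (1 + c) ^ 2 := pow_le_pow_left₀ zero_le le_add_self 2
  have hx : ∀ {a b : ℝ≥0∞} (x y : ℝ≥0∞), a ≤ (1 + c) ^ 2 → b ≤ (1 + c) ^ 2 →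
      2 * (a * x) + 2 * (b * y) ≤ 2 * (1 + c) ^ 2 * (x + y) := by
    intro a b x y ha hb
    calc _ ≤ 2 * ((1 + c) ^ 2 * x) + 2 * ((1 + c) ^ 2 * y) := by gcongr
      _ = _ := by ring
  refine ⟨fun t ht => ?_, ?_⟩
  · refine (lintegral_heatSol_le hκ hS h r hY hf ht).trans ?_
    simpa only [one_mul] using hx (a := 1) (b := c) _ _ c0 c1
  · exact (lintegral_time_heatSol_le hκ hS h r hY hf).trans (hx _ _ c1 c2)

/-- The energy bounds that put a field whose frequency side is a heat solution in `X^r_T`: the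
squares of its norms in `L^∞((0, T); H^r)` and `L²((0, T); H^{r+1})` are at most `M`. -/
def HasEnergyBound (T : EReal) (r : ℝ) (Y₀ : Sp N → ℂ) (f : ℝ × Sp N → ℂ) (M : ℝ≥0∞) : Prop :=
  (∀ t ∈ timeInterval T, ∫⁻ ξ, weight r ξ * ‖heatSol T Y₀ f (t, ξ)‖ₑ ^ 2 ≤ M) ∧
    ∫⁻ t, (∫⁻ ξ, weight (r + 1) ξ * ‖heatSol T Y₀ f (t, ξ)‖ₑ ^ 2) ∂(timeMeasure T) ≤ M

theorem HasEnergyBound.mono {T : EReal} {r : ℝ} {Y₀ : Sp N → ℂ} {f : ℝ × Sp N → ℂ} {M M' : ℝ≥0∞}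
    (h : HasEnergyBound T r Y₀ f M) (hM : M ≤ M') : HasEnergyBound T r Y₀ f M' :=
  ⟨fun t ht => (h.1 t ht).trans hM, h.2.trans hM⟩

/-- The energy bounds on a bounded time interval, with a constant depending on its length. -/
theorem heatSol_energy_finite {T : ℝ} (hT : 0 < T) (r : ℝ)
    {Y₀ : Sp N → ℂ} {f : ℝ × Sp N → ℂ} (hY : StronglyMeasurable Y₀) (hf : StronglyMeasurable f) :
    HasEnergyBound T r Y₀ f (2 * (1 + ENNReal.ofReal (T + 1)) ^ 2 *
      ((∫⁻ ξ, weight r ξ * ‖Y₀ ξ‖ₑ ^ 2) + forcingEnergy T (r - 1) f)) := by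
  have := heatSol_energy (T := (T : EReal)) (κ := T + 1) (by linarith) (S := univ)
    MeasurableSet.univ (fun ξ _ => kernelMass_le hT (freq_nonneg ξ)) r hY hf
  simpa only [Measure.restrict_univ, HasEnergyBound] using this

/-- The singularity `|ξ|⁻²` is integrable near the origin in dimension at least three. -/
theorem lintegral_inv_freq_lt_top (hN : 3 ≤ N) :
    ∫⁻ ξ in Metric.ball (0 : Sp N) 1, (ENNReal.ofReal (freq ξ))⁻¹ < ⊤ := by
  have : Nonempty (Fin N) := ⟨⟨0, by omega⟩⟩
  have : Nontrivial (Sp N) := by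
    refine ⟨⟨EuclideanSpace.single ⟨0, by omega⟩ 1, 0, fun h => ?_⟩⟩
    have := congrArg norm h
    simp at this
  have h1 : IntegrableOn (fun ξ : Sp N => ((2 * Real.pi * ‖ξ‖) ^ 2)⁻¹)
      (Metric.ball (0 : Sp N) 1) volume := by
    rw [integrableOn_fun_norm_addHaar (volume : Measure (Sp N))
      (f := fun y : ℝ => ((2 * Real.pi * y) ^ 2)⁻¹)]
    have hc : IntegrableOn (fun y : ℝ => y ^ (N - 3) * ((2 * Real.pi) ^ 2)⁻¹) (Ioo 0 1) := by
      have : Continuous fun y : ℝ => y ^ (N - 3) * ((2 * Real.pi) ^ 2)⁻¹ := by fun_prop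
      exact (this.integrableOn_Icc (a := 0) (b := 1)).mono_set Ioo_subset_Icc_self
    refine hc.congr_fun (fun y hy => ?_) measurableSet_Ioo
    have hy0 : y ≠ 0 := hy.1.ne'
    -- in polar coordinates the density `y^(N-1)` compensates the singularity `y⁻²`
    have e : Module.finrank ℝ (Sp N) - 1 = (N - 3) + 2 := by
      rw [finrank_euclideanSpace_fin]; omega
    simp only [e, smul_eq_mul, pow_add]
    have := Real.pi_ne_zero
    field_simp
  have h2 := h1.hasFiniteIntegral
  refine lt_of_le_of_lt (le_of_eq ?_) h2
  have h0 : ∀ᵐ ξ : Sp N, ξ ≠ 0 := by simp [ae_iff]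
  refine lintegral_congr_ae ?_
  filter_upwards [ae_restrict_of_ae h0] with ξ hξ
  have hp : 0 < freq ξ := by
    have : 0 < ‖ξ‖ := norm_pos_iff.2 hξ
    unfold freq
    positivity
  rw [Real.enorm_of_nonneg (by positivity), ← ENNReal.ofReal_inv_of_pos hp]
  rfl

/-- The energy bounds on `(0, ∞)`. The kernel mass `1 / |2πξ|²` is comparable with
`1 / (1 + |2πξ|²)` only away from the origin; near the origin the solution is bounded by the
`L¹` in time norm of the data, and the mass is integrable. -/
theorem exists_heatSol_energy_top (hN : 3 ≤ N) {r : ℝ} (hr : 0 ≤ r) :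
    ∃ C : ℝ≥0, ∀ (Y₀ : Sp N → ℂ) (f : ℝ × Sp N → ℂ) (m : ℝ≥0∞), StronglyMeasurable Y₀ →
      StronglyMeasurable f →
      (∀ᵐ ξ, ‖Y₀ ξ‖ₑ + ∫⁻ s, ‖f (s, ξ)‖ₑ ∂(timeMeasure ⊤) ≤ m) →
      HasEnergyBound ⊤ r Y₀ f
        (C * ((∫⁻ ξ, weight r ξ * ‖Y₀ ξ‖ₑ ^ 2) + forcingEnergy ⊤ (r - 1) f + m ^ 2)) := by
  set B : Set (Sp N) := Metric.ball 0 1 with hB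
  have hBm : MeasurableSet B := measurableSet_ball
  set c : ℝ≥0∞ := ENNReal.ofReal ((1 + (2 * Real.pi) ^ 2) ^ (r + 1)) with hc
  have hπ : 1 ≤ 2 * Real.pi := by linarith [Real.pi_gt_three]
  have hw1 : ∀ ξ ∈ B, weight (r + 1) ξ ≤ c := by
    intro ξ hξ
    have h1 : ‖ξ‖ < 1 := by simpa [hB] using hξ
    refine ENNReal.ofReal_le_ofReal (Real.rpow_le_rpow (by linarith [freq_nonneg ξ]) ?_
      (by linarith))
    unfold freq
    have h2 : 2 * Real.pi * ‖ξ‖ ≤ 2 * Real.pi := mul_le_of_le_one_right (by linarith) h1.le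
    gcongr
  have hw0 : ∀ ξ ∈ B, weight r ξ ≤ c := fun ξ hξ =>
    (weight_mono (by linarith) ξ).trans (hw1 ξ hξ)
  -- outside the unit ball `|2πξ|² ≥ 1`, so that `1 / |2πξ|² ≤ 2 / (1 + |2πξ|²)`
  have hhigh : ∀ ξ ∈ Bᶜ, kernelMass ⊤ (freq ξ) ≤ ENNReal.ofReal (2 / (1 + freq ξ)) := by
    intro ξ hξ
    have h1 : 1 ≤ ‖ξ‖ := by simpa [hB] using hξ
    have h2 : 1 ≤ freq ξ := one_le_pow₀ (by nlinarith)
    refine (kernelMass_top_le (by linarith)).trans (ENNReal.ofReal_le_ofReal ?_)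
    rw [div_le_div_iff₀ (by linarith) (by linarith)]
    linarith
  set K : Sp N → ℝ≥0∞ := fun ξ => (ENNReal.ofReal (freq ξ))⁻¹ with hK
  have hKm : Measurable K := continuous_freq.measurable.ennreal_ofReal.inv
  -- at `ξ = 0` both sides may be infinite, as the inverse of zero is infinite
  have hlow : ∀ ξ ∈ B, kernelMass ⊤ (freq ξ) ≤ K ξ := by
    intro ξ _
    rcases (freq_nonneg ξ).eq_or_lt with h0 | h0
    · simp [hK, ← h0]
    · refine (kernelMass_top_le h0).trans (le_of_eq ?_)
      rw [one_div, ENNReal.ofReal_inv_of_pos h0]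
  set A : ℝ≥0∞ := 2 * (1 + ENNReal.ofReal 2) ^ 2 with hA
  set D : ℝ≥0∞ := c * (volume B + ∫⁻ ξ in B, K ξ) with hD
  have hAt : A ≠ ⊤ := ENNReal.mul_ne_top (by norm_num)
    (ENNReal.pow_ne_top (ENNReal.add_ne_top.2 ⟨by norm_num, ENNReal.ofReal_ne_top⟩))
  have hDt : D ≠ ⊤ := ENNReal.mul_ne_top ENNReal.ofReal_ne_top
    (ENNReal.add_ne_top.2 ⟨measure_ball_lt_top.ne, (lintegral_inv_freq_lt_top hN).ne⟩)
  refine ⟨(A + D).toNNReal, fun Y₀ f m hY hf hm => ?_⟩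
  rw [ENNReal.coe_toNNReal (ENNReal.add_ne_top.2 ⟨hAt, hDt⟩)]
  set E := (∫⁻ ξ, weight r ξ * ‖Y₀ ξ‖ₑ ^ 2) + forcingEnergy ⊤ (r - 1) f
  obtain ⟨e1, e2⟩ := heatSol_energy (T := ⊤) (κ := 2) (by norm_num) hBm.compl hhigh r hY hf
  have hfin : A * E + D * m ^ 2 ≤ (A + D) * (E + m ^ 2) := by
    calc _ ≤ (A * E + D * m ^ 2) + (A * m ^ 2 + D * E) := le_self_add
      _ = _ := by ring
  refine ⟨fun t ht => ?_, ?_⟩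
  · rw [← lintegral_add_compl _ hBm, add_comm]
    refine (add_le_add (e1 t ht) (lintegral_heatSol_le_low hBm hw0 hm ht)).trans
      (le_trans ?_ hfin)
    refine add_le_add le_rfl ?_
    calc _ = c * volume B * m ^ 2 := by ring
      _ ≤ _ := by gcongr; exact mul_le_mul' le_rfl le_self_add
  · have hsplit : ∀ t, ∫⁻ ξ, weight (r + 1) ξ * ‖heatSol ⊤ Y₀ f (t, ξ)‖ₑ ^ 2 =
        (∫⁻ ξ in Bᶜ, weight (r + 1) ξ * ‖heatSol ⊤ Y₀ f (t, ξ)‖ₑ ^ 2) +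
        ∫⁻ ξ in B, weight (r + 1) ξ * ‖heatSol ⊤ Y₀ f (t, ξ)‖ₑ ^ 2 := fun t => by
      rw [← lintegral_add_compl _ hBm, add_comm]
    simp_rw [hsplit]
    have hmeas : Measurable fun t => ∫⁻ ξ in Bᶜ,
        weight (r + 1) ξ * ‖heatSol ⊤ Y₀ f (t, ξ)‖ₑ ^ 2 := by
      have m4 : Measurable (fun z : ℝ × Sp N => weight (r + 1) z.2 * ‖heatSol ⊤ Y₀ f z‖ₑ ^ 2) :=
        ((measurable_weight (r + 1)).comp measurable_snd).mul
          ((stronglyMeasurable_heatSol ⊤ hY hf).enorm.pow_const 2)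
      exact m4.lintegral_prod_right'
    rw [lintegral_add_left hmeas]
    refine (add_le_add e2 (lintegral_time_heatSol_le_low hBm hw1 hY hf hm hKm hlow)).trans
      (le_trans ?_ hfin)
    refine add_le_add le_rfl ?_
    calc _ = c * (∫⁻ ξ in B, K ξ) * m ^ 2 := by ring
      _ ≤ _ := by gcongr; exact mul_le_mul' le_rfl le_add_self

end EnergyBounds

/-! ### Fourier transforms of time-dependent fields -/

section FourierRepresentatives

variable {ι : Type} [Fintype ι]

/-- The Fourier transform in space of a time-dependent field has jointly measurable
coordinates. -/
theorem exists_fourier_representative {τ : Measure ℝ} {w : ℝ → L2 N (EuclideanSpace ℝ ι)}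
    (hw : AEStronglyMeasurable w τ) :
    ∃ W : ι → ℝ × Sp N → ℂ, (∀ k, StronglyMeasurable (W k)) ∧
      ∀ᵐ t ∂τ, ∀ k, (𝓕 (coordC k (w t)) : L2 N ℂ) =ᵐ[volume] fun ξ => W k (t, ξ) := by
  have h : ∀ k, AEStronglyMeasurable (fun t => (𝓕 (coordC k (w t)) : L2 N ℂ)) τ := fun k =>
    ((Lp.fourierTransformₗᵢ (Sp N) ℂ).continuous.comp
      (continuous_coordC k)).comp_aestronglyMeasurable hw
  choose W hW hWt using fun k => exists_joint_representative _ (h k)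
  exact ⟨W, hW, ae_all_iff.2 hWt⟩

theorem sum_forcingEnergy_eq {T : EReal} (r : ℝ) {w : ℝ → L2 N (EuclideanSpace ℝ ι)}
    {W : ι → ℝ × Sp N → ℂ} (hW : ∀ k, StronglyMeasurable (W k))
    (h : ∀ᵐ t ∂(timeMeasure T), ∀ k,
      (𝓕 (coordC k (w t)) : L2 N ℂ) =ᵐ[volume] fun ξ => W k (t, ξ)) :
    ∑ k, forcingEnergy T r (W k) = l2HsNorm T r w ^ 2 := by
  have hm : ∀ k, Measurable fun t => ∫⁻ ξ, weight r ξ * ‖W k (t, ξ)‖ₑ ^ 2 := by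
    intro k
    have m4 : Measurable (fun z : ℝ × Sp N => weight r z.2 * ‖W k z‖ₑ ^ 2) :=
      ((measurable_weight r).comp measurable_snd).mul ((hW k).enorm.pow_const 2)
    exact m4.lintegral_prod_right'
  rw [Finset.sum_congr rfl fun k _ => forcingEnergy_eq T r (hW k),
    ← lintegral_finsetSum _ fun k _ => hm k, sq_l2HsNorm]
  refine lintegral_congr_ae ?_
  filter_upwards [h] with t ht
  rw [sq_hsNorm]
  refine Finset.sum_congr rfl fun k _ => lintegral_congr_ae ?_
  filter_upwards [ht k] with ξ hξ
  rw [hξ]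

end FourierRepresentatives

/-! ### Fourier transforms of integrable data -/

section IntegrableFourier

theorem integral_fourier_mul_fourierInv {g : Sp N → ℂ} (hg : Integrable g) (ψ : 𝓢(Sp N, ℂ)) :
    ∫ ξ, 𝓕 g ξ * (𝓕⁻ ψ) ξ = ∫ x, g x * ψ x := by
  have h := VectorFourier.integral_fourierIntegral_smul_eq_flip (L := innerₗ (Sp N))
    (μ := volume) (ν := volume) (f := g) (g := (𝓕⁻ ψ : 𝓢(Sp N, ℂ)))
    Real.continuous_fourierChar continuous_inner hg (SchwartzMap.integrable _)
  simp only [smul_eq_mul, flip_innerₗ] at h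
  refine Eq.trans h ?_
  change ∫ x, g x * 𝓕 ((𝓕⁻ ψ : 𝓢(Sp N, ℂ)) : Sp N → ℂ) x = _
  have e : 𝓕 ((𝓕⁻ ψ : 𝓢(Sp N, ℂ)) : Sp N → ℂ) = ψ := by
    rw [← SchwartzMap.fourier_coe, FourierTransform.fourier_fourierInv_eq]
  rw [e]

theorem enorm_fourier_le (g : Sp N → ℂ) (ξ : Sp N) : ‖𝓕 g ξ‖ₑ ≤ ∫⁻ x, ‖g x‖ₑ := by
  rw [Real.fourier_eq]
  refine (enorm_integral_le_lintegral_enorm _).trans (le_of_eq ?_)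
  refine lintegral_congr fun x => ?_
  rw [← ofReal_norm, Circle.norm_smul, ofReal_norm]

theorem tempered_fourier {g : Sp N → ℂ} (hg : Integrable g) : Tempered (𝓕 g) := by
  refine tempered_of_bounded (C := ∫ x, ‖g x‖) ?_ fun ξ => ?_
  · exact (VectorFourier.fourierIntegral_continuous Real.continuous_fourierChar
      (by exact continuous_inner) hg).aestronglyMeasurable
  · exact VectorFourier.norm_fourierIntegral_le_integral_norm _ _ _ _ _

/-- The components of a field that is integrable have Fourier transforms bounded by its
`L¹` norm. -/
theorem enorm_fourier_coordC_le {ι : Type} [Fintype ι] (f : L2 N (EuclideanSpace ℝ ι))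
    (hf : eLpNorm f 1 volume < ⊤) (k : ι) :
    ∀ᵐ ξ, ‖(𝓕 (coordC k f) : L2 N ℂ) ξ‖ₑ ≤ eLpNorm f 1 volume := by
  have hle : ∫⁻ x, ‖((f x k : ℝ) : ℂ)‖ₑ ≤ eLpNorm f 1 volume := by
    rw [eLpNorm_one_eq_lintegral_enorm]
    refine lintegral_mono fun x => ?_
    rw [← ofReal_norm, ← ofReal_norm, Complex.norm_real]
    exact ENNReal.ofReal_le_ofReal (PiLp.norm_apply_le _ _)
  have hg : Integrable fun x => ((f x k : ℝ) : ℂ) := by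
    refine ⟨?_, lt_of_le_of_lt hle hf⟩
    exact Complex.continuous_ofReal.comp_aestronglyMeasurable
      (memLp_coord k f).aestronglyMeasurable
  have h0 := ((tempered_coe (𝓕 (coordC k f) : L2 N ℂ)).sub (tempered_fourier hg)).ae_eq_zero
    fun ψ hψ => by
      simp_rw [sub_mul]
      rw [integral_sub ((tempered_coe _).integrable_mul _)
        ((tempered_fourier hg).integrable_mul _), integral_fourier_mul_fourierInv hg,
        ← integral_coord_mul k f hψ, sub_eq_zero, ← integral_complex_ofReal]
      simp
  filter_upwards [h0] with ξ hξ
  rw [sub_eq_zero.1 hξ]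
  exact (enorm_fourier_le _ ξ).trans hle

/-- Bounds that hold for almost every time and frequency can be integrated in time. -/
theorem ae_lintegral_le_of_ae_le {τ : Measure ℝ} [SFinite τ] {W : ℝ × Sp N → ℂ}
    (hW : StronglyMeasurable W) {a : ℝ → ℝ≥0∞} (ha : AEMeasurable a τ)
    (h : ∀ᵐ t ∂τ, ∀ᵐ ξ : Sp N, ‖W (t, ξ)‖ₑ ≤ a t) :
    ∀ᵐ ξ, ∫⁻ t, ‖W (t, ξ)‖ₑ ∂τ ≤ ∫⁻ t, a t ∂τ := by
  have h' : ∀ᵐ t ∂τ, ∀ᵐ ξ : Sp N, ‖W (t, ξ)‖ₑ ≤ ha.mk a t := by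
    filter_upwards [h, ha.ae_eq_mk] with t ht hat
    rwa [← hat]
  rw [lintegral_congr_ae ha.ae_eq_mk]
  have hs : MeasurableSet {z : ℝ × Sp N | ‖W z‖ₑ ≤ ha.mk a z.1} :=
    measurableSet_le hW.enorm (ha.measurable_mk.comp measurable_fst)
  filter_upwards [(Measure.ae_ae_comm hs).1 h'] with ξ hξ
  exact lintegral_mono_ae hξ

theorem aemeasurable_eLpNorm_one {ι : Type} [Fintype ι] {τ : Measure ℝ}
    {w : ℝ → L2 N (EuclideanSpace ℝ ι)} (hw : AEStronglyMeasurable w τ) :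
    AEMeasurable (fun t => eLpNorm (w t) 1 volume) τ := by
  obtain ⟨G, hG, h⟩ := exists_joint_representative w hw
  refine ⟨fun t => ∫⁻ x, ‖G (t, x)‖ₑ, hG.enorm.lintegral_prod_right', ?_⟩
  filter_upwards [h] with t ht
  rw [eLpNorm_congr_ae ht, eLpNorm_one_eq_lintegral_enorm]

/-- On the frequency side, the divergence of an `L²` matrix field that is an `L¹` vector field
is bounded by the `L¹` norm. -/
theorem IsDiv.enorm_fourier_le {F : L2 N (Mat N)} {h : Lp (Sp N) 1 (volume : Measure (Sp N))}
    (hF : IsDiv F h) (i : Fin N) :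
    ∀ᵐ ξ : Sp N, ‖2 * Real.pi * Complex.I *
      ∑ j, (ξ j : ℂ) * (𝓕 (coordC (i, j) F) : L2 N ℂ) ξ‖ₑ ≤ ‖h‖ₑ := by
  have hle : ∫⁻ x, ‖((h x i : ℝ) : ℂ)‖ₑ ≤ ‖h‖ₑ := by
    rw [Lp.enorm_def, eLpNorm_one_eq_lintegral_enorm]
    refine lintegral_mono fun x => ?_
    rw [← ofReal_norm, ← ofReal_norm, Complex.norm_real]
    exact ENNReal.ofReal_le_ofReal (PiLp.norm_apply_le _ _)
  have hg : Integrable fun x => ((h x i : ℝ) : ℂ) := by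
    refine ⟨?_, lt_of_le_of_lt hle enorm_lt_top⟩
    exact (Complex.continuous_ofReal.comp (EuclideanSpace.proj i :
      EuclideanSpace ℝ (Fin N) →L[ℝ] ℝ).continuous).comp_aestronglyMeasurable
        (Lp.aestronglyMeasurable h)
  have hj : ∀ j, Tempered fun ξ => (ξ j : ℂ) * (𝓕 (coordC (i, j) F) : L2 N ℂ) ξ := by
    intro j
    refine (tempered_coe _).mul (C := 1) (m := 1) ?_ fun ξ => ?_
    · exact (by fun_prop : Continuous fun ξ : Sp N => (ξ j : ℂ)).aestronglyMeasurable
    · rw [Complex.norm_real]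
      have := PiLp.norm_apply_le ξ j
      nlinarith [sq_nonneg (‖ξ‖ - 1)]
  have hs : Tempered fun ξ => 2 * Real.pi * Complex.I *
      ∑ j, (ξ j : ℂ) * (𝓕 (coordC (i, j) F) : L2 N ℂ) ξ :=
    (Tempered.sum Finset.univ fun j _ => hj j).const_mul _
  have h0 := (hs.sub (tempered_fourier hg)).ae_eq_zero fun ψ hψ => by
    simp_rw [sub_mul]
    rw [integral_sub (hs.integrable_mul _) ((tempered_fourier hg).integrable_mul _),
      integral_fourier_mul_fourierInv hg, sub_eq_zero]
    have e1 : ∫ x, ((h x i : ℝ) : ℂ) * hψ.schwartz x = ((∫ x, h x i * ψ x : ℝ) : ℂ) := by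
      rw [← integral_complex_ofReal]
      simp
    rw [e1, hF i ψ hψ, integral_finsetSum _ fun j _ => integrable_coord_mul (i, j) F (hψ.pderiv j)]
    push_cast
    simp_rw [integral_coord_mul _ F (hψ.pderiv _), hψ.fourierInv_pderiv]
    rw [← Finset.sum_neg_distrib]
    simp_rw [mul_assoc (2 * Real.pi * Complex.I : ℂ), Finset.sum_mul]
    rw [integral_const_mul, integral_finsetSum _ fun j _ => (hj j).integrable_mul _,
      Finset.mul_sum]
    refine Finset.sum_congr rfl fun j _ => ?_
    rw [← integral_const_mul, ← integral_neg]
    refine integral_congr_ae (ae_of_all _ fun ξ => ?_)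
    simp only
    ring
  filter_upwards [h0] with ξ hξ
  rw [sub_eq_zero.1 hξ]
  exact (StokesHeat.enorm_fourier_le _ ξ).trans hle

end IntegrableFourier

/-! ### Scalar fields with prescribed Fourier transforms -/

section ScalarField

/-- The real scalar field of class `L²((0,T); L²)` whose Fourier transform is prescribed (up to
taking real parts). -/
theorem exists_scalar_field {T : EReal} {y : ℝ × Sp N → ℂ} (hy : StronglyMeasurable y)
    (h : ∫⁻ t, (∫⁻ ξ, ‖y (t, ξ)‖ₑ ^ 2) ∂(timeMeasure T) < ⊤) :
    ∃ P : ℝ → Lp ℝ 2 (volume : Measure (Sp N)), MemLp P 2 (timeMeasure T) ∧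
      ∀ᵐ t ∂(timeMeasure T), MemLp (fun ξ => y (t, ξ)) 2 volume ∧
        ∀ (ψ : Sp N → ℝ) (hψ : IsTest ψ),
          ∫ x, P t x * ψ x = (∫ ξ, y (t, ξ) * (𝓕⁻ hψ.schwartz) ξ).re := by
  classical
  have hm : Measurable fun t => ∫⁻ ξ, ‖y (t, ξ)‖ₑ ^ 2 :=
    (hy.enorm.pow_const 2).lintegral_prod_right'
  -- at the exceptional times, where the slice is not in `L²`, the field is set to zero
  set A : Set ℝ := {t | ∫⁻ ξ, ‖y (t, ξ)‖ₑ ^ 2 < ⊤} with hA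
  have hAm : MeasurableSet A := measurableSet_lt hm measurable_const
  set G : ℝ × Sp N → ℂ := (A ×ˢ univ).indicator y with hG
  have hGm : StronglyMeasurable G := hy.indicator (hAm.prod MeasurableSet.univ)
  have hGin : ∀ t ∈ A, ∀ ξ, G (t, ξ) = y (t, ξ) := fun t ht ξ => by simp [G, ht]
  have hslice : ∀ t, StronglyMeasurable fun ξ => G (t, ξ) := fun t =>
    hGm.comp_measurable (measurable_const.prodMk measurable_id)
  have hmem : ∀ t, MemLp (fun ξ => G (t, ξ)) 2 volume := by
    intro t
    by_cases ht : t ∈ A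
    · refine ⟨(hslice t).aestronglyMeasurable, ?_⟩
      rw [eLpNorm_lt_top_iff_lintegral_rpow_enorm_lt_top (by norm_num) (by norm_num)]
      simp only [ENNReal.toReal_ofNat, ENNReal.rpow_ofNat, hGin t ht]
      exact ht
    · have : (fun ξ => G (t, ξ)) = fun _ => 0 := by
        funext ξ
        simp [G, ht]
      rw [this]
      exact MemLp.zero'
  set W : ℝ → L2 N ℂ := fun t => (hmem t).toLp _ with hW
  have hWc : ∀ t, W t =ᵐ[volume] fun ξ => G (t, ξ) := fun t => (hmem t).coeFn_toLp
  have hWm : StronglyMeasurable W := stronglyMeasurable_of_joint G hGm W hWc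
  have hWL : MemLp W 2 (timeMeasure T) := by
    refine ⟨hWm.aestronglyMeasurable, ?_⟩
    rw [eLpNorm_lt_top_iff_lintegral_rpow_enorm_lt_top (by norm_num) (by norm_num)]
    simp only [ENNReal.toReal_ofNat, ENNReal.rpow_ofNat]
    refine lt_of_le_of_lt (lintegral_mono fun t => ?_) h
    rw [Lp.enorm_def, eLpNorm_eq_lintegral_rpow_enorm_toReal (by norm_num) (by norm_num)]
    simp only [ENNReal.toReal_ofNat, ENNReal.rpow_ofNat]
    rw [ennreal_sqrt_sq]
    refine lintegral_mono_ae ?_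
    filter_upwards [hWc t] with ξ hξ
    rw [hξ]
    by_cases ht : t ∈ A
    · rw [hGin t ht]
    · simp [G, ht]
  have hU : MemLp (fun t => (𝓕⁻ (W t) : L2 N ℂ)) 2 (timeMeasure T) :=
    ((Lp.fourierTransformₗᵢ (Sp N) ℂ).symm.toContinuousLinearEquiv :
      L2 N ℂ →L[ℂ] L2 N ℂ).comp_memLp' hWL
  refine ⟨fun t => Complex.reCLM.compLp (𝓕⁻ (W t) : L2 N ℂ),
    (Complex.reCLM.compLpL 2 (volume : Measure (Sp N))).comp_memLp' hU, ?_⟩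
  filter_upwards [ae_lt_top hm h.ne] with t ht
  have hs : (fun ξ => G (t, ξ)) = fun ξ => y (t, ξ) := funext (hGin t ht)
  refine ⟨hs ▸ hmem t, fun ψ hψ => ?_⟩
  have h1 := integral_mul_test (𝓕⁻ (W t) : L2 N ℂ) hψ
  have h2 := integral_re h1
  simp only [RCLike.re_eq_complex_re] at h2
  have h3 := integral_mul_schwartz (𝓕⁻ (W t) : L2 N ℂ) hψ.schwartz
  rw [FourierTransform.fourier_fourierInv_eq] at h3
  simp only [IsTest.schwartz_apply] at h3
  rw [h3] at h2
  have h4 : ∫ ξ, y (t, ξ) * (𝓕⁻ hψ.schwartz) ξ = ∫ ξ, W t ξ * (𝓕⁻ hψ.schwartz) ξ := by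
    refine integral_congr_ae ?_
    filter_upwards [hWc t] with ξ hξ
    rw [hξ, hGin t ht]
  rw [h4, ← h2]
  refine integral_congr_ae ?_
  filter_upwards [ContinuousLinearMap.coeFn_compLp Complex.reCLM (𝓕⁻ (W t) : L2 N ℂ)] with x hx
  rw [hx]
  simp

theorem memL2L2loc_of_memLp {T : EReal} {P : ℝ → Lp ℝ 2 (volume : Measure (Sp N))}
    (hP : MemLp P 2 (timeMeasure T)) : MemL2L2loc T fun t x => P t x := fun K _ =>
  ⟨fun t => LpToLpRestrictCLM (Sp N) ℝ ℝ volume 2 K (P t),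
    (LpToLpRestrictCLM (Sp N) ℝ ℝ volume 2 K).comp_memLp' hP,
    ae_of_all _ fun t => (LpToLpRestrictCLM_coeFn ℝ K (P t)).symm⟩

end ScalarField

/-! ### Divergence-free fields on the frequency side -/

section Divergence

theorem tempered_coord_mul {G : Sp N → ℂ} (hG : Tempered G) (j : Fin N) :
    Tempered fun ξ => (ξ j : ℂ) * G ξ := by
  refine hG.mul (C := 1) (m := 1) ?_ fun ξ => ?_
  · exact (by fun_prop : Continuous fun ξ : Sp N => (ξ j : ℂ)).aestronglyMeasurable
  · rw [Complex.norm_real]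
    have := PiLp.norm_apply_le ξ j
    nlinarith [sq_nonneg (‖ξ‖ - 1)]

/-- A divergence-free field has Fourier transform orthogonal to the frequency. -/
theorem IsDivFree.sum_fourier_eq_zero {v : L2 N (Sp N)} (hv : IsDivFree v) :
    ∀ᵐ ξ : Sp N, ∑ j, (ξ j : ℂ) * (𝓕 (coordC j v) : L2 N ℂ) ξ = 0 := by
  have hj : ∀ j : Fin N, Tempered fun ξ => (ξ j : ℂ) * (𝓕 (coordC j v) : L2 N ℂ) ξ := fun j =>
    tempered_coord_mul (tempered_coe _) j
  refine (Tempered.sum Finset.univ fun j _ => hj j).ae_eq_zero fun ψ hψ => ?_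
  have h1 := hv ψ hψ
  rw [integral_finsetSum _ fun j _ => integrable_coord_mul j v (hψ.pderiv j)] at h1
  have h2 := congrArg (fun r : ℝ => (r : ℂ)) h1
  simp only [Complex.ofReal_sum, Complex.ofReal_zero] at h2
  simp_rw [integral_coord_mul _ v (hψ.pderiv _), hψ.fourierInv_pderiv] at h2
  simp_rw [Finset.sum_mul]
  rw [integral_finsetSum _ fun j _ => (hj j).integrable_mul _]
  have h3 : ∀ j : Fin N, ∫ ξ : Sp N, (𝓕 (coordC j v) : L2 N ℂ) ξ *
      (-(2 * Real.pi * Complex.I) * (ξ j : ℂ) * (𝓕⁻ hψ.schwartz) ξ) =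
      -(2 * Real.pi * Complex.I) *
        ∫ ξ : Sp N, (ξ j : ℂ) * (𝓕 (coordC j v) : L2 N ℂ) ξ * (𝓕⁻ hψ.schwartz) ξ := by
    intro j
    rw [← integral_const_mul]
    refine integral_congr_ae (ae_of_all _ fun ξ => ?_)
    simp only
    ring
  simp_rw [h3, ← Finset.mul_sum] at h2
  refine (mul_eq_zero.1 h2).resolve_left ?_
  simp [Real.pi_ne_zero]

/-- A field whose pairings are computed from a frequency side orthogonal to the frequency is
divergence-free. -/
theorem isDivFree_of_pairing {v : L2 N (Sp N)} {y : Fin N → Sp N → ℂ}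
    (hy : ∀ k, MemLp (y k) 2 volume)
    (hv : ∀ k (ψ : Sp N → ℝ) (hψ : IsTest ψ),
      ∫ x, v x k * ψ x = (∫ ξ, y k ξ * (𝓕⁻ hψ.schwartz) ξ).re)
    (h : ∀ᵐ ξ : Sp N, ∑ j, (ξ j : ℂ) * y j ξ = 0) : IsDivFree v := by
  intro ψ hψ
  rw [integral_finsetSum _ fun j _ => integrable_coord_mul j v (hψ.pderiv j)]
  simp_rw [hv _ _ (hψ.pderiv _), ← Complex.re_sum]
  rw [← integral_finsetSum _ fun j _ => (tempered_of_memLp_two (hy j)).integrable_mul _]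
  simp_rw [hψ.fourierInv_pderiv]
  have h0 : ∫ ξ : Sp N, ∑ j, y j ξ *
      (-(2 * Real.pi * Complex.I) * (ξ j : ℂ) * (𝓕⁻ hψ.schwartz) ξ) = 0 := by
    refine integral_eq_zero_of_ae ?_
    filter_upwards [h] with ξ hξ
    have : ∑ j, y j ξ * (-(2 * Real.pi * Complex.I) * (ξ j : ℂ) * (𝓕⁻ hψ.schwartz) ξ) =
        (-(2 * Real.pi * Complex.I) * (𝓕⁻ hψ.schwartz) ξ) * ∑ j, (ξ j : ℂ) * y j ξ := by
      rw [Finset.mul_sum]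
      refine Finset.sum_congr rfl fun j _ => ?_
      ring
    rw [this, hξ, mul_zero]
    rfl
  rw [h0, Complex.zero_re]

end Divergence

/-! ### The pressure and the Leray projection -/

section Symbols

/-- The pressure on the frequency side: `p̂ = ∑ ξ_k ξ_l F̂_{kl} / |ξ|²`. It is set to zero at
`ξ = 0` by the convention for division. -/
def pressureHat (W : Fin N × Fin N → ℝ × Sp N → ℂ) (z : ℝ × Sp N) : ℂ :=
  (∑ q, (z.2 q.1 : ℂ) * (z.2 q.2 : ℂ) * W q z) / ((‖z.2‖ ^ 2 : ℝ) : ℂ)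

/-- The frequency side of `Div F - ∇p`, the Leray projection of `Div F`. -/
def stokesForcing (W : Fin N × Fin N → ℝ × Sp N → ℂ) (i : Fin N) (z : ℝ × Sp N) : ℂ :=
  2 * Real.pi * Complex.I *
    ((∑ j, (z.2 j : ℂ) * W (i, j) z) - (z.2 i : ℂ) * pressureHat W z)

theorem stronglyMeasurable_coord (j : Fin N) :
    StronglyMeasurable fun z : ℝ × Sp N => (z.2 j : ℂ) :=
  (by fun_prop : Continuous fun z : ℝ × Sp N => (z.2 j : ℂ)).stronglyMeasurable

theorem stronglyMeasurable_pressureHat {W : Fin N × Fin N → ℝ × Sp N → ℂ}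
    (hW : ∀ q, StronglyMeasurable (W q)) : StronglyMeasurable (pressureHat W) := by
  refine StronglyMeasurable.div ?_ ?_
  · exact Finset.stronglyMeasurable_fun_sum _ fun q _ =>
      ((stronglyMeasurable_coord q.1).mul (stronglyMeasurable_coord q.2)).mul (hW q)
  · exact (by fun_prop : Continuous fun z : ℝ × Sp N =>
      ((‖z.2‖ ^ 2 : ℝ) : ℂ)).stronglyMeasurable

theorem stronglyMeasurable_stokesForcing {W : Fin N × Fin N → ℝ × Sp N → ℂ}
    (hW : ∀ q, StronglyMeasurable (W q)) (i : Fin N) : StronglyMeasurable (stokesForcing W i) := by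
  refine StronglyMeasurable.const_mul (StronglyMeasurable.sub ?_ ?_) _
  · exact Finset.stronglyMeasurable_fun_sum _ fun j _ => (stronglyMeasurable_coord j).mul (hW _)
  · exact (stronglyMeasurable_coord i).mul (stronglyMeasurable_pressureHat hW)

theorem norm_coord_le (ξ : Sp N) (j : Fin N) : ‖(ξ j : ℂ)‖ ≤ ‖ξ‖ := by
  rw [Complex.norm_real]
  exact PiLp.norm_apply_le ξ j

theorem norm_pressureHat_le (W : Fin N × Fin N → ℝ × Sp N → ℂ) (z : ℝ × Sp N) :
    ‖pressureHat W z‖ ≤ ∑ q, ‖W q z‖ := by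
  unfold pressureHat
  rw [norm_div, Complex.norm_real, Real.norm_of_nonneg (by positivity)]
  refine div_le_of_le_mul₀ (by positivity) (by positivity) ?_
  refine (norm_sum_le _ _).trans ?_
  rw [Finset.sum_mul]
  refine Finset.sum_le_sum fun q _ => ?_
  rw [norm_mul, norm_mul]
  have h1 := norm_coord_le z.2 q.1
  have h2 := norm_coord_le z.2 q.2
  calc _ ≤ ‖z.2‖ * ‖z.2‖ * ‖W q z‖ := by gcongr
    _ = _ := by ring

theorem norm_two_pi_I : ‖(2 * Real.pi * Complex.I : ℂ)‖ = 2 * Real.pi := by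
  simp [abs_of_pos Real.pi_pos]

theorem norm_stokesForcing_le (W : Fin N × Fin N → ℝ × Sp N → ℂ) (i : Fin N) (z : ℝ × Sp N) :
    ‖stokesForcing W i z‖ ≤ 2 * Real.pi * ‖z.2‖ * (2 * ∑ q, ‖W q z‖) := by
  unfold stokesForcing
  rw [norm_mul, norm_two_pi_I, mul_assoc (2 * Real.pi)]
  refine mul_le_mul_of_nonneg_left ?_ (by positivity)
  refine (norm_sub_le _ _).trans ?_
  have h1 : ‖∑ j, (z.2 j : ℂ) * W (i, j) z‖ ≤ ‖z.2‖ * ∑ q, ‖W q z‖ := by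
    refine (norm_sum_le _ _).trans ?_
    have h2 : ∑ j, ‖W (i, j) z‖ ≤ ∑ q, ‖W q z‖ := by
      rw [Fintype.sum_prod_type]
      exact Finset.single_le_sum (f := fun i => ∑ j, ‖W (i, j) z‖)
        (fun i _ => Finset.sum_nonneg fun j _ => norm_nonneg _) (Finset.mem_univ i)
    refine le_trans ?_ (mul_le_mul_of_nonneg_left h2 (norm_nonneg _))
    rw [Finset.mul_sum]
    refine Finset.sum_le_sum fun j _ => ?_
    rw [norm_mul]
    exact mul_le_mul_of_nonneg_right (norm_coord_le _ _) (norm_nonneg _)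
  have h3 : ‖(z.2 i : ℂ) * pressureHat W z‖ ≤ ‖z.2‖ * ∑ q, ‖W q z‖ := by
    rw [norm_mul]
    exact mul_le_mul (norm_coord_le _ _) (norm_pressureHat_le W z) (norm_nonneg _) (norm_nonneg _)
  linarith

theorem enorm_sq_eq_ofReal (a : ℂ) : ‖a‖ₑ ^ 2 = ENNReal.ofReal (‖a‖ ^ 2) := by
  rw [← ofReal_norm, ENNReal.ofReal_pow (norm_nonneg _)]

theorem sq_sum_norm_le (W : Fin N × Fin N → ℝ × Sp N → ℂ) (z : ℝ × Sp N) :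
    (∑ q, ‖W q z‖) ^ 2 ≤ (N * N : ℝ) * ∑ q, ‖W q z‖ ^ 2 := by
  have := sq_sum_le_card_mul_sum_sq (s := (Finset.univ : Finset (Fin N × Fin N)))
    (f := fun q => ‖W q z‖)
  simpa using this

theorem ofReal_mul_sum_sq {c : ℝ} (hc : 0 ≤ c) (W : Fin N × Fin N → ℝ × Sp N → ℂ) (z : ℝ × Sp N) :
    ENNReal.ofReal (c * ∑ q, ‖W q z‖ ^ 2) = ENNReal.ofReal c * ∑ q, ‖W q z‖ₑ ^ 2 := by
  rw [ENNReal.ofReal_mul hc, ENNReal.ofReal_sum_of_nonneg fun q _ => by positivity]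
  simp_rw [enorm_sq_eq_ofReal]

theorem sq_enorm_pressureHat_le (W : Fin N × Fin N → ℝ × Sp N → ℂ) (z : ℝ × Sp N) :
    ‖pressureHat W z‖ₑ ^ 2 ≤ ENNReal.ofReal (N * N) * ∑ q, ‖W q z‖ₑ ^ 2 := by
  rw [← ofReal_mul_sum_sq (by positivity), enorm_sq_eq_ofReal]
  refine ENNReal.ofReal_le_ofReal (le_trans ?_ (sq_sum_norm_le W z))
  exact pow_le_pow_left₀ (norm_nonneg _) (norm_pressureHat_le W z) 2

theorem sq_enorm_stokesForcing_le (W : Fin N × Fin N → ℝ × Sp N → ℂ) (i : Fin N) (z : ℝ × Sp N) :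
    ‖stokesForcing W i z‖ₑ ^ 2 ≤
      weight 1 z.2 * (ENNReal.ofReal (4 * (N * N)) * ∑ q, ‖W q z‖ₑ ^ 2) := by
  rw [← ofReal_mul_sum_sq (by positivity), enorm_sq_eq_ofReal, weight, Real.rpow_one,
    ← ENNReal.ofReal_mul (by linarith [freq_nonneg z.2])]
  refine ENNReal.ofReal_le_ofReal ?_
  have h1 := sq_sum_norm_le W z
  calc ‖stokesForcing W i z‖ ^ 2 ≤ (2 * Real.pi * ‖z.2‖ * (2 * ∑ q, ‖W q z‖)) ^ 2 :=
        pow_le_pow_left₀ (norm_nonneg _) (norm_stokesForcing_le W i z) 2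
    _ = freq z.2 * (4 * (∑ q, ‖W q z‖) ^ 2) := by unfold freq; ring
    _ ≤ (1 + freq z.2) * (4 * ((N * N : ℝ) * ∑ q, ‖W q z‖ ^ 2)) := by
        have := freq_nonneg z.2
        gcongr
        linarith
    _ = _ := by ring

theorem forcingEnergy_stokes_le (T : EReal) (r : ℝ) {W : Fin N × Fin N → ℝ × Sp N → ℂ}
    (hW : ∀ q, StronglyMeasurable (W q)) (i : Fin N) :
    forcingEnergy T (r - 1) (stokesForcing W i) ≤
      ENNReal.ofReal (4 * (N * N)) * ∑ q, forcingEnergy T r (W q) := by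
  have hm : ∀ q, Measurable fun ξ => weight r ξ * ∫⁻ t, ‖W q (t, ξ)‖ₑ ^ 2 ∂(timeMeasure T) :=
    fun q => (measurable_weight r).mul (measurable_time_energy T (hW q))
  have hm' : ∀ q (ξ : Sp N), Measurable fun t => ‖W q (t, ξ)‖ₑ ^ 2 := fun q ξ =>
    (measurable_slice (hW q) ξ).enorm.pow_const 2
  unfold forcingEnergy
  rw [← lintegral_finsetSum _ fun q _ => hm q,
    ← lintegral_const_mul _ (Finset.measurable_fun_sum _ fun q _ => hm q)]
  refine lintegral_mono fun ξ => ?_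
  calc _ ≤ weight (r - 1) ξ * ∫⁻ t, weight 1 ξ * (ENNReal.ofReal (4 * (N * N)) *
          ∑ q, ‖W q (t, ξ)‖ₑ ^ 2) ∂(timeMeasure T) :=
        mul_le_mul' le_rfl (lintegral_mono fun t => sq_enorm_stokesForcing_le W i (t, ξ))
    _ = weight (r - 1) ξ * weight 1 ξ * (ENNReal.ofReal (4 * (N * N)) *
          ∑ q, ∫⁻ t, ‖W q (t, ξ)‖ₑ ^ 2 ∂(timeMeasure T)) := by
        rw [lintegral_const_mul' _ _ (weight_ne_top _ _),
          lintegral_const_mul' _ _ ENNReal.ofReal_ne_top,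
          lintegral_finsetSum _ fun q _ => hm' q ξ]
        ring
    _ = _ := by
        rw [← weight_add, sub_add_cancel, Finset.mul_sum, Finset.mul_sum, Finset.mul_sum]
        refine Finset.sum_congr rfl fun q _ => ?_
        ring

theorem sum_sq_coord (ξ : Sp N) : ∑ i, (ξ i : ℂ) * (ξ i : ℂ) = ((‖ξ‖ ^ 2 : ℝ) : ℂ) := by
  rw [EuclideanSpace.real_norm_sq_eq]
  push_cast
  exact Finset.sum_congr rfl fun i _ => by ring

theorem sum_coord_mul_stokesForcing (W : Fin N × Fin N → ℝ × Sp N → ℂ) (z : ℝ × Sp N) :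
    ∑ i, (z.2 i : ℂ) * stokesForcing W i z = 0 := by
  have h1 : ∑ i, (z.2 i : ℂ) * stokesForcing W i z = 2 * Real.pi * Complex.I *
      ((∑ q : Fin N × Fin N, (z.2 q.1 : ℂ) * (z.2 q.2 : ℂ) * W q z) -
        (∑ i, (z.2 i : ℂ) * (z.2 i : ℂ)) * pressureHat W z) := by
    unfold stokesForcing
    rw [Fintype.sum_prod_type, Finset.sum_mul, ← Finset.sum_sub_distrib, Finset.mul_sum]
    refine Finset.sum_congr rfl fun i _ => ?_
    simp_rw [mul_assoc (z.2 i : ℂ), ← Finset.mul_sum]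
    ring
  rw [h1, sum_sq_coord]
  unfold pressureHat
  by_cases h0 : z.2 = 0
  · simp [h0]
  · rw [mul_div_cancel₀, sub_self, mul_zero]
    exact_mod_cast pow_ne_zero 2 (norm_ne_zero_iff.2 h0)

/-- If `Div F` is bounded by `m` on the frequency side, then so is its Leray projection, up to a
factor. -/
theorem enorm_stokesForcing_le {W : Fin N × Fin N → ℝ × Sp N → ℂ} {z : ℝ × Sp N} {m : ℝ≥0∞}
    (h : ∀ i, ‖2 * Real.pi * Complex.I * ∑ j, (z.2 j : ℂ) * W (i, j) z‖ₑ ≤ m) (i : Fin N) :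
    ‖stokesForcing W i z‖ₑ ≤ (N + 1) * m := by
  set H : Fin N → ℂ := fun i => 2 * Real.pi * Complex.I * ∑ j, (z.2 j : ℂ) * W (i, j) z with hH
  -- the projection is applied to `Div F`, whose components are `H`, with bounded coefficients
  have e : stokesForcing W i z =
      H i - ∑ k, ((z.2 i : ℂ) * (z.2 k : ℂ) / ((‖z.2‖ ^ 2 : ℝ) : ℂ)) * H k := by
    unfold stokesForcing pressureHat
    rw [mul_sub]
    congr 1
    rw [Fintype.sum_prod_type, Finset.sum_div, Finset.mul_sum, Finset.mul_sum]
    refine Finset.sum_congr rfl fun k _ => ?_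
    simp_rw [hH, mul_assoc (z.2 k : ℂ), ← Finset.mul_sum]
    ring
  have hc : ∀ k, ‖(z.2 i : ℂ) * (z.2 k : ℂ) / ((‖z.2‖ ^ 2 : ℝ) : ℂ)‖ₑ ≤ 1 := by
    intro k
    rw [← ofReal_norm, ← ENNReal.ofReal_one]
    refine ENNReal.ofReal_le_ofReal ?_
    rw [norm_div, Complex.norm_real, norm_mul, Real.norm_of_nonneg (by positivity)]
    refine div_le_one_of_le₀ ?_ (by positivity)
    rw [sq]
    exact mul_le_mul (norm_coord_le _ _) (norm_coord_le _ _) (norm_nonneg _) (norm_nonneg _)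
  rw [e]
  refine (enorm_sub_le).trans ?_
  have h2 : ‖∑ k, ((z.2 i : ℂ) * (z.2 k : ℂ) / ((‖z.2‖ ^ 2 : ℝ) : ℂ)) * H k‖ₑ ≤ N * m := by
    refine (enorm_sum_le _ _).trans ?_
    calc _ ≤ ∑ _k : Fin N, m := Finset.sum_le_sum fun k _ => by
          rw [enorm_mul]
          exact (mul_le_mul' (hc k) (h k)).trans (one_mul m).le
      _ = _ := by simp
  calc _ ≤ m + N * m := add_le_add (h i) h2
    _ = _ := by ring

end Symbols

/-! ### Existence -/

section Existence

theorem integrable_kernel_mul {T : EReal} {lam : ℝ} (hl : 0 ≤ lam) {f : ℝ → ℂ}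
    (hf : MemLp f 2 (timeMeasure T)) (t : ℝ) :
    Integrable (fun s => (expKernel lam (t - s) : ℂ) * f s) (timeMeasure T) := by
  have hfin : IsFiniteMeasure ((timeMeasure T).restrict (Iio t)) := by
    refine ⟨?_⟩
    rw [Measure.restrict_apply_univ, timeMeasure, Measure.restrict_apply measurableSet_Iio]
    refine lt_of_le_of_lt (measure_mono ?_) (measure_Ioo_lt_top (a := (0 : ℝ)) (b := t))
    exact fun s hs => ⟨hs.2.1, hs.1⟩
  have h1 : Integrable f ((timeMeasure T).restrict (Iio t)) :=
    (hf.restrict _).integrable (by norm_num)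
  have hm : Measurable fun s => (expKernel lam (t - s) : ℂ) :=
    Complex.measurable_ofReal.comp
      ((measurable_expKernel_right lam).comp (measurable_const.sub measurable_id))
  have h2 : IntegrableOn (fun s => (expKernel lam (t - s) : ℂ) * f s) (Iio t) (timeMeasure T) := by
    refine h1.bdd_mul (c := 1) hm.aestronglyMeasurable (ae_of_all _ fun s => ?_)
    rw [Complex.norm_real, Real.norm_of_nonneg (expKernel_nonneg _ _)]
    exact expKernel_le_one hl _
  refine (integrableOn_iff_integrable_of_support_subset fun s hs => ?_).1 h2
  by_contra hst
  refine hs ?_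
  have : ¬ 0 < t - s := by simpa using hst
  simp [expKernel, this]

/-- Linear combinations, with coefficients depending on the frequency, of heat solutions. -/
theorem sum_mul_heatSol {T : EReal} {Y : Fin N → Sp N → ℂ} {f : Fin N → ℝ × Sp N → ℂ} {ξ : Sp N}
    (hf : ∀ j, MemLp (fun s => f j (s, ξ)) 2 (timeMeasure T)) (c : Fin N → ℂ) (t : ℝ) :
    ∑ j, c j * heatSol T (Y j) (f j) (t, ξ) =
      duhamel T (freq ξ) (∑ j, c j * Y j ξ) (fun s => ∑ j, c j * f j (s, ξ)) t := by
  simp only [heatSol_apply, duhamel]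
  have hi := fun j => integrable_kernel_mul (freq_nonneg ξ) (hf j) t
  have h1 : ∫ s, (expKernel (freq ξ) (t - s) : ℂ) * ∑ j, c j * f j (s, ξ) ∂(timeMeasure T) =
      ∑ j, c j * ∫ s, (expKernel (freq ξ) (t - s) : ℂ) * f j (s, ξ) ∂(timeMeasure T) := by
    simp_rw [← integral_const_mul]
    rw [← integral_finsetSum _ fun j _ => (hi j).const_mul _]
    refine integral_congr_ae (ae_of_all _ fun s => ?_)
    simp only [Finset.mul_sum]
    exact Finset.sum_congr rfl fun j _ => by ring
  rw [h1, Finset.mul_sum, ← Finset.sum_add_distrib]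
  exact Finset.sum_congr rfl fun j _ => by ring

/-- Existence for the heat equation: a field with the bound given by the energies of its frequency
side, solving the weak equation with initial condition. -/
theorem exists_heat_field {T : EReal} (hT : 0 < T) {r : ℝ} (hr : 0 ≤ r) (v₀ : L2 N (Sp N))
    {f : Fin N → ℝ × Sp N → ℂ} (hf : ∀ k, StronglyMeasurable (f k))
    (hB : ∀ k, forcingEnergy T (r - 1) (f k) < ⊤) {M : ℝ≥0∞} (hM : M < ⊤)
    (h : ∀ k, HasEnergyBound T r (𝓕 (coordC k v₀) : L2 N ℂ) (f k) M) :
    ∃ v : ℝ → L2 N (Sp N), MemX T r v ∧ xNorm T r v ≤ 2 * (N * M) ^ (1 / 2 : ℝ) ∧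
      (∀ t ∈ timeInterval T, ∀ k (ψ : Sp N → ℝ) (hψ : IsTest ψ), ∫ x, v t x k * ψ x =
        (∫ ξ, heatSol T (𝓕 (coordC k v₀) : L2 N ℂ) (f k) (t, ξ) * (𝓕⁻ hψ.schwartz) ξ).re) ∧
      ∀ k (φ : ℝ × Sp N → ℝ), IsSpaceTimeTest T φ →
        (∫ t, (∫ x, v t x k * (tderiv φ t x + xlap φ t x)) ∂(timeMeasure T)) +
        (∫ t, (∫ ξ, f k (t, ξ) * sliceF φ t ξ).re ∂(timeMeasure T)) +
        ∫ x, v₀ x k * φ (0, x) = 0 := by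
  have hm : ∀ k, StronglyMeasurable (heatSol T (𝓕 (coordC k v₀) : L2 N ℂ) (f k)) := fun k =>
    stronglyMeasurable_heatSol T (Lp.stronglyMeasurable _) (hf k)
  have hNM : N * M < ⊤ := ENNReal.mul_lt_top (ENNReal.natCast_lt_top N) hM
  have hsum : ∀ a : Fin N → ℝ≥0∞, (∀ k, a k ≤ M) → ∑ k, a k ≤ N * M := fun a ha =>
    (Finset.sum_le_sum fun k _ => ha k).trans (by simp)
  obtain ⟨v, hv, hx, hp⟩ := exists_field hr hm hNM
    (fun t ht => hsum _ fun k => (h k).1 t ht) (by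
      have m4 : ∀ k, Measurable fun t => ∫⁻ ξ, weight (r + 1) ξ *
          ‖heatSol T (𝓕 (coordC k v₀) : L2 N ℂ) (f k) (t, ξ)‖ₑ ^ 2 := by
        intro k
        have m5 : Measurable fun z : ℝ × Sp N => weight (r + 1) z.2 *
            ‖heatSol T (𝓕 (coordC k v₀) : L2 N ℂ) (f k) z‖ₑ ^ 2 :=
          ((measurable_weight (r + 1)).comp measurable_snd).mul ((hm k).enorm.pow_const 2)
        exact m5.lintegral_prod_right'
      rw [lintegral_finsetSum _ fun k _ => m4 k]
      exact hsum _ fun k => (h k).2)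
  refine ⟨v, ⟨hv, lt_of_le_of_lt hx ?_⟩, hx, hp, fun k φ hφ => ?_⟩
  · exact ENNReal.mul_lt_top (by norm_num) (ENNReal.rpow_lt_top_of_nonneg (by norm_num) hNM.ne)
  · exact heatSol_weak hT hr v₀ k (hf k) (hB k) (lt_of_le_of_lt (h k).2 hM)
      (fun t ht => hp t ht k) hφ

theorem memLp_time_slice {T : EReal} {f : ℝ × Sp N → ℂ} (hf : StronglyMeasurable f) {ξ : Sp N}
    (h : ∫⁻ t, ‖f (t, ξ)‖ₑ ^ 2 ∂(timeMeasure T) < ⊤) :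
    MemLp (fun t => f (t, ξ)) 2 (timeMeasure T) := by
  refine ⟨(measurable_slice hf ξ).aestronglyMeasurable, ?_⟩
  rw [eLpNorm_lt_top_iff_lintegral_rpow_enorm_lt_top (by norm_num) (by norm_num)]
  simpa only [ENNReal.toReal_ofNat, ENNReal.rpow_ofNat] using h

theorem lintegral_pressureHat_lt_top {T : EReal} {r : ℝ} (hr : 0 ≤ r)
    {W : Fin N × Fin N → ℝ × Sp N → ℂ} (hW : ∀ q, StronglyMeasurable (W q))
    (hE : ∑ q, forcingEnergy T r (W q) < ⊤) :
    ∫⁻ t, (∫⁻ ξ, ‖pressureHat W (t, ξ)‖ₑ ^ 2) ∂(timeMeasure T) < ⊤ := by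
  have hm : ∀ q, Measurable fun z => ‖W q z‖ₑ ^ 2 := fun q => (hW q).enorm.pow_const 2
  have hm1 : ∀ q t, Measurable fun ξ => ‖W q (t, ξ)‖ₑ ^ 2 := fun q t =>
    (hm q).comp (measurable_const.prodMk measurable_id)
  have hm2 : ∀ q, Measurable fun t => ∫⁻ ξ, ‖W q (t, ξ)‖ₑ ^ 2 := fun q =>
    (hm q).lintegral_prod_right'
  calc _ ≤ ∫⁻ t, (∫⁻ ξ, ENNReal.ofReal (N * N) * ∑ q, ‖W q (t, ξ)‖ₑ ^ 2) ∂(timeMeasure T) :=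
        lintegral_mono fun t => lintegral_mono fun ξ => sq_enorm_pressureHat_le W (t, ξ)
    _ = ENNReal.ofReal (N * N) *
          ∑ q, ∫⁻ t, (∫⁻ ξ, ‖W q (t, ξ)‖ₑ ^ 2) ∂(timeMeasure T) := by
        simp_rw [lintegral_const_mul' _ _ ENNReal.ofReal_ne_top]
        congr 1
        rw [← lintegral_finsetSum _ fun q _ => hm2 q]
        exact lintegral_congr fun t => lintegral_finsetSum _ fun q _ => hm1 q t
    _ ≤ ENNReal.ofReal (N * N) * ∑ q, forcingEnergy T r (W q) := by
        gcongr with q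
        rw [forcingEnergy_eq T r (hW q)]
        exact lintegral_mono fun t => lintegral_mono fun ξ =>
          le_mul_of_one_le_left zero_le (one_le_weight hr ξ)
    _ < ⊤ := ENNReal.mul_lt_top ENNReal.ofReal_lt_top hE

/-- The Leray projection of `Div F`, tested against `φ`, is `∫ p ∂_i φ - ∑ F_{ij} ∂_j φ`. -/
theorem integral_stokesForcing_mul {W : Fin N × Fin N → ℝ × Sp N → ℂ} {F : L2 N (Mat N)} {t : ℝ}
    (hW : ∀ q, (𝓕 (coordC q F) : L2 N ℂ) =ᵐ[volume] fun ξ => W q (t, ξ))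
    {P : Lp ℝ 2 (volume : Measure (Sp N))}
    (hpm : MemLp (fun ξ => pressureHat W (t, ξ)) 2 volume)
    (hP : ∀ (ψ : Sp N → ℝ) (hψ : IsTest ψ),
      ∫ x, P x * ψ x = (∫ ξ, pressureHat W (t, ξ) * (𝓕⁻ hψ.schwartz) ξ).re)
    (i : Fin N) {φ : ℝ × Sp N → ℝ} (h : IsSmoothCompact φ) :
    (∫ ξ, stokesForcing W i (t, ξ) * sliceF φ t ξ).re =
      (∫ x, P x * xderiv i φ t x) - ∑ j, ∫ x, F x (i, j) * xderiv j φ t x := by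
  have hWt : ∀ q, Tempered fun ξ => W q (t, ξ) := fun q => (tempered_coe _).congr (hW q)
  have iW : ∀ q j, Integrable fun ξ =>
      W q (t, ξ) * sliceF (fun z => xderiv j φ z.1 z.2) t ξ := by
    intro q j
    simp_rw [(h.xderiv j).sliceF_eq]
    exact (hWt q).integrable_mul _
  have iP : Integrable fun ξ =>
      pressureHat W (t, ξ) * sliceF (fun z => xderiv i φ z.1 z.2) t ξ := by
    simp_rw [(h.xderiv i).sliceF_eq]
    exact (tempered_of_memLp_two hpm).integrable_mul _
  have e : ∀ ξ, stokesForcing W i (t, ξ) * sliceF φ t ξ =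
      pressureHat W (t, ξ) * sliceF (fun z => xderiv i φ z.1 z.2) t ξ -
        ∑ j, W (i, j) (t, ξ) * sliceF (fun z => xderiv j φ z.1 z.2) t ξ := by
    intro ξ
    simp_rw [h.sliceF_xderiv]
    unfold stokesForcing
    have : ∑ j, W (i, j) (t, ξ) * (-(2 * Real.pi * Complex.I) * (ξ j : ℂ) * sliceF φ t ξ) =
        -(2 * Real.pi * Complex.I) * sliceF φ t ξ * ∑ j, (ξ j : ℂ) * W (i, j) (t, ξ) := by
      rw [Finset.mul_sum]
      exact Finset.sum_congr rfl fun j _ => by ring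
    rw [this]
    ring
  simp_rw [e]
  rw [integral_sub iP (integrable_finsetSum _ fun j _ => iW _ j),
    integral_finsetSum _ fun j _ => iW _ j, Complex.sub_re, Complex.re_sum]
  congr 1
  · rw [hP _ ((h.xderiv i).slice t)]
    simp_rw [(h.xderiv i).sliceF_eq]
  · refine Finset.sum_congr rfl fun j _ => ?_
    have h1 := congrArg Complex.re (integral_coord_mul (i, j) F ((h.xderiv j).slice t))
    rw [Complex.ofReal_re] at h1
    rw [h1]
    congr 1
    refine integral_congr_ae ?_
    filter_upwards [hW (i, j)] with ξ hξ
    rw [hξ, (h.xderiv j).sliceF_eq]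

theorem integrable_Lp_mul_test (P : Lp ℝ 2 (volume : Measure (Sp N))) {ψ : Sp N → ℝ}
    (h : IsTest ψ) : Integrable fun x => P x * ψ x :=
  (Lp.memLp P).integrable_mul (h.memLp 2 volume)

/-- Existence for the Stokes/heat system, with the bounds given by the energies of the frequency
side. -/
theorem exists_solution {T : EReal} (hT : 0 < T) {s : ℝ} (hs : 0 ≤ s) {u₀ d₀ : L2 N (Sp N)}
    {F : ℝ → L2 N (Mat N)} {g : ℝ → L2 N (Sp N)} (hdiv : IsDivFree u₀)
    (hF : MemL2Hs T s F) (hg : MemL2Hs T s g)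
    {W : Fin N × Fin N → ℝ × Sp N → ℂ} (hW : ∀ q, StronglyMeasurable (W q))
    (hWt : ∀ᵐ t ∂(timeMeasure T), ∀ q,
      (𝓕 (coordC q (F t)) : L2 N ℂ) =ᵐ[volume] fun ξ => W q (t, ξ))
    {V : Fin N → ℝ × Sp N → ℂ} (hV : ∀ k, StronglyMeasurable (V k))
    (hVt : ∀ᵐ t ∂(timeMeasure T), ∀ k,
      (𝓕 (coordC k (g t)) : L2 N ℂ) =ᵐ[volume] fun ξ => V k (t, ξ))
    {Mu Md : ℝ≥0∞} (hMu : Mu < ⊤) (hMd : Md < ⊤)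
    (hbu : ∀ k, HasEnergyBound T s (𝓕 (coordC k u₀) : L2 N ℂ) (stokesForcing W k) Mu)
    (hbd : ∀ k, HasEnergyBound T (s + 1) (𝓕 (coordC k d₀) : L2 N ℂ) (V k) Md) :
    ∃ u p d, IsSolution T s u₀ d₀ F g u p d ∧ xNorm T s u ≤ 2 * (N * Mu) ^ (1 / 2 : ℝ) ∧
      xNorm T (s + 1) d ≤ 2 * (N * Md) ^ (1 / 2 : ℝ) := by
  have hEW : ∑ q, forcingEnergy T s (W q) < ⊤ := by
    rw [sum_forcingEnergy_eq s hW hWt]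
    exact ENNReal.pow_lt_top hF.2
  have hEV : ∑ k, forcingEnergy T s (V k) < ⊤ := by
    rw [sum_forcingEnergy_eq s hV hVt]
    exact ENNReal.pow_lt_top hg.2
  have hBu : ∀ k, forcingEnergy T (s - 1) (stokesForcing W k) < ⊤ := fun k =>
    lt_of_le_of_lt (forcingEnergy_stokes_le T s hW k)
      (ENNReal.mul_lt_top ENNReal.ofReal_lt_top hEW)
  have hBd : ∀ k, forcingEnergy T (s + 1 - 1) (V k) < ⊤ := fun k => by
    rw [add_sub_cancel_right]
    exact (ENNReal.sum_lt_top.1 hEV) k (Finset.mem_univ k)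
  have hfm := stronglyMeasurable_stokesForcing hW
  obtain ⟨u, hu, hun, hup, huw⟩ := exists_heat_field hT hs u₀ hfm hBu hMu hbu
  obtain ⟨d, hd, hdn, -, hdw⟩ := exists_heat_field hT (by linarith) d₀ hV hBd hMd hbd
  obtain ⟨P, hP, hPt⟩ := exists_scalar_field (stronglyMeasurable_pressureHat hW)
    (lintegral_pressureHat_lt_top hs hW hEW)
  have huL : MemLp u 2 (timeMeasure T) := hu.memLp hs
  have hdL : MemLp d 2 (timeMeasure T) := hd.memLp (by linarith)
  have hgL : MemLp g 2 (timeMeasure T) := hg.memLp hs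
  refine ⟨u, fun t x => P t x, d, ⟨hu, memL2L2loc_of_memLp hP, hd, ?_, ?_, ?_⟩, hun, hdn⟩
  · intro i φ hφ
    have h := hφ.smooth
    have hQ := h.tderiv.add h.xlap
    refine Eq.trans ?_ (huw i φ hφ)
    congr 1
    rw [← integral_add (integrable_pairing_coord huL i hQ)
      (by simpa only [RCLike.re_eq_complex_re] using
        (integrable_forcing_mul hs (hfm i) (hBu i) h).integral_prod_left.re)]
    refine integral_congr_ae ?_
    filter_upwards [hWt, hPt] with t ht hpt
    rw [integral_stokesForcing_mul ht hpt.1 hpt.2 i h]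
    have i1 := integrable_coord_mul i (u t) (hQ.slice t)
    have i2 := integrable_Lp_mul_test (P t) ((h.xderiv i).slice t)
    have i3 := fun j => integrable_coord_mul (i, j) (F t) ((h.xderiv j).slice t)
    rw [← integral_finsetSum _ fun j _ => i3 j]
    have i23 := i2.sub (integrable_finsetSum Finset.univ fun j _ => i3 j)
    rw [← integral_sub i2 (integrable_finsetSum Finset.univ fun j _ => i3 j)]
    have := integral_add i1 i23
    simp only [Pi.sub_apply] at this
    rw [← this]
    refine integral_congr_ae (ae_of_all _ fun x => ?_)
    simp only
    ring
  · have hae : ∀ᵐ ξ : Sp N, ∀ j, ∫⁻ t, ‖stokesForcing W j (t, ξ)‖ₑ ^ 2 ∂(timeMeasure T) < ⊤ :=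
      ae_all_iff.2 fun j => ae_time_energy_lt_top (hfm j) (hBu j)
    filter_upwards [ae_mem_timeInterval T] with t ht
    refine isDivFree_of_pairing (fun k => memLp_two_of_weight hs ?_ ?_) (fun k => hup t ht k) ?_
    · exact ((stronglyMeasurable_heatSol T (Lp.stronglyMeasurable _) (hfm k)).comp_measurable
        (measurable_const.prodMk measurable_id)).aestronglyMeasurable
    · exact lt_of_le_of_lt ((hbu k).1 t ht) hMu
    · filter_upwards [hdiv.sum_fourier_eq_zero, hae] with ξ h0 h1
      rw [sum_mul_heatSol (fun j => memLp_time_slice (hfm j) (h1 j)) (fun j => (ξ j : ℂ)) t, h0]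
      have : (fun s => ∑ j, (ξ j : ℂ) * stokesForcing W j (s, ξ)) = fun _ => 0 :=
        funext fun s => sum_coord_mul_stokesForcing W (s, ξ)
      rw [this]
      simp [duhamel]
  · intro i φ hφ
    have h := hφ.smooth
    have hQ := h.tderiv.add h.xlap
    refine Eq.trans ?_ (hdw i φ hφ)
    congr 1
    have e : ∫ t, (∫ ξ, V i (t, ξ) * sliceF φ t ξ).re ∂(timeMeasure T) =
        ∫ t, (∫ x, g t x i * φ (t, x)) ∂(timeMeasure T) := by
      refine integral_congr_ae ?_
      filter_upwards [hVt] with t ht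
      have h1 := congrArg Complex.re (integral_coord_mul i (g t) (h.slice t))
      rw [Complex.ofReal_re] at h1
      rw [h1]
      congr 1
      refine integral_congr_ae ?_
      filter_upwards [ht i] with ξ hξ
      rw [hξ, h.sliceF_eq]
    rw [e, ← integral_add (integrable_pairing_coord hdL i hQ) (integrable_pairing_coord hgL i h)]
    refine integral_congr_ae (ae_of_all _ fun t => ?_)
    exact integral_add (integrable_coord_mul i (d t) (hQ.slice t))
      (integrable_coord_mul i (g t) (h.slice t))

end Existence

/-! ### Uniqueness for a bounded linear evolution equation -/

section WeakODE

/-- Bump functions at the origin whose supports shrink, with comparable inner and outer radii. -/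
def shrinkingBump (E : Type*) [NormedAddCommGroup E] [NormedSpace ℝ E] (n : ℕ) :
    ContDiffBump (0 : E) where
  rIn := 1 / (2 * (n + 1))
  rOut := 1 / (n + 1)
  rIn_pos := by positivity
  rIn_lt_rOut := by
    have : (0 : ℝ) < n + 1 := by positivity
    exact one_div_lt_one_div_of_lt this (by linarith)

theorem shrinkingBump_rOut (E : Type*) [NormedAddCommGroup E] [NormedSpace ℝ E] (n : ℕ) :
    (shrinkingBump E n).rOut = 1 / ((n : ℝ) + 1) := rfl

theorem tendsto_rOut_shrinkingBump (E : Type*) [NormedAddCommGroup E] [NormedSpace ℝ E] :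
    Tendsto (fun n => (shrinkingBump E n).rOut) atTop (𝓝 0) :=
  tendsto_one_div_add_atTop_nhds_zero_nat

theorem rOut_le_rIn_shrinkingBump (E : Type*) [NormedAddCommGroup E] [NormedSpace ℝ E] (n : ℕ) :
    (shrinkingBump E n).rOut ≤ 2 * (shrinkingBump E n).rIn := by
  refine le_of_eq ?_
  change 1 / ((n : ℝ) + 1) = 2 * (1 / (2 * ((n : ℝ) + 1)))
  field_simp

/-- Test functions in time on `[0, T)`: they need not vanish at the initial time. -/
def IsTimeTest (T : EReal) (θ : ℝ → ℝ) : Prop :=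
  ContDiff ℝ ∞ θ ∧ HasCompactSupport θ ∧ ∀ t ∈ tsupport θ, (t : EReal) < T

theorem IsTimeTest.integrable_smul {T : EReal} {θ : ℝ → ℝ} (hθ : IsTimeTest T θ) {H : Type*}
    [NormedAddCommGroup H] [NormedSpace ℝ H] {z : ℝ → H} (hz : MemLp z 2 (timeMeasure T)) :
    Integrable (fun t => θ t • z t) (timeMeasure T) := by
  have hθL : MemLp θ 2 (timeMeasure T) := hθ.1.continuous.memLp_of_hasCompactSupport hθ.2.1
  exact memLp_one_iff_integrable.1 (hz.smul hθL)

theorem IsTimeTest.integrable_deriv_smul {T : EReal} {θ : ℝ → ℝ} (hθ : IsTimeTest T θ) {H : Type*}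
    [NormedAddCommGroup H] [NormedSpace ℝ H] {z : ℝ → H} (hz : MemLp z 2 (timeMeasure T)) :
    Integrable (fun t => deriv θ t • z t) (timeMeasure T) := by
  have hθL : MemLp (deriv θ) 2 (timeMeasure T) :=
    (hθ.1.continuous_deriv (by exact_mod_cast le_top)).memLp_of_hasCompactSupport hθ.2.1.deriv
  exact memLp_one_iff_integrable.1 (hz.smul hθL)

/-- Uniqueness for the weak form of `z' = -Λ z`, `z(0) = 0`, with `Λ` bounded: the mollifications
in time of `z`, extended by zero to negative times, solve the equation classically. -/
theorem ae_eq_zero_of_weak_ode {H : Type*} [NormedAddCommGroup H] [NormedSpace ℝ H]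
    [CompleteSpace H] {T : EReal} {z : ℝ → H} (hz : MemLp z 2 (timeMeasure T)) (Λ : H →L[ℝ] H)
    (h : ∀ θ, IsTimeTest T θ → ∫ t, deriv θ t • z t ∂(timeMeasure T) =
      Λ (∫ t, θ t • z t ∂(timeMeasure T))) :
    ∀ᵐ t ∂(timeMeasure T), z t = 0 := by
  set Z : ℝ → H := (timeInterval T).indicator z with hZ
  have hZL : MemLp Z 2 volume := (memLp_indicator_iff_restrict (measurableSet_timeInterval T)).2 hz
  have hZloc : LocallyIntegrable Z volume := hZL.locallyIntegrable (by norm_num)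
  have hint : ∀ c : ℝ → ℝ, ∫ s, c s • Z s = ∫ s, c s • z s ∂(timeMeasure T) := by
    intro c
    unfold timeMeasure
    rw [← integral_indicator (measurableSet_timeInterval T)]
    refine integral_congr_ae (ae_of_all _ fun s => ?_)
    by_cases hs : s ∈ timeInterval T <;> simp [Z, hs]
  set ρ : ℕ → ℝ → ℝ := fun n => (shrinkingBump ℝ n).normed volume with hρ
  have hρs : ∀ n, ContDiff ℝ ∞ (ρ n) := fun n => (shrinkingBump ℝ n).contDiff_normed
  have hρc : ∀ n, HasCompactSupport (ρ n) := fun n => (shrinkingBump ℝ n).hasCompactSupport_normed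
  have hρt : ∀ n, tsupport (ρ n) = Metric.closedBall 0 (1 / ((n : ℝ) + 1)) := fun n =>
    (shrinkingBump ℝ n).tsupport_normed_eq
  set f : ℕ → ℝ → H := fun n => convolution (ρ n) Z (ContinuousLinearMap.lsmul ℝ ℝ) volume with hf
  have hfx : ∀ n x, f n x = ∫ s, ρ n (x - s) • Z s := fun n x => by
    simp only [hf, convolution_eq_swap, ContinuousLinearMap.lsmul_apply]
  -- the test function `s ↦ ρ n (x - s)` is admissible also for `x` near or below zero, because
  -- test functions need not vanish at the initial time
  have hder : ∀ (n : ℕ) (x : ℝ), (x : EReal) + ((1 / ((n : ℝ) + 1) : ℝ) : EReal) < T →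
      HasDerivAt (f n) (-Λ (f n x)) x := by
    intro n x hx
    have h1 := (hρc n).hasDerivAt_convolution_left (ContinuousLinearMap.lsmul ℝ ℝ)
      ((hρs n).of_le (by exact_mod_cast le_top)) hZloc x
    have h2 : IsTimeTest T fun s => ρ n (x - s) := by
      refine ⟨(hρs n).comp (contDiff_const.sub contDiff_id),
        (hρc n).comp_homeomorph (Homeomorph.subLeft x), fun t ht => ?_⟩
      have h3 : x - t ∈ tsupport (ρ n) :=
        tsupport_comp_subset_preimage (ρ n) (f := fun s => x - s) (by fun_prop) ht
      rw [hρt, mem_closedBall_zero_iff, Real.norm_eq_abs] at h3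
      have h4 : t ≤ x + 1 / ((n : ℝ) + 1) := by linarith [neg_abs_le (x - t)]
      refine lt_of_le_of_lt ?_ hx
      rw [← EReal.coe_add]
      exact EReal.coe_le_coe_iff.2 h4
    have h5 : ∀ s, deriv (fun s => ρ n (x - s)) s = - deriv (ρ n) (x - s) := fun s =>
      deriv_comp_const_sub (ρ n) x s
    have h6 := h _ h2
    rw [← hint, ← hint, ← hfx] at h6
    simp_rw [h5, neg_smul] at h6
    rw [integral_neg] at h6
    convert h1 using 1
    rw [← h6, neg_neg, convolution_eq_swap]
    rfl
  have hzero : ∀ (n : ℕ) (x : ℝ), x ≤ -1 → f n x = 0 := by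
    intro n x hx
    rw [hfx]
    refine integral_eq_zero_of_ae (ae_of_all _ fun s => ?_)
    by_cases hs : s ∈ timeInterval T
    · have h0 : ρ n (x - s) = 0 := by
        refine image_eq_zero_of_notMem_tsupport ?_
        rw [hρt, mem_closedBall_zero_iff, Real.norm_eq_abs, not_le]
        have h1 : (1 : ℝ) / ((n : ℝ) + 1) ≤ 1 := by
          rw [div_le_one (by positivity)]
          have : (0 : ℝ) ≤ n := n.cast_nonneg
          linarith
        have h2 : 0 < s := hs.1
        have := neg_abs_le (x - s)
        linarith
      simp [h0]
    · simp [Z, hs]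
  have hvanish : ∀ (n : ℕ) (x : ℝ), 0 < x → (x : EReal) + ((1 / ((n : ℝ) + 1) : ℝ) : EReal) < T →
      f n x = 0 := by
    intro n x hx0 hx
    have hd : ∀ t ≤ x, HasDerivAt (f n) (-Λ (f n t)) t := fun t ht =>
      hder n t (lt_of_le_of_lt (add_le_add (EReal.coe_le_coe_iff.2 ht) le_rfl) hx)
    have hlip : ∀ _t : ℝ, LipschitzWith ‖-Λ‖₊ fun v : H => -Λ v := fun _ => (-Λ).lipschitz
    have := ODE_solution_unique (f := f n) (g := fun _ => 0) (a := -1) (b := x)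
      (v := fun _ v => -Λ v) hlip
      (fun t ht => (hd t ht.2).continuousAt.continuousWithinAt)
      (fun t ht => (hd t ht.2.le).hasDerivWithinAt) continuousOn_const
      (fun t _ => by simpa using hasDerivWithinAt_const t _ (0 : H)) (hzero n _ le_rfl)
    exact this ⟨by linarith, le_rfl⟩
  have hconv := ContDiffBump.ae_convolution_tendsto_right_of_locallyIntegrable
    (φ := shrinkingBump ℝ) (tendsto_rOut_shrinkingBump ℝ)
    (Eventually.of_forall (rOut_le_rIn_shrinkingBump ℝ)) hZloc
  filter_upwards [ae_mem_timeInterval T, ae_restrict_of_ae hconv] with t ht htc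
  have hev : ∀ᶠ n : ℕ in atTop, f n t = 0 := by
    obtain ⟨b, hb1, hb2⟩ := EReal.lt_iff_exists_real_btwn.1 ht.2
    have hb : 0 < b - t := sub_pos.2 (EReal.coe_lt_coe_iff.1 hb1)
    have := (tendsto_rOut_shrinkingBump ℝ).eventually (gt_mem_nhds hb)
    filter_upwards [this] with n hn
    refine hvanish n t ht.1 (lt_trans ?_ hb2)
    rw [← EReal.coe_add]
    refine EReal.coe_lt_coe_iff.2 ?_
    rw [shrinkingBump_rOut] at hn
    linarith
  have h0 : Tendsto (fun n => f n t) atTop (𝓝 0) :=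
    tendsto_const_nhds.congr' (hev.mono fun n hn => hn.symm)
  have := tendsto_nhds_unique htc h0
  rwa [hZ, indicator_of_mem ht] at this

end WeakODE

/-! ### Uniqueness for the heat equation on the frequency side -/

section FrequencyODE

/-- The pairing with a Schwartz function, as a continuous functional on `L²`. -/
theorem pairing_exists_clm (ζ : 𝓢(Sp N, ℂ)) :
    ∃ ℓ : L2 N ℂ →L[ℂ] ℂ, ∀ f, ℓ f = ∫ ξ, f ξ * ζ ξ := by
  set g : L2 N ℂ := (SchwartzMap.memLp ζ 2 volume).toLp ζ with hg
  refine ⟨innerSL ℂ (star g), fun f => ?_⟩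
  rw [innerSL_apply_apply, L2.inner_def]
  refine integral_congr_ae ?_
  filter_upwards [(SchwartzMap.memLp ζ 2 volume).coeFn_toLp, Lp.coeFn_star g] with ξ h1 h2
  rw [h2, Pi.star_apply, hg, h1]
  simp

/-- A continuous symbol that is cut off outside a ball is a bounded multiplier. -/
theorem memLp_cutoff {m : Sp N → ℂ} (hm : Continuous m) (n : ℕ) :
    MemLp ((Metric.ball (0 : Sp N) n).indicator m) ⊤ volume := by
  obtain ⟨C, hC⟩ := (isCompact_closedBall (0 : Sp N) n).exists_bound_of_continuousOn
    hm.continuousOn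
  refine memLp_top_of_le (hm.measurable.indicator measurableSet_ball) (C := max C 0) fun ξ => ?_
  by_cases h : ξ ∈ Metric.ball (0 : Sp N) n
  · rw [indicator_of_mem h]
    exact (hC ξ (Metric.ball_subset_closedBall h)).trans (le_max_left _ _)
  · rw [indicator_of_notMem h, norm_zero]
    exact le_max_right _ _

/-- Uniqueness on the frequency side: the weak form of `∂ₜz = -|2πξ|² z`, `z(0) = 0`. The weight
`1 + |2πξ|²` is harmless for test functions, and allows for `z` to arise from an `L²` field by
multiplication with a symbol of second order. -/
theorem ae_eq_zero_of_weak_freq {T : EReal} {z : ℝ → L2 N ℂ} (hz : MemLp z 2 (timeMeasure T))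
    (h : ∀ θ, IsTimeTest T θ → ∀ (η : Sp N → ℝ) (hη : IsTest η),
      ∫ t, (∫ ξ, z t ξ * ((1 + freq ξ : ℂ) * (deriv θ t - freq ξ * θ t) *
        (𝓕⁻ hη.schwartz) ξ)) ∂(timeMeasure T) = 0) :
    ∀ᵐ t ∂(timeMeasure T), z t = 0 := by
  have hcf := continuous_freq (N := N)
  -- the equation holds pointwise in frequency after integration against `θ`, since the test
  -- functions in space determine tempered functions
  have key : ∀ θ, IsTimeTest T θ → ∀ᵐ ξ,
      (∫ t, deriv θ t • z t ∂(timeMeasure T) : L2 N ℂ) ξ =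
        (freq ξ : ℂ) * (∫ t, θ t • z t ∂(timeMeasure T) : L2 N ℂ) ξ := by
    intro θ hθ
    have i0 := hθ.integrable_smul hz
    have i1 := hθ.integrable_deriv_smul hz
    set A : L2 N ℂ := ∫ t, deriv θ t • z t ∂(timeMeasure T) with hA
    set B : L2 N ℂ := ∫ t, θ t • z t ∂(timeMeasure T) with hB
    have hw : ∀ {G : Sp N → ℂ}, Tempered G → Tempered fun ξ => (freq ξ : ℂ) * G ξ := by
      intro G hG
      refine hG.mul (C := (2 * Real.pi) ^ 2) (m := 1) ?_ fun ξ => ?_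
      · exact (by fun_prop : Continuous fun ξ : Sp N => (freq ξ : ℂ)).aestronglyMeasurable
      · rw [Complex.norm_real, Real.norm_of_nonneg (freq_nonneg ξ)]
        unfold freq
        rw [mul_pow]
        gcongr
        linarith
    have hG : Tempered fun ξ => (A ξ - freq ξ * B ξ) + freq ξ * (A ξ - freq ξ * B ξ) :=
      ((tempered_coe A).sub (hw (tempered_coe B))).add
        (hw ((tempered_coe A).sub (hw (tempered_coe B))))
    have h0 := hG.ae_eq_zero fun η hη => by
      have t1 := hη.laplacian
      have t2 := hη.laplacian.laplacian
      obtain ⟨ℓ0, hℓ0⟩ := pairing_exists_clm (𝓕⁻ hη.schwartz)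
      obtain ⟨ℓ1, hℓ1⟩ := pairing_exists_clm (𝓕⁻ t1.schwartz)
      obtain ⟨ℓ2, hℓ2⟩ := pairing_exists_clm (𝓕⁻ t2.schwartz)
      have e : ∀ (a b : L2 N ℂ) (p q : ℂ), ∫ ξ, ((p * a ξ - freq ξ * (q * b ξ)) +
          freq ξ * (p * a ξ - freq ξ * (q * b ξ))) * (𝓕⁻ hη.schwartz) ξ =
          p * (ℓ0 - ℓ1) a + q * (ℓ1 - ℓ2) b := by
        intro a b p q
        simp only [_root_.sub_apply, hℓ0, hℓ1, hℓ2]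
        have j := fun (f : L2 N ℂ) (ζ : 𝓢(Sp N, ℂ)) => (tempered_coe f).integrable_mul ζ
        have hadd := integral_add
          (((j a (𝓕⁻ hη.schwartz)).sub (j a (𝓕⁻ t1.schwartz))).const_mul p)
          (((j b (𝓕⁻ t1.schwartz)).sub (j b (𝓕⁻ t2.schwartz))).const_mul q)
        simp only [Pi.sub_apply] at hadd
        rw [← integral_sub (j _ _) (j _ _), ← integral_sub (j _ _) (j _ _), ← integral_const_mul,
          ← integral_const_mul, ← hadd]
        refine integral_congr_ae (ae_of_all _ fun ξ => ?_)
        simp only [hη.laplacian.fourierInv_laplacian, hη.fourierInv_laplacian]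
        ring
      have e1 := e A B 1 1
      simp only [one_mul] at e1
      rw [e1, hA, hB, ← ContinuousLinearMap.integral_comp_comm _ i1,
        ← ContinuousLinearMap.integral_comp_comm _ i0,
        ← integral_add ((ℓ0 - ℓ1).integrable_comp i1) ((ℓ1 - ℓ2).integrable_comp i0),
        ← h θ hθ η hη]
      refine integral_congr_ae (ae_of_all _ fun t => ?_)
      have s1 : (ℓ0 - ℓ1) (deriv θ t • z t) = ((deriv θ t : ℝ) : ℂ) * (ℓ0 - ℓ1) (z t) := by
        rw [ContinuousLinearMap.map_smul_of_tower, Complex.real_smul]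
      have s2 : (ℓ1 - ℓ2) (θ t • z t) = (θ t : ℂ) * (ℓ1 - ℓ2) (z t) := by
        rw [ContinuousLinearMap.map_smul_of_tower, Complex.real_smul]
      simp only [s1, s2]
      rw [← e]
      refine integral_congr_ae (ae_of_all _ fun ξ => ?_)
      simp only
      ring
    filter_upwards [h0] with ξ hξ
    have h1 : (1 + freq ξ : ℂ) * (A ξ - freq ξ * B ξ) = 0 := by rw [← hξ]; ring
    have h2 : (1 + freq ξ : ℂ) ≠ 0 := by
      exact_mod_cast (add_pos_of_pos_of_nonneg one_pos (freq_nonneg ξ)).ne'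
    exact sub_eq_zero.1 ((mul_eq_zero.1 h1).resolve_left h2)
  -- on frequencies in a ball the symbol `|2πξ|²` is a bounded operator
  have hcut : ∀ n : ℕ, ∀ᵐ t ∂(timeMeasure T),
      mulL _ (memLp_cutoff (N := N) (m := fun _ => 1) continuous_const n) (z t) = 0 := by
    intro n
    set χ := mulL _ (memLp_cutoff (N := N) (m := fun _ => 1) continuous_const n)
    set Λ := mulL _ (memLp_cutoff (N := N) (m := fun ξ => (freq ξ : ℂ)) (by fun_prop) n)
    refine ae_eq_zero_of_weak_ode (χ.comp_memLp' hz) (Λ.restrictScalars ℝ) fun θ hθ => ?_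
    have i0 := hθ.integrable_smul hz
    have i1 := hθ.integrable_deriv_smul hz
    have c0 : ∀ c : ℝ → ℝ, Integrable (fun t => c t • z t) (timeMeasure T) →
        ∫ t, c t • χ (z t) ∂(timeMeasure T) = χ (∫ t, c t • z t ∂(timeMeasure T)) := by
      intro c hc
      rw [← ContinuousLinearMap.integral_comp_comm _ hc]
      refine integral_congr_ae (ae_of_all _ fun t => ?_)
      simp only [ContinuousLinearMap.map_smul_of_tower]
    have c1 := c0 _ i1
    have c2 := c0 _ i0
    rw [c1, c2, ContinuousLinearMap.coe_restrictScalars']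
    refine Lp.ext ?_
    filter_upwards [key θ hθ, coeFn_mulL _ (memLp_cutoff (N := N) (m := fun _ => 1)
        continuous_const n) (∫ t, deriv θ t • z t ∂(timeMeasure T)),
      coeFn_mulL _ (memLp_cutoff (N := N) (m := fun _ => 1)
        continuous_const n) (∫ t, θ t • z t ∂(timeMeasure T)),
      coeFn_mulL _ (memLp_cutoff (N := N) (m := fun ξ => (freq ξ : ℂ)) (by fun_prop) n)
        (χ (∫ t, θ t • z t ∂(timeMeasure T)))] with ξ k1 k2 k3 k4
    rw [k2, k4, k3, k1]
    by_cases hξ : ξ ∈ Metric.ball (0 : Sp N) n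
    · simp [hξ]
    · simp [hξ]
  filter_upwards [ae_all_iff.2 hcut] with t ht
  refine Lp.ext ?_
  have h1 : ∀ᵐ ξ, ∀ n : ℕ, (Metric.ball (0 : Sp N) n).indicator (fun _ => (1 : ℂ)) ξ * z t ξ = 0 := by
    refine ae_all_iff.2 fun n => ?_
    filter_upwards [coeFn_mulL _ (memLp_cutoff (N := N) (m := fun _ => 1) continuous_const n) (z t),
      Lp.coeFn_zero ℂ 2 (volume : Measure (Sp N))] with ξ k1 k2
    rw [← k1, ht n, k2]
    rfl
  filter_upwards [h1, Lp.coeFn_zero ℂ 2 (volume : Measure (Sp N))] with ξ k1 k2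
  obtain ⟨n, hn⟩ := exists_nat_gt ‖ξ‖
  have := k1 n
  rw [indicator_of_mem (by simpa using hn), one_mul] at this
  rw [this, k2]
  rfl

end FrequencyODE

/-! ### Test functions that are products -/

section ProductTests

theorem IsTimeTest.isSpaceTimeTest {T : EReal} {θ : ℝ → ℝ} (hθ : IsTimeTest T θ) {η : Sp N → ℝ}
    (hη : IsTest η) : IsSpaceTimeTest T fun z : ℝ × Sp N => θ z.1 * η z.2 := by
  have hsub : ∀ z : ℝ × Sp N, θ z.1 * η z.2 ≠ 0 → z ∈ tsupport θ ×ˢ tsupport η := fun z hz =>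
    ⟨subset_tsupport _ (left_ne_zero_of_mul hz), subset_tsupport _ (right_ne_zero_of_mul hz)⟩
  have hcl : IsClosed (tsupport θ ×ˢ tsupport η) :=
    (isClosed_tsupport θ).prod (isClosed_tsupport η)
  refine ⟨?_, ?_, fun z hz => ?_⟩
  · exact (hθ.1.comp contDiff_fst).mul (hη.1.comp contDiff_snd)
  · refine HasCompactSupport.intro' (hθ.2.1.isCompact.prod hη.2.isCompact) hcl fun z hz => ?_
    by_contra h
    exact hz (hsub z h)
  · exact hθ.2.2 _ ((closure_minimal hsub hcl) hz).1

theorem tderiv_prod (θ : ℝ → ℝ) (η : Sp N → ℝ) (t : ℝ) (x : Sp N) :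
    tderiv (fun z : ℝ × Sp N => θ z.1 * η z.2) t x = deriv θ t * η x := by
  unfold tderiv
  simp

theorem xderiv_prod (θ : ℝ → ℝ) {η : Sp N → ℝ} (hη : IsTest η) (j : Fin N) (t : ℝ) (x : Sp N) :
    xderiv j (fun z : ℝ × Sp N => θ z.1 * η z.2) t x = θ t * pderiv j η x := by
  unfold xderiv pderiv
  have hd : DifferentiableAt ℝ η x := (hη.1.differentiable (by simp)) x
  simp only
  rw [fderiv_const_mul hd]
  rfl

theorem sliceF_prod (θ : ℝ → ℝ) {η : Sp N → ℝ} (hη : IsTest η) (t : ℝ) (ξ : Sp N) :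
    sliceF (fun z : ℝ × Sp N => θ z.1 * η z.2) t ξ = (θ t : ℂ) * (𝓕⁻ hη.schwartz) ξ := by
  rw [sliceF_eq_integral, SchwartzMap.fourierInv_coe, Real.fourierInv_eq', ← integral_const_mul]
  refine integral_congr_ae (ae_of_all _ fun x => ?_)
  simp only [IsTest.schwartz_apply, smul_eq_mul]
  push_cast
  ring

theorem pderiv_comm {η : Sp N → ℝ} (hη : IsTest η) (i j : Fin N) (x : Sp N) :
    pderiv i (pderiv j η) x = pderiv j (pderiv i η) x := by
  have h0 : ContDiff ℝ 2 η := contDiff_infty.1 hη.1 2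
  have h1 : ∀ v w : Sp N, fderiv ℝ (fun y => fderiv ℝ η y v) x w = fderiv ℝ (fderiv ℝ η) x w v := by
    intro v w
    have hd : DifferentiableAt ℝ (fderiv ℝ η) x :=
      ((h0.fderiv_right (m := 1) (by norm_num)).differentiable (by norm_num)) x
    rw [fderiv_clm_apply hd (differentiableAt_const v)]
    simp
  have h2 : IsSymmSndFDerivAt ℝ η x := h0.contDiffAt.isSymmSndFDerivAt (by simp)
  unfold pderiv
  rw [h1, h1]
  exact h2 _ _

/-- The pairing of a coordinate of an `L²` field with the heat operator applied to a product test
function. -/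
theorem integral_coord_mul_heat_prod (v : L2 N (Sp N)) (k : Fin N) {T : EReal} {θ : ℝ → ℝ}
    (hθ : IsTimeTest T θ) {η : Sp N → ℝ} (hη : IsTest η) (t : ℝ) :
    ((∫ x, v x k * (tderiv (fun z : ℝ × Sp N => θ z.1 * η z.2) t x +
      xlap (fun z : ℝ × Sp N => θ z.1 * η z.2) t x) : ℝ) : ℂ) =
    ∫ ξ, (𝓕 (coordC k v) : L2 N ℂ) ξ *
      (((deriv θ t : ℝ) - (freq ξ : ℂ) * (θ t : ℝ)) * (𝓕⁻ hη.schwartz) ξ) := by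
  have h := (hθ.isSpaceTimeTest hη).smooth
  have hQ := h.tderiv.add h.xlap
  rw [integral_coord_mul k v (hQ.slice t)]
  refine integral_congr_ae (ae_of_all _ fun ξ => ?_)
  simp only
  rw [← hQ.sliceF_eq, h.tderiv.sliceF_add h.xlap, h.sliceF_xlap, sliceF_prod θ hη]
  simp_rw [tderiv_prod]
  rw [sliceF_prod (deriv θ) hη]
  ring

end ProductTests

/-! ### The terms of the weak equations -/

section SplitEquations

/-- A pressure of class `L²((0,T); L²_loc)` can be paired with test functions. -/
theorem integrable_pressure_pairing {T : EReal} {p : ℝ → Sp N → ℝ} (hp : MemL2L2loc T p)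
    {φ : ℝ × Sp N → ℝ} (h : IsSmoothCompact φ) :
    (∀ᵐ t ∂(timeMeasure T), Integrable fun x => p t x * φ (t, x)) ∧
      Integrable (fun t => ∫ x, p t x * φ (t, x)) (timeMeasure T) := by
  set K : Set (Sp N) := Prod.snd '' tsupport φ with hK
  have hKc : IsCompact K := h.2.isCompact.image continuous_snd
  have hzero : ∀ t, ∀ x ∉ K, φ (t, x) = 0 := by
    intro t x hx
    by_contra h0
    exact hx ⟨(t, x), subset_tsupport _ h0, rfl⟩
  obtain ⟨P, hP, hPt⟩ := hp K hKc
  have hfin : IsFiniteMeasure (volume.restrict K : Measure (Sp N)) :=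
    ⟨by simpa using hKc.measure_lt_top⟩
  refine ⟨?_, (integrable_pairing hP h).congr ?_⟩
  · filter_upwards [hPt] with t ht
    have h1 : Integrable (fun x => P t x * φ (t, x)) (volume.restrict K) :=
      (Lp.memLp (P t)).integrable_mul ((h.slice t).memLp 2 _)
    refine (integrableOn_iff_integrable_of_support_subset (s := K) fun x hx => ?_).1
      (h1.congr ?_)
    · by_contra hxK
      exact hx (by simp [hzero t x hxK])
    · filter_upwards [ht] with x hx
      rw [hx]
  · filter_upwards [hPt] with t ht
    rw [← setIntegral_eq_integral_of_forall_compl_eq_zero (s := K) (μ := volume)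
      (fun x hx => by simp [hzero t x hx])]
    refine integral_congr_ae ?_
    filter_upwards [ht] with x hx
    rw [hx]

/-- The three terms of the momentum equation are integrable separately, so that differences of
solutions can be formed. -/
theorem IsSolution.momentum_split {T : EReal} {s : ℝ} (hs : 0 ≤ s) {u₀ d₀ : L2 N (Sp N)}
    {F : ℝ → L2 N (Mat N)} {g u d : ℝ → L2 N (Sp N)} {p : ℝ → Sp N → ℝ}
    (hF : MemLp F 2 (timeMeasure T)) (h : IsSolution T s u₀ d₀ F g u p d) (i : Fin N)
    {φ : ℝ × Sp N → ℝ} (hφ : IsSpaceTimeTest T φ) :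
    (∫ t, (∫ x, u t x i * (tderiv φ t x + xlap φ t x)) ∂(timeMeasure T)) +
      (∫ t, (∫ x, p t x * xderiv i φ t x) ∂(timeMeasure T)) =
      (∫ t, (∑ j, ∫ x, F t x (i, j) * xderiv j φ t x) ∂(timeMeasure T)) -
        ∫ x, u₀ x i * φ (0, x) := by
  have hφs := hφ.smooth
  have hQ := hφs.tderiv.add hφs.xlap
  obtain ⟨p1, p2⟩ := integrable_pressure_pairing h.p_mem (hφs.xderiv i)
  have iu := integrable_pairing_coord (h.u_mem.memLp hs) i hQ
  have iF : ∀ j, Integrable (fun t => ∫ x, F t x (i, j) * xderiv j φ t x) (timeMeasure T) :=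
    fun j => integrable_pairing_coord hF (i, j) (hφs.xderiv j)
  rw [eq_sub_iff_add_eq, ← sub_eq_zero, ← integral_add iu p2]
  refine Eq.trans ?_ (h.momentum i φ hφ)
  rw [add_sub_right_comm]
  congr 1
  have e := integral_sub (iu.add p2) (integrable_finsetSum Finset.univ fun j _ => iF j)
  simp only [Pi.add_apply] at e
  refine e.symm.trans (integral_congr_ae ?_)
  filter_upwards [p1] with t ht
  have i1 := integrable_coord_mul i (u t) (hQ.slice t)
  have i3 := fun j => integrable_coord_mul (i, j) (F t) ((hφs.xderiv j).slice t)
  have e1 := integral_sub (i1.add ht) (integrable_finsetSum Finset.univ fun j _ => i3 j)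
  simp only [Pi.add_apply] at e1
  have e2 := integral_add i1 ht
  simp only at e2
  rw [e1, e2, integral_finsetSum _ fun j _ => i3 j]

theorem IsSolution.heat_split {T : EReal} {s : ℝ} (hs : 0 ≤ s) {u₀ d₀ : L2 N (Sp N)}
    {F : ℝ → L2 N (Mat N)} {g u d : ℝ → L2 N (Sp N)} {p : ℝ → Sp N → ℝ}
    (hg : MemLp g 2 (timeMeasure T)) (h : IsSolution T s u₀ d₀ F g u p d) (i : Fin N)
    {φ : ℝ × Sp N → ℝ} (hφ : IsSpaceTimeTest T φ) :
    ∫ t, (∫ x, d t x i * (tderiv φ t x + xlap φ t x)) ∂(timeMeasure T) =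
      -(∫ t, (∫ x, g t x i * φ (t, x)) ∂(timeMeasure T)) - ∫ x, d₀ x i * φ (0, x) := by
  have hφs := hφ.smooth
  have hQ := hφs.tderiv.add hφs.xlap
  have id := integrable_pairing_coord (h.d_mem.memLp (by linarith)) i hQ
  have ig := integrable_pairing_coord hg i hφs
  have e := h.heat i φ hφ
  have e1 : ∀ t, ∫ x, (d t x i * (tderiv φ t x + xlap φ t x) + g t x i * φ (t, x)) =
      (∫ x, d t x i * (tderiv φ t x + xlap φ t x)) + ∫ x, g t x i * φ (t, x) := fun t =>
    integral_add (integrable_coord_mul i (d t) (hQ.slice t))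
      (integrable_coord_mul i (g t) (hφs.slice t))
  simp_rw [e1] at e
  rw [integral_add id ig] at e
  linarith

theorem integral_pairing_sub {T : EReal} {w w' : ℝ → L2 N (Sp N)} (hw : MemLp w 2 (timeMeasure T))
    (hw' : MemLp w' 2 (timeMeasure T)) (k : Fin N) {φ : ℝ × Sp N → ℝ} (h : IsSmoothCompact φ) :
    ∫ t, (∫ x, (w' - w) t x k * φ (t, x)) ∂(timeMeasure T) =
      (∫ t, (∫ x, w' t x k * φ (t, x)) ∂(timeMeasure T)) -
        ∫ t, (∫ x, w t x k * φ (t, x)) ∂(timeMeasure T) := by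
  rw [← integral_sub (integrable_pairing_coord hw' k h) (integrable_pairing_coord hw k h)]
  refine integral_congr_ae (ae_of_all _ fun t => ?_)
  simp only
  rw [← integral_sub (integrable_coord_mul k (w' t) (h.slice t))
    (integrable_coord_mul k (w t) (h.slice t))]
  refine integral_congr_ae ?_
  filter_upwards [Lp.coeFn_sub (w' t) (w t)] with x hx
  rw [Pi.sub_apply, hx, Pi.sub_apply, PiLp.sub_apply, sub_mul]

end SplitEquations

/-! ### Uniqueness for the heat equation and for the velocity -/

section VelocityUniqueness

theorem eq_zero_of_fourier_eq_zero {f : L2 N (Sp N)}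
    (h : ∀ k, ∀ᵐ ξ, (𝓕 (coordC k f) : L2 N ℂ) ξ = 0) : f = 0 := by
  have h1 : ‖f‖ₑ ^ 2 = 0 := by
    rw [enorm_sq_eq_sum]
    refine Finset.sum_eq_zero fun k _ => ?_
    rw [← lintegral_fourier_eq]
    rw [lintegral_congr_ae (g := fun _ => 0) ?_, lintegral_zero]
    filter_upwards [h k] with ξ hξ
    simp [hξ]
  simpa using h1

/-- The symbols of order at most two, divided by `1 + |2πξ|²`, are bounded. -/
theorem memLp_div_one_add_freq {m : Sp N → ℂ} (hm : Continuous m) (h : ∀ ξ, ‖m ξ‖ ≤ 1 + ‖ξ‖ ^ 2) :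
    MemLp (fun ξ => m ξ / (1 + freq ξ : ℂ)) ⊤ volume := by
  have hcf := continuous_freq (N := N)
  refine memLp_top_of_le (C := 1) (by fun_prop) fun ξ => ?_
  have h0 : 0 < 1 + freq ξ := by linarith [freq_nonneg ξ]
  have h1 : ‖(1 + freq ξ : ℂ)‖ = 1 + freq ξ := by
    rw [← Complex.ofReal_one, ← Complex.ofReal_add, Complex.norm_real, Real.norm_of_nonneg h0.le]
  rw [norm_div, h1, div_le_one h0]
  refine (h ξ).trans ?_
  have : ‖ξ‖ ^ 2 ≤ freq ξ := by
    unfold freq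
    have h3 : 1 ≤ 2 * Real.pi := by linarith [Real.pi_gt_three]
    exact pow_le_pow_left₀ (norm_nonneg _) (le_mul_of_one_le_left (norm_nonneg _) h3) 2
  linarith

theorem one_add_freq_ne_zero (ξ : Sp N) : (1 + freq ξ : ℂ) ≠ 0 := by
  exact_mod_cast (add_pos_of_pos_of_nonneg one_pos (freq_nonneg ξ)).ne'

/-- Uniqueness for the weak heat equation in the class `L²((0,T); L²)`. -/
theorem ae_eq_zero_of_weak_heat {T : EReal} {e : ℝ → L2 N (Sp N)} (he : MemLp e 2 (timeMeasure T))
    (h : ∀ i (φ : ℝ × Sp N → ℝ), IsSpaceTimeTest T φ →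
      ∫ t, (∫ x, e t x i * (tderiv φ t x + xlap φ t x)) ∂(timeMeasure T) = 0) :
    ∀ᵐ t ∂(timeMeasure T), e t = 0 := by
  -- the weight of the frequency equation is compensated by dividing by `1 + |2πξ|²`
  have hm := memLp_div_one_add_freq (N := N) (m := fun _ => 1) continuous_const
    (fun ξ => by simp)
  have hz : ∀ i : Fin N, ∀ᵐ t ∂(timeMeasure T), mulL _ hm (𝓕 (coordC i (e t))) = 0 := by
    intro i
    refine ae_eq_zero_of_weak_freq ((mulL _ hm).comp_memLp' (memLp_fourier (memLp_coordC he i)))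
      fun θ hθ η hη => ?_
    have h1 := h i _ (hθ.isSpaceTimeTest hη)
    have h2 := congrArg (fun r : ℝ => (r : ℂ)) h1
    simp only [← integral_complex_ofReal, Complex.ofReal_zero] at h2
    rw [← h2]
    refine integral_congr_ae (ae_of_all _ fun t => ?_)
    simp only
    rw [integral_complex_ofReal, integral_coord_mul_heat_prod (e t) i hθ hη t]
    refine integral_congr_ae ?_
    filter_upwards [coeFn_mulL _ hm (𝓕 (coordC i (e t)))] with ξ hξ
    rw [hξ]
    have := one_add_freq_ne_zero ξ
    field_simp
  filter_upwards [ae_all_iff.2 hz] with t ht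
  refine eq_zero_of_fourier_eq_zero fun i => ?_
  filter_upwards [coeFn_mulL _ hm (𝓕 (coordC i (e t))), Lp.coeFn_zero ℂ 2 (volume : Measure (Sp N))]
    with ξ k1 k2
  rw [ht i, k2] at k1
  have := one_add_freq_ne_zero ξ
  simpa [this] using k1.symm

theorem norm_coord_le_one_add_sq (ξ : Sp N) (j : Fin N) : ‖(ξ j : ℂ)‖ ≤ 1 + ‖ξ‖ ^ 2 := by
  have := norm_coord_le ξ j
  nlinarith [sq_nonneg (‖ξ‖ - 1)]

/-- A divergence-free field whose curl vanishes, on the frequency side, is zero. -/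
theorem eq_zero_of_curl_of_div {w : L2 N (Sp N)}
    (hc : ∀ i j, ∀ᵐ ξ : Sp N, (ξ j : ℂ) * (𝓕 (coordC i w) : L2 N ℂ) ξ -
      (ξ i : ℂ) * (𝓕 (coordC j w) : L2 N ℂ) ξ = 0)
    (hd : ∀ᵐ ξ : Sp N, ∑ j, (ξ j : ℂ) * (𝓕 (coordC j w) : L2 N ℂ) ξ = 0)
    (hN : 0 < N) : w = 0 := by
  have : Nonempty (Fin N) := ⟨⟨0, hN⟩⟩
  have : Nontrivial (Sp N) := by
    refine ⟨⟨EuclideanSpace.single ⟨0, hN⟩ 1, 0, fun h => ?_⟩⟩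
    have := congrArg norm h
    simp at this
  have hne : ∀ᵐ ξ : Sp N, ξ ≠ 0 := by simp [ae_iff]
  refine eq_zero_of_fourier_eq_zero fun i => ?_
  filter_upwards [hne, hd, ae_all_iff.2 (hc i)] with ξ h0 h1 h2
  -- `|ξ|² ŵ_i = ∑ ξ_j (ξ_j ŵ_i - ξ_i ŵ_j) + ξ_i ∑ ξ_j ŵ_j`
  have h3 : ((‖ξ‖ ^ 2 : ℝ) : ℂ) * (𝓕 (coordC i w) : L2 N ℂ) ξ =
      ∑ j, (ξ j : ℂ) * ((ξ j : ℂ) * (𝓕 (coordC i w) : L2 N ℂ) ξ -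
        (ξ i : ℂ) * (𝓕 (coordC j w) : L2 N ℂ) ξ) +
      (ξ i : ℂ) * ∑ j, (ξ j : ℂ) * (𝓕 (coordC j w) : L2 N ℂ) ξ := by
    rw [← sum_sq_coord, Finset.sum_mul, Finset.mul_sum, ← Finset.sum_add_distrib]
    exact Finset.sum_congr rfl fun j _ => by ring
  simp only [h2, h1, mul_zero, Finset.sum_const_zero, add_zero] at h3
  refine (mul_eq_zero.1 h3).resolve_left ?_
  exact_mod_cast pow_ne_zero 2 (norm_ne_zero_iff.2 h0)

/-- Uniqueness of the velocity: testing the `i`-th equation with `∂_j` and the `j`-th with `∂_i`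
of a product test function eliminates the pressure. -/
theorem ae_eq_zero_of_weak_curl {T : EReal} (hN : 0 < N) {w : ℝ → L2 N (Sp N)}
    (hw : MemLp w 2 (timeMeasure T))
    (hd : ∀ᵐ t ∂(timeMeasure T), ∀ᵐ ξ : Sp N,
      ∑ j, (ξ j : ℂ) * (𝓕 (coordC j (w t)) : L2 N ℂ) ξ = 0)
    (h : ∀ i j θ (η : Sp N → ℝ), IsTimeTest T θ → IsTest η →
      ∫ t, (∫ x, w t x i * (tderiv (fun z : ℝ × Sp N => θ z.1 * pderiv j η z.2) t x +
        xlap (fun z : ℝ × Sp N => θ z.1 * pderiv j η z.2) t x)) ∂(timeMeasure T) =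
      ∫ t, (∫ x, w t x j * (tderiv (fun z : ℝ × Sp N => θ z.1 * pderiv i η z.2) t x +
        xlap (fun z : ℝ × Sp N => θ z.1 * pderiv i η z.2) t x)) ∂(timeMeasure T)) :
    ∀ᵐ t ∂(timeMeasure T), w t = 0 := by
  have hm : ∀ j : Fin N, MemLp (fun ξ : Sp N => (ξ j : ℂ) / (1 + freq ξ : ℂ)) ⊤ volume := fun j =>
    memLp_div_one_add_freq (by fun_prop) fun ξ => norm_coord_le_one_add_sq ξ j
  have hwF := fun i => memLp_fourier (memLp_coordC hw i)
  -- the components of the curl, divided by `1 + |2πξ|²` to be in `L²`, solve the heat equation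
  have hz : ∀ i j : Fin N, ∀ᵐ t ∂(timeMeasure T),
      mulL _ (hm j) (𝓕 (coordC i (w t))) - mulL _ (hm i) (𝓕 (coordC j (w t))) = 0 := by
    intro i j
    refine ae_eq_zero_of_weak_freq (((mulL _ (hm j)).comp_memLp' (hwF i)).sub
      ((mulL _ (hm i)).comp_memLp' (hwF j))) fun θ hθ η hη => ?_
    have s1 := (hθ.isSpaceTimeTest (hη.pderiv j)).smooth
    have s2 := (hθ.isSpaceTimeTest (hη.pderiv i)).smooth
    have h1 := h i j θ η hθ hη
    rw [← sub_eq_zero, ← integral_sub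
      (integrable_pairing_coord hw i (s1.tderiv.add s1.xlap))
      (integrable_pairing_coord hw j (s2.tderiv.add s2.xlap))] at h1
    have h2 := congrArg (fun r : ℝ => (r : ℂ)) h1
    simp only [← integral_complex_ofReal, Complex.ofReal_zero] at h2
    have h3 : -(2 * Real.pi * Complex.I : ℂ) * ∫ t, (∫ ξ,
        (mulL _ (hm j) (𝓕 (coordC i (w t))) - mulL _ (hm i) (𝓕 (coordC j (w t))) : L2 N ℂ) ξ *
        ((1 + freq ξ : ℂ) * (((deriv θ t : ℝ) : ℂ) - freq ξ * θ t) * (𝓕⁻ hη.schwartz) ξ))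
          ∂(timeMeasure T) = 0 := by
      rw [← h2, ← integral_const_mul]
      refine integral_congr_ae (ae_of_all _ fun t => ?_)
      simp only
      rw [Complex.ofReal_sub, integral_coord_mul_heat_prod (w t) i hθ (hη.pderiv j) t,
        integral_coord_mul_heat_prod (w t) j hθ (hη.pderiv i) t]
      have int : ∀ k l : Fin N, Integrable fun ξ : Sp N => (𝓕 (coordC k (w t)) : L2 N ℂ) ξ *
          (((deriv θ t : ℝ) - (freq ξ : ℂ) * (θ t : ℝ)) * (𝓕⁻ (hη.pderiv l).schwartz) ξ) := by
        intro k l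
        have j1 := (tempered_coe (𝓕 (coordC k (w t)) : L2 N ℂ)).integrable_mul
          (𝓕⁻ (hη.pderiv l).schwartz)
        have j2 := (tempered_coe (𝓕 (coordC k (w t)) : L2 N ℂ)).integrable_mul
          (𝓕⁻ (hη.pderiv l).laplacian.schwartz)
        refine ((j1.const_mul ((deriv θ t : ℝ) : ℂ)).add (j2.const_mul (θ t : ℂ))).congr
          (ae_of_all _ fun ξ => ?_)
        simp only [Pi.add_apply, (hη.pderiv l).fourierInv_laplacian]
        ring
      rw [← integral_sub (int i j) (int j i), ← integral_const_mul]
      refine integral_congr_ae ?_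
      filter_upwards [coeFn_mulL _ (hm j) (𝓕 (coordC i (w t))),
        coeFn_mulL _ (hm i) (𝓕 (coordC j (w t))),
        Lp.coeFn_sub (mulL _ (hm j) (𝓕 (coordC i (w t)))) (mulL _ (hm i) (𝓕 (coordC j (w t))))]
        with ξ k1 k2 k3
      rw [k3, Pi.sub_apply, k1, k2, hη.fourierInv_pderiv, hη.fourierInv_pderiv]
      have := one_add_freq_ne_zero ξ
      field_simp
      ring
    refine (mul_eq_zero.1 h3).resolve_left ?_
    simp [Real.pi_ne_zero]
  filter_upwards [ae_all_iff.2 fun i => ae_all_iff.2 (hz i), hd] with t ht hdt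
  refine eq_zero_of_curl_of_div (fun i j => ?_) hdt hN
  filter_upwards [coeFn_mulL _ (hm j) (𝓕 (coordC i (w t))),
    coeFn_mulL _ (hm i) (𝓕 (coordC j (w t))),
    Lp.coeFn_sub (mulL _ (hm j) (𝓕 (coordC i (w t)))) (mulL _ (hm i) (𝓕 (coordC j (w t)))),
    Lp.coeFn_zero ℂ 2 (volume : Measure (Sp N))] with ξ k1 k2 k3 k4
  rw [ht i j, k4, Pi.sub_apply, k1, k2] at k3
  have h0 := one_add_freq_ne_zero ξ
  have h1 : ((ξ j : ℂ) * (𝓕 (coordC i (w t)) : L2 N ℂ) ξ -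
      (ξ i : ℂ) * (𝓕 (coordC j (w t)) : L2 N ℂ) ξ) / (1 + freq ξ : ℂ) = 0 := by
    refine Eq.trans ?_ k3.symm
    ring
  exact (div_eq_zero_iff.1 h1).resolve_right h0

end VelocityUniqueness

/-! ### Uniqueness of the pressure -/

section PressureUniqueness

/-- The test functions used to mollify the pressure at the point `y`. -/
def mollifierTest (n : ℕ) (y x : Sp N) : ℝ := (shrinkingBump (Sp N) n).normed volume (y - x)

theorem isTest_mollifierTest (n : ℕ) (y : Sp N) : IsTest (mollifierTest n y) :=
  ⟨(shrinkingBump (Sp N) n).contDiff_normed.comp (contDiff_const.sub contDiff_id),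
    (shrinkingBump (Sp N) n).hasCompactSupport_normed.comp_homeomorph (Homeomorph.subLeft y)⟩

theorem pderiv_mollifierTest (n : ℕ) (y x : Sp N) (i : Fin N) :
    pderiv i (mollifierTest n y) x =
      - fderiv ℝ ((shrinkingBump (Sp N) n).normed volume) (y - x) (EuclideanSpace.single i 1) := by
  unfold pderiv mollifierTest
  have h1 : DifferentiableAt ℝ ((shrinkingBump (Sp N) n).normed volume) (y - x) :=
    (((shrinkingBump (Sp N) n).contDiff_normed (n := 1)).differentiable (by norm_num)) _
  have h2 := h1.hasFDerivAt.comp x ((hasFDerivAt_id x).const_sub y)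
  have h3 : fderiv ℝ (fun x => (shrinkingBump (Sp N) n).normed volume (y - x)) x = _ := h2.fderiv
  rw [h3]
  simp

/-- A locally integrable function whose distributional gradient vanishes is constant. It suffices
to test against countably many mollifiers. -/
theorem ae_eq_const_of_gradient {q : Sp N → ℝ} (hq : LocallyIntegrable q volume)
    (h : ∀ (n k : ℕ) (i : Fin N),
      ∫ x, q x * pderiv i (mollifierTest n (TopologicalSpace.denseSeq (Sp N) k)) x = 0) :
    ∃ c, ∀ᵐ x, q x = c := by
  set ρ : ℕ → Sp N → ℝ := fun n => (shrinkingBump (Sp N) n).normed volume with hρ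
  have hρs : ∀ n, ContDiff ℝ 1 (ρ n) := fun n => (shrinkingBump (Sp N) n).contDiff_normed
  have hρc : ∀ n, HasCompactSupport (ρ n) := fun n =>
    (shrinkingBump (Sp N) n).hasCompactSupport_normed
  set L := ContinuousLinearMap.mul ℝ ℝ with hL
  set f : ℕ → Sp N → ℝ := fun n => convolution q (ρ n) L volume with hf
  have hder : ∀ n y, HasFDerivAt (f n) (0 : Sp N →L[ℝ] ℝ) y := by
    intro n y
    have h1 := (hρc n).hasFDerivAt_convolution_right L hq (hρs n) y
    have hc : Continuous (fderiv ℝ (ρ n)) := (hρs n).continuous_fderiv (by norm_num)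
    have h0 : ∀ i, convolution q (fun a => fderiv ℝ (ρ n) a (EuclideanSpace.single i 1)) L volume
        = fun _ => 0 := by
      intro i
      have hcont : Continuous (convolution q
          (fun a => fderiv ℝ (ρ n) a (EuclideanSpace.single i 1)) L volume) :=
        (((hρc n).fderiv ℝ).comp_left (g := fun A : Sp N →L[ℝ] ℝ => A (EuclideanSpace.single i 1))
          rfl).continuous_convolution_right L hq (hc.clm_apply continuous_const)
      refine Continuous.ext_on (TopologicalSpace.denseRange_denseSeq (Sp N)) hcont
        continuous_const ?_
      rintro _ ⟨k, rfl⟩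
      have h2 := h n k i
      simp_rw [pderiv_mollifierTest, mul_neg] at h2
      rw [integral_neg, neg_eq_zero] at h2
      exact h2
    have hb : ∀ i, (convolution q (fderiv ℝ (ρ n)) (L.precompR (Sp N)) volume) y
        (EuclideanSpace.single i 1) = 0 := by
      intro i
      rw [convolution_precompR_apply L hq ((hρc n).fderiv ℝ) hc, h0 i]
    have hD : convolution q (fderiv ℝ (ρ n)) (L.precompR (Sp N)) volume y = 0 := by
      rw [← ContinuousLinearMap.coe_inj]
      refine (EuclideanSpace.basisFun (Fin N) ℝ).toBasis.ext fun i => ?_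
      simpa using hb i
    rw [hD] at h1
    exact h1
  have hconst : ∀ n x y, f n x = f n y := fun n x y =>
    is_const_of_fderiv_eq_zero (𝕜 := ℝ) (fun x => (hder n x).differentiableAt)
      (fun x => (hder n x).fderiv) x y
  have hconv := ContDiffBump.ae_convolution_tendsto_right_of_locallyIntegrable
    (φ := shrinkingBump (Sp N)) (tendsto_rOut_shrinkingBump (Sp N))
    (Eventually.of_forall (rOut_le_rIn_shrinkingBump (Sp N))) hq
  have hconv' : ∀ᵐ x, Tendsto (fun n => f n 0) atTop (𝓝 (q x)) := by
    filter_upwards [hconv] with x hx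
    refine hx.congr fun n => ?_
    rw [hconst n 0 x, convolution_eq_swap]
    simp only [hf, convolution, hL, ContinuousLinearMap.mul_apply',
      ContinuousLinearMap.lsmul_apply, smul_eq_mul, hρ]
    exact integral_congr_ae (ae_of_all _ fun s => mul_comm _ _)
  obtain ⟨x₀, hx₀⟩ := hconv'.exists
  exact ⟨q x₀, hconv'.mono fun x hx => tendsto_nhds_unique hx hx₀⟩

theorem MemL2L2loc.ae_locallyIntegrable {T : EReal} {p : ℝ → Sp N → ℝ} (hp : MemL2L2loc T p) :
    ∀ᵐ t ∂(timeMeasure T), LocallyIntegrable (p t) volume := by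
  have h : ∀ n : ℕ, ∀ᵐ t ∂(timeMeasure T),
      IntegrableOn (p t) (Metric.closedBall (0 : Sp N) n) volume := by
    intro n
    obtain ⟨P, -, hPt⟩ := hp _ (isCompact_closedBall (0 : Sp N) n)
    have hfin : IsFiniteMeasure (volume.restrict (Metric.closedBall (0 : Sp N) n)) :=
      ⟨by simpa using measure_closedBall_lt_top⟩
    filter_upwards [hPt] with t ht
    exact ((Lp.memLp (P t)).integrable (by norm_num)).congr ht.symm
  filter_upwards [ae_all_iff.2 h] with t ht
  rw [locallyIntegrable_iff]
  intro K hK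
  obtain ⟨r, hr⟩ := hK.isBounded.subset_closedBall (0 : Sp N)
  obtain ⟨n, hn⟩ := exists_nat_ge r
  exact (ht n).mono_set (hr.trans (Metric.closedBall_subset_closedBall hn))

theorem memLp_pressure_pairing {T : EReal} {p : ℝ → Sp N → ℝ} (hp : MemL2L2loc T p)
    {η : Sp N → ℝ} (hη : IsTest η) :
    MemLp (fun t => ∫ x, p t x * η x) 2 (timeMeasure T) := by
  obtain ⟨P, hP, hPt⟩ := hp (tsupport η) hη.2
  have hηL : MemLp η 2 (volume.restrict (tsupport η)) := (hη.memLp 2 volume).restrict _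
  refine ((innerSL ℝ (hηL.toLp η)).comp_memLp' hP).ae_eq ?_
  filter_upwards [hPt] with t ht
  rw [Function.comp_apply, innerSL_apply_apply, L2.inner_def]
  rw [← setIntegral_eq_integral_of_forall_compl_eq_zero (s := tsupport η) (μ := volume)
    (fun x hx => by simp [image_eq_zero_of_notMem_tsupport hx])]
  refine integral_congr_ae ?_
  filter_upwards [ht, hηL.coeFn_toLp] with x h1 h2
  rw [h1, h2]
  simp

theorem isOpen_timeInterval (T : EReal) : IsOpen (timeInterval T) :=
  (isOpen_lt continuous_const continuous_id).inter
    (isOpen_lt continuous_coe_real_ereal continuous_const)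

/-- The fundamental lemma of the calculus of variations, in the time variable. -/
theorem ae_eq_zero_of_timeTest {T : EReal} {a : ℝ → ℝ} (ha : MemLp a 2 (timeMeasure T))
    (h : ∀ θ, IsTimeTest T θ → ∫ t, θ t * a t ∂(timeMeasure T) = 0) :
    ∀ᵐ t ∂(timeMeasure T), a t = 0 := by
  have hloc : LocallyIntegrableOn a (timeInterval T) volume :=
    locallyIntegrableOn_of_locallyIntegrable_restrict (ha.locallyIntegrable (by norm_num))
  refine (ae_restrict_iff' (measurableSet_timeInterval T)).2
    ((isOpen_timeInterval T).ae_eq_zero_of_integral_contDiff_smul_eq_zero hloc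
      fun θ hθ hθc hθs => ?_)
  rw [← h θ ⟨hθ, hθc, fun t ht => (hθs ht).2⟩, timeMeasure,
    setIntegral_eq_integral_of_forall_compl_eq_zero]
  · rfl
  · intro t ht
    rw [image_eq_zero_of_notMem_tsupport fun h' => ht (hθs h'), zero_mul]

/-- Two pressures with the same distributional gradient differ by a square integrable function of
time. -/
theorem exists_pressure_shift {T : EReal} {p p' : ℝ → Sp N → ℝ} (hp : MemL2L2loc T p)
    (hp' : MemL2L2loc T p')
    (h : ∀ i θ (η : Sp N → ℝ), IsTimeTest T θ → IsTest η →
      ∫ t, θ t * (∫ x, p' t x * pderiv i η x) ∂(timeMeasure T) =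
        ∫ t, θ t * (∫ x, p t x * pderiv i η x) ∂(timeMeasure T)) :
    ∃ ρ : ℝ → ℝ, MemLp ρ 2 (timeMeasure T) ∧
      ∀ᵐ t ∂(timeMeasure T), ∀ᵐ x : Sp N, p' t x = p t x + ρ t := by
  have h1 : ∀ (i : Fin N) (η : Sp N → ℝ), IsTest η → ∀ᵐ t ∂(timeMeasure T),
      (∫ x, p' t x * pderiv i η x) - ∫ x, p t x * pderiv i η x = 0 := by
    intro i η hη
    have m' := memLp_pressure_pairing hp' (hη.pderiv i)
    have m := memLp_pressure_pairing hp (hη.pderiv i)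
    refine ae_eq_zero_of_timeTest (m'.sub m) fun θ hθ => ?_
    have e := h i θ η hθ hη
    have e' := integral_sub (hθ.integrable_smul m') (hθ.integrable_smul m)
    simp only [smul_eq_mul] at e'
    rw [e, sub_self] at e'
    simpa only [Pi.sub_apply, mul_sub] using e'
  -- countably many test functions share one null set of times
  have h2 : ∀ᵐ t ∂(timeMeasure T), ∀ (n k : ℕ) (i : Fin N),
      (∫ x, p' t x * pderiv i (mollifierTest n (TopologicalSpace.denseSeq (Sp N) k)) x) -
        ∫ x, p t x * pderiv i (mollifierTest n (TopologicalSpace.denseSeq (Sp N) k)) x = 0 :=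
    ae_all_iff.2 fun n => ae_all_iff.2 fun k => ae_all_iff.2 fun i =>
      h1 i _ (isTest_mollifierTest n _)
  have hconst : ∀ᵐ t ∂(timeMeasure T), ∃ c, ∀ᵐ x : Sp N, p' t x - p t x = c := by
    filter_upwards [h2, hp.ae_locallyIntegrable, hp'.ae_locallyIntegrable] with t ht hl hl'
    refine ae_eq_const_of_gradient (hl'.sub hl) fun n k i => ?_
    rw [← ht n k i]
    have hη := (isTest_mollifierTest n (TopologicalSpace.denseSeq (Sp N) k)).pderiv i
    have hi : ∀ {f : Sp N → ℝ}, LocallyIntegrable f volume → Integrable (fun x => f x *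
        pderiv i (mollifierTest n (TopologicalSpace.denseSeq (Sp N) k)) x) volume := fun hf => by
      simpa only [smul_eq_mul, mul_comm] using
        hf.integrable_smul_left_of_hasCompactSupport hη.1.continuous hη.2
    rw [← integral_sub (hi hl') (hi hl)]
    refine integral_congr_ae (ae_of_all _ fun x => ?_)
    simp only [sub_mul]
  -- the shift is recovered, measurably in time, as the average over the unit ball
  set K : Set (Sp N) := Metric.closedBall 0 1 with hK
  obtain ⟨P, hP, hPt⟩ := hp K (isCompact_closedBall _ _)
  obtain ⟨P', hP', hPt'⟩ := hp' K (isCompact_closedBall _ _)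
  have hfin : IsFiniteMeasure (volume.restrict K) := ⟨by simpa using measure_closedBall_lt_top⟩
  have hv : (volume.real K) ≠ 0 := by
    refine (ENNReal.toReal_pos ?_ measure_closedBall_lt_top.ne).ne'
    exact (Metric.measure_closedBall_pos volume _ one_pos).ne'
  have hc : MemLp (fun _ : Sp N => (volume.real K)⁻¹) 2 (volume.restrict K) := memLp_const _
  refine ⟨fun t => innerSL ℝ (hc.toLp _) ((P' - P) t),
    (innerSL ℝ (hc.toLp _)).comp_memLp' (hP'.sub hP), ?_⟩
  filter_upwards [hconst, hPt, hPt'] with t ⟨c, hct⟩ h3 h3'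
  have e : innerSL ℝ (hc.toLp _) ((P' - P) t) = c := by
    rw [innerSL_apply_apply, L2.inner_def]
    have e1 : ∫ x, inner ℝ (hc.toLp _ x) ((P' - P) t x) ∂(volume.restrict K) =
        ∫ _x, c * (volume.real K)⁻¹ ∂(volume.restrict K) := by
      refine integral_congr_ae ?_
      filter_upwards [hc.coeFn_toLp, ae_restrict_of_ae hct, h3, h3', Lp.coeFn_sub (P' t) (P t)]
        with x k1 k2 k3 k4 k5
      rw [Pi.sub_apply, k5, Pi.sub_apply, k1, ← k3, ← k4, k2]
      simp
    rw [e1, integral_const, measureReal_restrict_apply_univ, smul_eq_mul]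
    field_simp
  filter_upwards [hct] with x hx
  rw [e]
  linarith

end PressureUniqueness

/-! ### Uniqueness of solutions -/

section Uniqueness

theorem integral_pderiv_eq_zero {η : Sp N → ℝ} (hη : IsTest η) (i : Fin N) :
    ∫ x, pderiv i η x = 0 := by
  have h := hη.fourierInv_pderiv i 0
  rw [SchwartzMap.fourierInv_coe, Real.fourierInv_eq'] at h
  simp only [inner_zero_right, mul_zero, Complex.ofReal_zero, zero_mul, Complex.exp_zero, one_smul,
    IsTest.schwartz_apply, PiLp.zero_apply] at h
  rw [integral_complex_ofReal] at h
  exact_mod_cast h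

theorem MemX.congr {T : EReal} {s : ℝ} {w w' : ℝ → L2 N (Sp N)} (h : MemX T s w)
    (hw : w' =ᵐ[timeMeasure T] w) : MemX T s w' := by
  refine ⟨h.1.congr hw.symm, lt_of_le_of_lt (le_of_eq ?_) h.2⟩
  unfold xNorm lInftyHsNorm l2HsNorm
  congr 1
  · refine essSup_congr_ae ?_
    filter_upwards [hw] with t ht
    rw [ht]
  · congr 1
    refine lintegral_congr_ae ?_
    filter_upwards [hw] with t ht
    rw [ht]

theorem MemL2L2loc.add_time {T : EReal} {p p' : ℝ → Sp N → ℝ} (hp : MemL2L2loc T p) {ρ : ℝ → ℝ}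
    (hρ : MemLp ρ 2 (timeMeasure T))
    (h : ∀ᵐ t ∂(timeMeasure T), ∀ᵐ x : Sp N, p' t x = p t x + ρ t) : MemL2L2loc T p' := by
  intro K hK
  obtain ⟨P, hP, hPt⟩ := hp K hK
  have hfin : IsFiniteMeasure (volume.restrict K) := ⟨by simpa using hK.measure_lt_top⟩
  have hc : MemLp (fun _ : Sp N => (1 : ℝ)) 2 (volume.restrict K) := memLp_const _
  refine ⟨fun t => P t + ρ t • hc.toLp _,
    hP.add ((ContinuousLinearMap.toSpanSingleton ℝ (hc.toLp _)).comp_memLp' hρ), ?_⟩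
  filter_upwards [hPt, h] with t h1 h2
  filter_upwards [h1, ae_restrict_of_ae h2, Lp.coeFn_add (P t) (ρ t • hc.toLp _),
    Lp.coeFn_smul (ρ t) (hc.toLp _), hc.coeFn_toLp] with x k1 k2 k3 k4 k5
  rw [k3, Pi.add_apply, k4, Pi.smul_apply, k5, k2, k1]
  simp

/-- Adding a function of time to the pressure, and changing the fields on a null set of times,
preserves solutions. -/
theorem IsSolution.of_ae_eq {T : EReal} {s : ℝ} {u₀ d₀ : L2 N (Sp N)}
    {F : ℝ → L2 N (Mat N)} {g u u' d d' : ℝ → L2 N (Sp N)} {p p' : ℝ → Sp N → ℝ}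
    (h : IsSolution T s u₀ d₀ F g u p d) (hu : u' =ᵐ[timeMeasure T] u)
    (hd : d' =ᵐ[timeMeasure T] d) {ρ : ℝ → ℝ} (hρ : MemLp ρ 2 (timeMeasure T))
    (hp : ∀ᵐ t ∂(timeMeasure T), ∀ᵐ x : Sp N, p' t x = p t x + ρ t) :
    IsSolution T s u₀ d₀ F g u' p' d' := by
  refine ⟨h.u_mem.congr hu, h.p_mem.add_time hρ hp, h.d_mem.congr hd, fun i φ hφ => ?_, ?_,
    fun i φ hφ => ?_⟩
  · have hφs := hφ.smooth
    have hQ := hφs.tderiv.add hφs.xlap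
    refine Eq.trans ?_ (h.momentum i φ hφ)
    congr 1
    refine integral_congr_ae ?_
    filter_upwards [hu, hp, (integrable_pressure_pairing h.p_mem (hφs.xderiv i)).1]
      with t h1 h2 h3
    have i1 := integrable_coord_mul i (u t) (hQ.slice t)
    have i3 := fun j => integrable_coord_mul (i, j) (F t) ((hφs.xderiv j).slice t)
    have i4 := (i1.add h3).sub (integrable_finsetSum Finset.univ fun j _ => i3 j)
    have ht := (hφs.xderiv i).slice t
    have i5 : Integrable fun x => ρ t * xderiv i φ t x :=
      (memLp_one_iff_integrable.1 (ht.memLp 1 volume)).const_mul (ρ t)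
    have e1 := integral_add i4 i5
    have e2 : ∫ x, ρ t * xderiv i φ t x = 0 := by
      rw [integral_const_mul]
      have := integral_pderiv_eq_zero (hφs.slice t) i
      rw [show ∫ x, xderiv i φ t x = 0 from this, mul_zero]
    rw [e2, add_zero] at e1
    refine Eq.trans (integral_congr_ae ?_) e1
    filter_upwards [h2] with x hx
    simp only [Pi.add_apply, Pi.sub_apply]
    rw [h1, hx]
    ring
  · filter_upwards [hu, h.incompressible] with t h1 h2
    rwa [h1]
  · refine Eq.trans ?_ (h.heat i φ hφ)
    congr 1
    refine integral_congr_ae ?_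
    filter_upwards [hd] with t ht
    rw [ht]

/-- The difference of two solutions solves the homogeneous equations, whose solutions vanish,
up to a pressure depending on time only. -/
theorem IsSolution.isUniqueSolution {T : EReal} (hN : 0 < N) {s : ℝ} (hs : 0 ≤ s)
    {u₀ d₀ : L2 N (Sp N)} {F : ℝ → L2 N (Mat N)} {g u d : ℝ → L2 N (Sp N)} {p : ℝ → Sp N → ℝ}
    (hF : MemLp F 2 (timeMeasure T)) (hg : MemLp g 2 (timeMeasure T))
    (h : IsSolution T s u₀ d₀ F g u p d) : IsUniqueSolution T s u₀ d₀ F g u p d := by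
  refine ⟨h, fun u' p' d' => ⟨fun h' => ?_, fun ⟨hu, hd, ρ, hρ, hp⟩ => h.of_ae_eq hu hd hρ hp⟩⟩
  have hdL := h.d_mem.memLp (by linarith)
  have hdL' := h'.d_mem.memLp (by linarith)
  have huL := h.u_mem.memLp hs
  have huL' := h'.u_mem.memLp hs
  have hd : d' =ᵐ[timeMeasure T] d := by
    have := ae_eq_zero_of_weak_heat (hdL'.sub hdL) fun i φ hφ => by
      have e := integral_pairing_sub hdL hdL' i (hφ.smooth.tderiv.add hφ.smooth.xlap)
      rw [e, h'.heat_split hs hg i hφ, h.heat_split hs hg i hφ, sub_self]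
    filter_upwards [this] with t ht
    exact sub_eq_zero.1 ht
  have hu : u' =ᵐ[timeMeasure T] u := by
    have := ae_eq_zero_of_weak_curl hN (huL'.sub huL) ?_ ?_
    · filter_upwards [this] with t ht
      exact sub_eq_zero.1 ht
    · filter_upwards [h.incompressible, h'.incompressible] with t h1 h2
      have e : ∀ j, 𝓕 (coordC j ((u' - u) t)) =
          (𝓕 (coordC j (u' t)) - 𝓕 (coordC j (u t)) : L2 N ℂ) := fun j => by
        rw [Pi.sub_apply, coordC_sub]
        exact map_sub (Lp.fourierTransformₗᵢ (Sp N) ℂ) _ _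
      filter_upwards [h1.sum_fourier_eq_zero, h2.sum_fourier_eq_zero,
        ae_all_iff.2 fun j => Lp.coeFn_sub (𝓕 (coordC j (u' t)) : L2 N ℂ) (𝓕 (coordC j (u t)))]
        with ξ k1 k2 k3
      simp_rw [e, k3, Pi.sub_apply, mul_sub]
      rw [Finset.sum_sub_distrib, k1, k2, sub_zero]
    · intro i j θ η hθ hη
      -- both test functions give the pressure term `∫ p θ ∂_i ∂_j η`
      have s1 := hθ.isSpaceTimeTest (hη.pderiv j)
      have s2 := hθ.isSpaceTimeTest (hη.pderiv i)
      have e1 := integral_pairing_sub huL huL' i (s1.smooth.tderiv.add s1.smooth.xlap)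
      have e2 := integral_pairing_sub huL huL' j (s2.smooth.tderiv.add s2.smooth.xlap)
      rw [e1, e2]
      have a1 := (h'.momentum_split hs hF i s1).trans (h.momentum_split hs hF i s1).symm
      have a2 := (h'.momentum_split hs hF j s2).trans (h.momentum_split hs hF j s2).symm
      simp_rw [xderiv_prod θ (hη.pderiv j)] at a1
      simp_rw [xderiv_prod θ (hη.pderiv i), pderiv_comm hη j i] at a2
      linarith
  refine ⟨hu, hd, exists_pressure_shift h.p_mem h'.p_mem fun i θ η hθ hη => ?_⟩
  have s1 := hθ.isSpaceTimeTest hη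
  have a1 := (h'.momentum_split hs hF i s1).trans (h.momentum_split hs hF i s1).symm
  have e : ∫ t, (∫ x, u' t x i * (tderiv (fun z : ℝ × Sp N => θ z.1 * η z.2) t x +
      xlap (fun z : ℝ × Sp N => θ z.1 * η z.2) t x)) ∂(timeMeasure T) =
      ∫ t, (∫ x, u t x i * (tderiv (fun z : ℝ × Sp N => θ z.1 * η z.2) t x +
      xlap (fun z : ℝ × Sp N => θ z.1 * η z.2) t x)) ∂(timeMeasure T) := by
    refine integral_congr_ae ?_
    filter_upwards [hu] with t ht
    rw [ht]
  rw [e, add_right_inj] at a1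
  simp_rw [xderiv_prod θ hη] at a1
  have e3 : ∀ (p : ℝ → Sp N → ℝ) t, θ t * ∫ x, p t x * pderiv i η x =
      ∫ x, p t x * (θ t * pderiv i η x) := fun p t => by
    rw [← integral_const_mul]
    refine integral_congr_ae (ae_of_all _ fun x => ?_)
    simp only
    ring
  simp_rw [e3]
  exact a1

end Uniqueness

end StokesHeat

end

noncomputable section

namespace StokesHeat

open Filter Topology Set

variable {N : ℕ}

/-! ### Dependence of the bounds on the data -/

section Constants

theorem lintegral_fourier_coordC_le {ι : Type} [Fintype ι] (r : ℝ)
    (f : L2 N (EuclideanSpace ℝ ι)) (k : ι) :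
    ∫⁻ ξ, weight r ξ * ‖(𝓕 (coordC k f) : L2 N ℂ) ξ‖ₑ ^ 2 ≤ hsNorm r f ^ 2 := by
  rw [sq_hsNorm]
  exact Finset.single_le_sum
    (f := fun k => ∫⁻ ξ, weight r ξ * ‖(𝓕 (coordC k f) : L2 N ℂ) ξ‖ₑ ^ 2)
    (fun _ _ => zero_le) (Finset.mem_univ k)

variable {T : EReal} {s : ℝ} {u₀ d₀ : L2 N (Sp N)} {F : ℝ → L2 N (Mat N)} {g : ℝ → L2 N (Sp N)}
  {W : Fin N × Fin N → ℝ × Sp N → ℂ} {V : Fin N → ℝ × Sp N → ℂ}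

/-- The energies of the initial velocity and of the projected forcing are controlled by the data.
The divergence costs one derivative, which the heat equation with forcing in `H^{s-1}` affords. -/
theorem stokes_data_energy_le (hW : ∀ q, StronglyMeasurable (W q))
    (hWt : ∀ᵐ t ∂(timeMeasure T), ∀ q,
      (𝓕 (coordC q (F t)) : L2 N ℂ) =ᵐ[volume] fun ξ => W q (t, ξ))
    {X : ℝ≥0∞} (h₀ : hsNorm s u₀ ≤ X) (hFX : l2HsNorm T s F ≤ X) (k : Fin N) :
    (∫⁻ ξ, weight s ξ * ‖(𝓕 (coordC k u₀) : L2 N ℂ) ξ‖ₑ ^ 2) +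
      forcingEnergy T (s - 1) (stokesForcing W k) ≤
        (1 + ENNReal.ofReal (4 * (N * N))) * X ^ 2 := by
  have h2 := forcingEnergy_stokes_le T s hW k
  rw [sum_forcingEnergy_eq s hW hWt] at h2
  calc _ ≤ hsNorm s u₀ ^ 2 + ENNReal.ofReal (4 * (N * N)) * l2HsNorm T s F ^ 2 :=
        add_le_add (lintegral_fourier_coordC_le s u₀ k) h2
    _ ≤ X ^ 2 + ENNReal.ofReal (4 * (N * N)) * X ^ 2 := by gcongr
    _ = _ := by ring

theorem heat_data_energy_le (hV : ∀ k, StronglyMeasurable (V k))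
    (hVt : ∀ᵐ t ∂(timeMeasure T), ∀ k,
      (𝓕 (coordC k (g t)) : L2 N ℂ) =ᵐ[volume] fun ξ => V k (t, ξ))
    {X : ℝ≥0∞} (h₀ : hsNorm (s + 1) d₀ ≤ X) (hgX : l2HsNorm T s g ≤ X) (k : Fin N) :
    (∫⁻ ξ, weight (s + 1) ξ * ‖(𝓕 (coordC k d₀) : L2 N ℂ) ξ‖ₑ ^ 2) +
      forcingEnergy T (s + 1 - 1) (V k) ≤ (1 + 1) * X ^ 2 := by
  have h2 : forcingEnergy T (s + 1 - 1) (V k) ≤ l2HsNorm T s g ^ 2 := by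
    rw [add_sub_cancel_right, ← sum_forcingEnergy_eq s hV hVt]
    exact Finset.single_le_sum (f := fun k => forcingEnergy T s (V k))
      (fun _ _ => zero_le) (Finset.mem_univ k)
  calc _ ≤ hsNorm (s + 1) d₀ ^ 2 + l2HsNorm T s g ^ 2 :=
        add_le_add (lintegral_fourier_coordC_le (s + 1) d₀ k) h2
    _ ≤ X ^ 2 + X ^ 2 := by gcongr
    _ = _ := by ring

/-- Componentwise energy bounds that are quadratic in the size `X` of the data give a unique
solution with a linear bound. -/
theorem exists_isUniqueSolution_of_energyBound (hN : 0 < N) (hT : 0 < T) (hs : 0 ≤ s)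
    (hdiv : IsDivFree u₀) (hF : MemL2Hs T s F) (hg : MemL2Hs T s g)
    (hW : ∀ q, StronglyMeasurable (W q))
    (hWt : ∀ᵐ t ∂(timeMeasure T), ∀ q,
      (𝓕 (coordC q (F t)) : L2 N ℂ) =ᵐ[volume] fun ξ => W q (t, ξ))
    (hV : ∀ k, StronglyMeasurable (V k))
    (hVt : ∀ᵐ t ∂(timeMeasure T), ∀ k,
      (𝓕 (coordC k (g t)) : L2 N ℂ) =ᵐ[volume] fun ξ => V k (t, ξ))
    {B X : ℝ≥0∞} (hB : B ≠ ∞) (hX : X ≠ ∞)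
    (hbu : ∀ k, HasEnergyBound T s (𝓕 (coordC k u₀) : L2 N ℂ) (stokesForcing W k) (B * X ^ 2))
    (hbd : ∀ k, HasEnergyBound T (s + 1) (𝓕 (coordC k d₀) : L2 N ℂ) (V k) (B * X ^ 2)) :
    ∃ (u : ℝ → L2 N (Sp N)) (p : ℝ → Sp N → ℝ) (d : ℝ → L2 N (Sp N)),
      IsUniqueSolution T s u₀ d₀ F g u p d ∧
        xNorm T s u + xNorm T (s + 1) d ≤ (4 * (N * B) ^ (1 / 2 : ℝ)).toNNReal * X := by
  have hM : B * X ^ 2 < ∞ := (ENNReal.mul_ne_top hB (ENNReal.pow_ne_top hX)).lt_top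
  obtain ⟨u, p, d, h, hu, hd⟩ := exists_solution hT hs hdiv hF hg hW hWt hV hVt hM hM hbu hbd
  refine ⟨u, p, d, h.isUniqueSolution hN hs (hF.memLp hs) (hg.memLp hs), ?_⟩
  have e : ((N : ℝ≥0∞) * (B * X ^ 2)) ^ (1 / 2 : ℝ) = (N * B) ^ (1 / 2 : ℝ) * X := by
    rw [← mul_assoc, ENNReal.mul_rpow_of_nonneg _ _ (by norm_num), ← ENNReal.rpow_natCast X 2,
      ← ENNReal.rpow_mul]
    norm_num
  have hfin : 4 * ((N : ℝ≥0∞) * B) ^ (1 / 2 : ℝ) ≠ ∞ :=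
    ENNReal.mul_ne_top (by norm_num) (ENNReal.rpow_ne_top_of_nonneg (by norm_num)
      (ENNReal.mul_ne_top (ENNReal.natCast_ne_top N) hB))
  rw [ENNReal.coe_toNNReal hfin]
  rw [e] at hu hd
  calc _ ≤ 2 * ((N * B) ^ (1 / 2 : ℝ) * X) + 2 * ((N * B) ^ (1 / 2 : ℝ) * X) := add_le_add hu hd
    _ = _ := by ring

/-- The case of a bounded time interval: the kernel mass is comparable with `1 / (1 + |2πξ|²)` at
all frequencies. -/
theorem exists_uniqueSolution_finite (hN : 0 < N) (hs : 0 ≤ s) {T : ℝ} (hT : 0 < T) :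
    ∃ C : ℝ≥0, ∀ (u₀ d₀ : L2 N (Sp N)) (F : ℝ → L2 N (Mat N)) (g : ℝ → L2 N (Sp N)),
      hsNorm s u₀ < ∞ → IsDivFree u₀ → hsNorm (s + 1) d₀ < ∞ →
      MemL2Hs (T : EReal) s F → MemL2Hs (T : EReal) s g →
      ∃ (u : ℝ → L2 N (Sp N)) (p : ℝ → Sp N → ℝ) (d : ℝ → L2 N (Sp N)),
        IsUniqueSolution (T : EReal) s u₀ d₀ F g u p d ∧
        xNorm (T : EReal) s u + xNorm (T : EReal) (s + 1) d ≤
          C * (hsNorm s u₀ + hsNorm (s + 1) d₀ + l2HsNorm (T : EReal) s F +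
            l2HsNorm (T : EReal) s g) := by
  set A : ℝ≥0∞ := 2 * (1 + ENNReal.ofReal (T + 1)) ^ 2 with hA
  set B : ℝ≥0∞ := A * (1 + ENNReal.ofReal (4 * (N * N)) + 1) with hBdef
  have hA' : A ≠ ∞ := by finiteness
  have hB : B ≠ ∞ := by finiteness
  refine ⟨(4 * (N * B) ^ (1 / 2 : ℝ)).toNNReal, fun u₀ d₀ F g hu hdiv hd hF hg => ?_⟩
  obtain ⟨W, hW, hWt⟩ := exists_fourier_representative hF.1
  obtain ⟨V, hV, hVt⟩ := exists_fourier_representative hg.1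
  set X := hsNorm s u₀ + hsNorm (s + 1) d₀ + l2HsNorm (T : EReal) s F +
    l2HsNorm (T : EReal) s g with hX
  have x1 : hsNorm s u₀ ≤ X := by
    rw [hX, add_assoc, add_assoc]; exact le_self_add
  have x2 : hsNorm (s + 1) d₀ ≤ X := (le_add_self.trans le_self_add).trans le_self_add
  have x3 : l2HsNorm (T : EReal) s F ≤ X := le_add_self.trans le_self_add
  have x4 : l2HsNorm (T : EReal) s g ≤ X := le_add_self
  refine exists_isUniqueSolution_of_energyBound hN (EReal.coe_pos.2 hT) hs hdiv hF hg hW hWt hV hVt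
    hB (ENNReal.add_lt_top.2 ⟨ENNReal.add_lt_top.2 ⟨ENNReal.add_lt_top.2 ⟨hu, hd⟩, hF.2⟩, hg.2⟩).ne
    (fun k => ?_) fun k => ?_
  · refine (heatSol_energy_finite hT s (Lp.stronglyMeasurable _)
      (stronglyMeasurable_stokesForcing hW k)).mono ?_
    rw [← hA, hBdef, mul_assoc A]
    refine mul_le_mul_right ((stokes_data_energy_le hW hWt x1 x3 k).trans ?_) _
    exact mul_le_mul_left le_self_add _
  · refine (heatSol_energy_finite hT (s + 1) (Lp.stronglyMeasurable _) (hV k)).mono ?_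
    rw [← hA, hBdef, mul_assoc A]
    refine mul_le_mul_right ((heat_data_energy_le hV hVt x2 x4 k).trans ?_) _
    exact mul_le_mul_left (add_le_add_left le_self_add _) _

/-- The `L¹` bounds on the data of the Stokes equation bound its Fourier transform uniformly. -/
theorem ae_stokes_data_le (hWm : ∀ q, StronglyMeasurable (W q))
    (hWt : ∀ᵐ t ∂(timeMeasure T), ∀ q,
      (𝓕 (coordC q (F t)) : L2 N ℂ) =ᵐ[volume] fun ξ => W q (t, ξ))
    (h₀ : eLpNorm u₀ 1 volume < ∞)
    {h : ℝ → Lp (Sp N) 1 (volume : Measure (Sp N))} (hh : Integrable h (timeMeasure T))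
    (hdiv : ∀ᵐ t ∂(timeMeasure T), IsDiv (F t) (h t)) (k : Fin N) :
    ∀ᵐ ξ : Sp N, ‖(𝓕 (coordC k u₀) : L2 N ℂ) ξ‖ₑ +
      ∫⁻ t, ‖stokesForcing W k (t, ξ)‖ₑ ∂(timeMeasure T) ≤
        eLpNorm u₀ 1 volume + (N + 1) * ∫⁻ t, ‖h t‖ₑ ∂(timeMeasure T) := by
  have hm : AEMeasurable (fun t => ‖h t‖ₑ) (timeMeasure T) := hh.aestronglyMeasurable.enorm
  have h1 := ae_lintegral_le_of_ae_le (stronglyMeasurable_stokesForcing hWm k)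
    (hm.const_mul ((N : ℝ≥0∞) + 1)) <| by
      filter_upwards [hWt, hdiv] with t ht hdt
      filter_upwards [ae_all_iff.2 ht, ae_all_iff.2 hdt.enorm_fourier_le] with ξ e1 e2
      refine enorm_stokesForcing_le (fun i => ?_) k
      simpa only [e1] using e2 i
  rw [lintegral_const_mul' _ _ (by finiteness)] at h1
  filter_upwards [enorm_fourier_coordC_le u₀ h₀ k, h1] with ξ a b
  exact add_le_add a b

/-- The `L¹` bounds on the data of the heat equation bound its Fourier transform uniformly. -/
theorem ae_heat_data_le (hV : ∀ k, StronglyMeasurable (V k))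
    (hVt : ∀ᵐ t ∂(timeMeasure T), ∀ k,
      (𝓕 (coordC k (g t)) : L2 N ℂ) =ᵐ[volume] fun ξ => V k (t, ξ))
    (h₀ : eLpNorm d₀ 1 volume < ∞) (hg : AEStronglyMeasurable g (timeMeasure T))
    (hg1 : ∫⁻ t, eLpNorm (g t) 1 volume ∂(timeMeasure T) < ∞) (k : Fin N) :
    ∀ᵐ ξ : Sp N, ‖(𝓕 (coordC k d₀) : L2 N ℂ) ξ‖ₑ + ∫⁻ t, ‖V k (t, ξ)‖ₑ ∂(timeMeasure T) ≤
        eLpNorm d₀ 1 volume + ∫⁻ t, eLpNorm (g t) 1 volume ∂(timeMeasure T) := by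
  have hm := aemeasurable_eLpNorm_one hg
  have h1 := ae_lintegral_le_of_ae_le (hV k) hm <| by
    filter_upwards [hVt, ae_lt_top' hm hg1.ne] with t ht hgt
    filter_upwards [ht k, enorm_fourier_coordC_le (g t) hgt k] with ξ e1 e2
    rwa [← e1]
  filter_upwards [enorm_fourier_coordC_le d₀ h₀ k, h1] with ξ a b
  exact add_le_add a b

theorem le_sum_of_eight (a₁ a₂ a₃ a₄ a₅ a₆ a₇ a₈ : ℝ≥0∞) :
    a₁ ≤ (a₁ + a₂) + (a₃ + a₄) + (a₅ + a₆) + a₇ + a₈ ∧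
    a₃ ≤ (a₁ + a₂) + (a₃ + a₄) + (a₅ + a₆) + a₇ + a₈ ∧
    a₇ ≤ (a₁ + a₂) + (a₃ + a₄) + (a₅ + a₆) + a₇ + a₈ ∧
    a₈ ≤ (a₁ + a₂) + (a₃ + a₄) + (a₅ + a₆) + a₇ + a₈ ∧
    a₂ + a₅ ≤ (a₁ + a₂) + (a₃ + a₄) + (a₅ + a₆) + a₇ + a₈ ∧
    a₄ + a₆ ≤ (a₁ + a₂) + (a₃ + a₄) + (a₅ + a₆) + a₇ + a₈ := by
  refine ⟨?_, ?_, le_add_self.trans le_self_add, le_add_self, ?_, ?_⟩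
  · exact le_of_le_of_eq (le_self_add (b := a₂ + (a₃ + a₄) + (a₅ + a₆) + a₇ + a₈)) (by ring)
  · exact le_of_le_of_eq (le_self_add (b := a₁ + a₂ + a₄ + (a₅ + a₆) + a₇ + a₈)) (by ring)
  · exact le_of_le_of_eq (le_self_add (b := a₁ + (a₃ + a₄) + a₆ + a₇ + a₈)) (by ring)
  · exact le_of_le_of_eq (le_self_add (b := a₁ + a₂ + a₃ + a₅ + a₇ + a₈)) (by ring)

/-- The case of the half line, where low frequencies are controlled by the `L¹` norms. -/
theorem exists_uniqueSolution_top (hN : 3 ≤ N) (hs : 0 ≤ s) :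
    ∃ C : ℝ≥0, ∀ (u₀ d₀ : L2 N (Sp N)) (F : ℝ → L2 N (Mat N)) (g : ℝ → L2 N (Sp N))
      (h : ℝ → Lp (Sp N) 1 (volume : Measure (Sp N))),
      hsNorm s u₀ < ∞ → IsDivFree u₀ → hsNorm (s + 1) d₀ < ∞ →
      MemL2Hs ⊤ s F → MemL2Hs ⊤ s g →
      eLpNorm u₀ 1 volume < ∞ → eLpNorm d₀ 1 volume < ∞ →
      (∫⁻ t, eLpNorm (g t) 1 volume ∂(timeMeasure ⊤)) < ∞ →
      Integrable h (timeMeasure ⊤) →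
      (∀ᵐ t ∂(timeMeasure ⊤), IsDiv (F t) (h t)) →
      ∃ (u : ℝ → L2 N (Sp N)) (p : ℝ → Sp N → ℝ) (d : ℝ → L2 N (Sp N)),
        IsUniqueSolution ⊤ s u₀ d₀ F g u p d ∧
        xNorm ⊤ s u + xNorm ⊤ (s + 1) d ≤
          C * ((hsNorm s u₀ + eLpNorm u₀ 1 volume) +
            (hsNorm (s + 1) d₀ + eLpNorm d₀ 1 volume) +
            ((∫⁻ t, ‖h t‖ₑ ∂(timeMeasure ⊤)) +
              ∫⁻ t, eLpNorm (g t) 1 volume ∂(timeMeasure ⊤)) +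
            l2HsNorm ⊤ s F + l2HsNorm ⊤ s g) := by
  obtain ⟨Cu, hCu⟩ := exists_heatSol_energy_top hN hs
  obtain ⟨Cd, hCd⟩ := exists_heatSol_energy_top hN (add_nonneg hs zero_le_one)
  set K : ℝ≥0∞ := 1 + ENNReal.ofReal (4 * (N * N)) + 1 + (N + 1) ^ 2 with hK
  set B : ℝ≥0∞ := (Cu + Cd) * K with hBdef
  have hB : B ≠ ∞ := by finiteness
  refine ⟨(4 * (N * B) ^ (1 / 2 : ℝ)).toNNReal,
    fun u₀ d₀ F g h hu hdiv hd hF hg hu1 hd1 hg1 hh hFh => ?_⟩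
  obtain ⟨W, hW, hWt⟩ := exists_fourier_representative hF.1
  obtain ⟨V, hV, hVt⟩ := exists_fourier_representative hg.1
  have hh1 : ∫⁻ t, ‖h t‖ₑ ∂(timeMeasure ⊤) < ∞ := hh.hasFiniteIntegral
  obtain ⟨x1, x3, x7, x8, x25, x46⟩ := le_sum_of_eight (hsNorm s u₀) (eLpNorm u₀ 1 volume)
    (hsNorm (s + 1) d₀) (eLpNorm d₀ 1 volume) (∫⁻ t, ‖h t‖ₑ ∂(timeMeasure ⊤))
    (∫⁻ t, eLpNorm (g t) 1 volume ∂(timeMeasure ⊤)) (l2HsNorm ⊤ s F) (l2HsNorm ⊤ s g)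
  have hX' : (hsNorm s u₀ + eLpNorm u₀ 1 volume) + (hsNorm (s + 1) d₀ + eLpNorm d₀ 1 volume) +
      ((∫⁻ t, ‖h t‖ₑ ∂(timeMeasure ⊤)) + ∫⁻ t, eLpNorm (g t) 1 volume ∂(timeMeasure ⊤)) +
      l2HsNorm ⊤ s F + l2HsNorm ⊤ s g ≠ ∞ :=
    ENNReal.add_ne_top.2 ⟨ENNReal.add_ne_top.2 ⟨ENNReal.add_ne_top.2 ⟨ENNReal.add_ne_top.2
      ⟨ENNReal.add_ne_top.2 ⟨hu.ne, hu1.ne⟩, ENNReal.add_ne_top.2 ⟨hd.ne, hd1.ne⟩⟩,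
      ENNReal.add_ne_top.2 ⟨hh1.ne, hg1.ne⟩⟩, hF.2.ne⟩, hg.2.ne⟩
  generalize (hsNorm s u₀ + eLpNorm u₀ 1 volume) + (hsNorm (s + 1) d₀ + eLpNorm d₀ 1 volume) +
      ((∫⁻ t, ‖h t‖ₑ ∂(timeMeasure ⊤)) + ∫⁻ t, eLpNorm (g t) 1 volume ∂(timeMeasure ⊤)) +
      l2HsNorm ⊤ s F + l2HsNorm ⊤ s g = X at x1 x3 x7 x8 x25 x46 hX' ⊢
  have n1 : (1 : ℝ≥0∞) ≤ N + 1 := le_add_self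
  refine exists_isUniqueSolution_of_energyBound (by omega) EReal.zero_lt_top hs hdiv hF hg
    hW hWt hV hVt hB hX' (fun k => ?_) fun k => ?_
  · have hm : eLpNorm u₀ 1 volume + (N + 1) * ∫⁻ t, ‖h t‖ₑ ∂(timeMeasure ⊤) ≤ (N + 1) * X :=
      calc
          eLpNorm u₀ 1 volume + (N + 1) * ∫⁻ t, ‖h t‖ₑ ∂(timeMeasure ⊤)
          ≤ (N + 1) * eLpNorm u₀ 1 volume + (N + 1) * ∫⁻ t, ‖h t‖ₑ ∂(timeMeasure ⊤) := by
            gcongr; exact le_mul_of_one_le_left' n1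
        _ ≤ (N + 1) * X := by rw [← mul_add]; gcongr
    refine (hCu _ _ ((N + 1) * X) (Lp.stronglyMeasurable _) (stronglyMeasurable_stokesForcing hW k)
      ?_).mono ?_
    · filter_upwards [ae_stokes_data_le hW hWt hu1 hh hFh k] with ξ hξ
      exact hξ.trans hm
    · calc _ ≤ (Cu : ℝ≥0∞) * ((1 + ENNReal.ofReal (4 * (N * N))) * X ^ 2 + ((N + 1) * X) ^ 2) := by
            gcongr
            exact stokes_data_energy_le hW hWt x1 x7 k
        _ = Cu * ((1 + ENNReal.ofReal (4 * (N * N)) + (N + 1) ^ 2) * X ^ 2) := by ring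
        _ ≤ (Cu + Cd) * (K * X ^ 2) := by
            gcongr
            · exact le_self_add
            · exact add_le_add_left le_self_add _
        _ = _ := by rw [hBdef]; ring
  · refine (hCd _ _ X (Lp.stronglyMeasurable _) (hV k) ?_).mono ?_
    · filter_upwards [ae_heat_data_le hV hVt hd1 hg.1 hg1 k] with ξ hξ
      exact hξ.trans x46
    · calc _ ≤ (Cd : ℝ≥0∞) * ((1 + 1) * X ^ 2 + X ^ 2) := by
            gcongr
            exact heat_data_energy_le hV hVt x3 x8 k
        _ = Cd * ((1 + 1 + 1) * X ^ 2) := by ring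
        _ ≤ (Cu + Cd) * (K * X ^ 2) := by
            gcongr
            · exact le_add_self
            · rw [hK]
              gcongr
              · exact le_self_add
              · exact one_le_pow₀ n1
        _ = _ := by rw [hBdef]; ring

end Constants

end StokesHeat

end

theorem theoremt (N : ℕ) (hN : 3 ≤ N) (s : ℝ) (hs : 0 ≤ s) :
    (∀ T : ℝ, 0 < T → ∃ C : ℝ≥0,
      ∀ (u₀ d₀ : StokesHeat.L2 N (StokesHeat.Sp N))
        (F : ℝ → StokesHeat.L2 N (StokesHeat.Mat N)) (g : ℝ → StokesHeat.L2 N (StokesHeat.Sp N)),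
        StokesHeat.hsNorm s u₀ < ∞ → StokesHeat.IsDivFree u₀ →
        StokesHeat.hsNorm (s + 1) d₀ < ∞ →
        StokesHeat.MemL2Hs (T : EReal) s F → StokesHeat.MemL2Hs (T : EReal) s g →
        ∃ (u : ℝ → StokesHeat.L2 N (StokesHeat.Sp N)) (p : ℝ → StokesHeat.Sp N → ℝ)
          (d : ℝ → StokesHeat.L2 N (StokesHeat.Sp N)),
          StokesHeat.IsUniqueSolution (T : EReal) s u₀ d₀ F g u p d ∧
          StokesHeat.xNorm (T : EReal) s u + StokesHeat.xNorm (T : EReal) (s + 1) d ≤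
            C * (StokesHeat.hsNorm s u₀ + StokesHeat.hsNorm (s + 1) d₀ +
              StokesHeat.l2HsNorm (T : EReal) s F + StokesHeat.l2HsNorm (T : EReal) s g)) ∧
    (∃ C : ℝ≥0,
      ∀ (u₀ d₀ : StokesHeat.L2 N (StokesHeat.Sp N))
        (F : ℝ → StokesHeat.L2 N (StokesHeat.Mat N)) (g : ℝ → StokesHeat.L2 N (StokesHeat.Sp N))
        (h : ℝ → Lp (StokesHeat.Sp N) 1 (volume : Measure (StokesHeat.Sp N))),
        StokesHeat.hsNorm s u₀ < ∞ → StokesHeat.IsDivFree u₀ →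
        StokesHeat.hsNorm (s + 1) d₀ < ∞ →
        StokesHeat.MemL2Hs ⊤ s F → StokesHeat.MemL2Hs ⊤ s g →
        eLpNorm u₀ 1 volume < ∞ → eLpNorm d₀ 1 volume < ∞ →
        (∫⁻ t, eLpNorm (g t) 1 volume ∂(StokesHeat.timeMeasure ⊤)) < ∞ →
        Integrable h (StokesHeat.timeMeasure ⊤) →
        (∀ᵐ t ∂(StokesHeat.timeMeasure ⊤), StokesHeat.IsDiv (F t) (h t)) →
        ∃ (u : ℝ → StokesHeat.L2 N (StokesHeat.Sp N)) (p : ℝ → StokesHeat.Sp N → ℝ)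
          (d : ℝ → StokesHeat.L2 N (StokesHeat.Sp N)),
          StokesHeat.IsUniqueSolution ⊤ s u₀ d₀ F g u p d ∧
          StokesHeat.xNorm ⊤ s u + StokesHeat.xNorm ⊤ (s + 1) d ≤
            C * ((StokesHeat.hsNorm s u₀ + eLpNorm u₀ 1 volume) +
              (StokesHeat.hsNorm (s + 1) d₀ + eLpNorm d₀ 1 volume) +
              ((∫⁻ t, ‖h t‖ₑ ∂(StokesHeat.timeMeasure ⊤)) +
                ∫⁻ t, eLpNorm (g t) 1 volume ∂(StokesHeat.timeMeasure ⊤)) +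
              StokesHeat.l2HsNorm ⊤ s F + StokesHeat.l2HsNorm ⊤ s g)) :=
  ⟨fun _ hT => StokesHeat.exists_uniqueSolution_finite (by omega) hs hT,
    StokesHeat.exists_uniqueSolution_top hN hs⟩
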